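/- Let $k$ be a field of characteristic different from $2$. All super-algebras are $\mathbb{Z}/2$-graded $k$-algebras that are super-commutative, i.e. $ba=(-1)^{|a||b|}ab$ for homogeneous $a,b$; $\otimes=\otimes_k$, and tensor products of super-algebras carry the product $(a\otimes b)(c\otimes d)=(-1)^{|b||c|}ac\otimes bd$. Let $H$ be a (super-commutative) Hopf super-algebra with comultiplication $\Delta(h)=h_{(1)}\otimes h_{(2)}$ and counit $\varepsilon$, let $\overline H=H/(H_1)$ be its quotient by the ideal generated by the odd component (an ordinary commutative Hopf algebra), and write $h\mapsto\overline h$ for the quotient map. Let $\mathtt{SMod}^H$ be the tensor category of right $H$-super-comodules. For a Hopf super-algebra $H$, an $H$-Galois extension $A/B$ consists of an algebra $A=(A,\rho)$ in $\mathtt{SMod}^H$, $\rho:A\to A\otimes H$, $\rho(a)=a_{(0)}\otimes a_{(1)}$, together with an identification of the super-algebra $B$ with the super-subalgebra $A^{\mathrm{co}H}=\{a\in A\mid\rho(a)=a\otimes 1\}$, such that $A$ is faithfully flat over $B$ and the map $\beta:A\otimes_BA\to A\otimes H$, $\beta(a\otimes a')=a\,\rho(a')$, is bijective. For an algebra $(D,\rho_D)$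 in $\mathtt{SMod}^{\overline H}$ put $$D\,\square_{\overline H}H=\Big\{\sum_i d_i\otimes h_i\in D\otimes H\ \Big|\ \sum_i\rho_D(d_i)\otimes h_i=\sum_i d_i\otimes\overline{(h_i)_{(1)}}\otimes (h_i)_{(2)}\Big\},$$ an algebra in $\mathtt{SMod}^H$ with the product of $D\otimes H$ and the coaction $\mathrm{id}\otimes\Delta$. An $H$-Galois extension $A/B$ is said to arise from an $\overline H$-Galois extension $D/B$ if $A$ is isomorphic to $D\,\square_{\overline H}H$ as an algebra in $\mathtt{SMod}^H$ over $B$. Let $R={}^{\mathrm{co}\overline H}H=\{h\in H\mid\overline{h_{(1)}}\otimes h_{(2)}=\overline 1\otimes h\}$. It is a super-subalgebra of $H$ with $\Delta(R)\subset R\otimes H$, hence an algebra in $\mathtt{SMod}^H$. Let $R^+=R\cap\ker\varepsilon$. **Proposition.** Let $B\neq 0$ be a super-algebra and let $A=(A,\rho)$ be an $H$-Galois extension over $B$. 1. $A/B$ arises from some $\overline H$-Galois extension over $B$ if and only if there exists an algebra morphism $R\to A$ in $\mathtt{SMod}^H$. 2. Let $f:R\to A$ be an algebra morphism in $\mathtt{SMod}^H$.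 Then the quotient super-algebra $D_f=A/(f(R^+))$ of $A$ by the super-ideal generated by $f(R^+)$ is a quotient algebra of $A$ in $\mathtt{SMod}^{\overline H}$ (that is, the coaction $a\mapsto a_{(0)}\otimes\overline{a_{(1)}}$ of $\overline H$ on $A$ induces one on $D_f$), and $D_f$ is an $\overline H$-Galois extension over $B$ via the composite $B\to A\to D_f$. Moreover, with $a\mapsto\overline a$ denoting the quotient map $A\to D_f$, $$\iota:A\to D_f\,\square_{\overline H}H,\qquad \iota(a)=\overline{a_{(0)}}\otimes a_{(1)},$$ is an isomorphism of algebras in $\mathtt{SMod}^H$ over $B$; in particular $A/B$ arises from $D_f/B$. -/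

import Mathlib

open scoped TensorProduct DirectSum

noncomputable section

namespace SuperHopf

universe u v w x

section Basic

variable {k : Type u} [Field k]

/-- A linear map is even (a morphism of super-vector spaces) if it preserves the degree. -/
def IsEven {V : Type v} {W : Type w} [AddCommGroup V] [Module k V] [AddCommGroup W] [Module k W]
    (𝒱 : ZMod 2 → Submodule k V) (𝒲 : ZMod 2 → Submodule k W) (φ : V → W) : Prop :=
  ∀ (i : ZMod 2) (x : V), x ∈ 𝒱 i → φ x ∈ 𝒲 i

/-- The grading of the tensor product of two super-vector spaces:
`(V ⊗ W)_i = ∑_{j + l = i} V_j ⊗ W_l`. -/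
def tensorGr {V : Type v} {W : Type w} [AddCommGroup V] [Module k V] [AddCommGroup W] [Module k W]
    (𝒱 : ZMod 2 → Submodule k V) (𝒲 : ZMod 2 → Submodule k W) (i : ZMod 2) :
    Submodule k (V ⊗[k] W) :=
  ⨆ j : ZMod 2, Submodule.map₂ (TensorProduct.mk k V W) (𝒱 j) (𝒲 (i - j))

end Basic

/-- A super-commutative super-algebra over `k`: a `ℤ/2`-graded algebra such that
`b a = (-1)^{|a||b|} a b` for homogeneous `a`, `b`. -/
structure SuperAlg (k : Type u) [Field k] where
  carrier : Type v
  [ring : Ring carrier]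
  [algebra : Algebra k carrier]
  gr : ZMod 2 → Submodule k carrier
  [gradedAlgebra : GradedAlgebra gr]
  supercomm : ∀ {i j : ZMod 2} {a b : carrier}, a ∈ gr i → b ∈ gr j →
    b * a = ((-1 : ℤˣ) ^ (i * j)) • (a * b)

attribute [instance] SuperAlg.ring SuperAlg.algebra SuperAlg.gradedAlgebra

instance (k : Type u) [Field k] : CoeSort (SuperAlg.{u, v} k) (Type v) := ⟨SuperAlg.carrier⟩

/-- A (super-commutative) Hopf super-algebra over `k`: a super-algebra with an even comultiplication
and an even counit which are algebra morphisms, the target `H ⊗ H` of the comultiplication having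
the product `(a ⊗ b)(c ⊗ d) = (-1)^{|b||c|} ac ⊗ bd`, and with an antipode. -/
structure HopfSuperAlg (k : Type u) [Field k] extends SuperAlg.{u, v} k where
  [coalgebra : Coalgebra k carrier]
  comul_even : IsEven gr (tensorGr gr gr) (Coalgebra.comul (R := k) (A := carrier))
  comul_one : GradedTensorProduct.of k gr gr (Coalgebra.comul (R := k) (1 : carrier)) = 1
  comul_mul : ∀ a b : carrier,
    GradedTensorProduct.of k gr gr (Coalgebra.comul (R := k) (a * b)) =
      GradedTensorProduct.of k gr gr (Coalgebra.comul (R := k) a) *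
        GradedTensorProduct.of k gr gr (Coalgebra.comul (R := k) b)
  counit_odd : ∀ a ∈ gr 1, Coalgebra.counit (R := k) a = 0
  counit_one : Coalgebra.counit (R := k) (1 : carrier) = 1
  counit_mul : ∀ a b : carrier, Coalgebra.counit (R := k) (a * b) =
    Coalgebra.counit (R := k) a * Coalgebra.counit (R := k) b
  antipode : carrier →ₗ[k] carrier
  antipode_even : IsEven gr gr antipode
  mul_antipode_rTensor_comul :
    LinearMap.mul' k carrier ∘ₗ antipode.rTensor carrier ∘ₗ Coalgebra.comul =
      Algebra.linearMap k carrier ∘ₗ Coalgebra.counit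
  mul_antipode_lTensor_comul :
    LinearMap.mul' k carrier ∘ₗ antipode.lTensor carrier ∘ₗ Coalgebra.comul =
      Algebra.linearMap k carrier ∘ₗ Coalgebra.counit

attribute [instance] HopfSuperAlg.coalgebra

instance (k : Type u) [Field k] : CoeSort (HopfSuperAlg.{u, v} k) (Type v) :=
  ⟨fun H => H.toSuperAlg.carrier⟩

section GradedTensor

variable {k : Type u} [Field k]

/-- The identity map from the super-algebra `A ⊗ B` (with the signed product) to the underlying
tensor product of vector spaces. -/
def plain (A : SuperAlg.{u, v} k) (B : SuperAlg.{u, w} k) :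
    (A.gr ᵍ⊗[k] B.gr) →ₗ[k] (A ⊗[k] B) :=
  (GradedTensorProduct.of k A.gr B.gr).symm.toLinearMap

/-- The comultiplication as an algebra morphism `H → H ⊗ H`. -/
def HopfSuperAlg.comulAlg (H : HopfSuperAlg.{u, v} k) : H →ₐ[k] (H.gr ᵍ⊗[k] H.gr) :=
  AlgHom.ofLinearMap ((GradedTensorProduct.of k H.gr H.gr).toLinearMap ∘ₗ Coalgebra.comul)
    H.comul_one H.comul_mul

/-- The tensor product `f ⊗ g` of even algebra morphisms, an algebra morphism. -/
def gtMap {A : SuperAlg.{u, v} k} {A' : SuperAlg.{u, w} k} {B : SuperAlg.{u, x} k}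
    {B' : SuperAlg k} (f : A →ₐ[k] A') (hf : IsEven A.gr A'.gr f)
    (g : B →ₐ[k] B') (hg : IsEven B.gr B'.gr g) :
    (A.gr ᵍ⊗[k] B.gr) →ₐ[k] (A'.gr ᵍ⊗[k] B'.gr) :=
  GradedTensorProduct.lift A.gr B.gr
    ((GradedTensorProduct.includeLeft A'.gr B'.gr).comp f)
    ((GradedTensorProduct.includeRight A'.gr B'.gr).comp g)
    (by
      intro i j a b
      have ha := hf i a a.2
      have hb := hg j b b.2
      have h1 := GradedTensorProduct.tmul_coe_mul_coe_tmul (R := k) A'.gr B'.gr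
        (1 : A') (⟨g b, hb⟩ : B'.gr j) (⟨f a, ha⟩ : A'.gr i) (1 : B')
      have h2 := GradedTensorProduct.tmul_one_mul_one_tmul (R := k) A'.gr B'.gr (f a) (g b)
      simp only [one_mul, mul_one] at h1
      simp only [AlgHom.comp_apply, GradedTensorProduct.includeLeft_apply,
        GradedTensorProduct.includeRight_apply]
      rw [h1, h2, smul_smul, Int.units_mul_self, one_smul])

theorem plain_gtMap {A : SuperAlg.{u, v} k} {A' : SuperAlg.{u, w} k} {B : SuperAlg.{u, x} k}
    {B' : SuperAlg k} (f : A →ₐ[k] A') (hf : IsEven A.gr A'.gr f)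
    (g : B →ₐ[k] B') (hg : IsEven B.gr B'.gr g) (t : A.gr ᵍ⊗[k] B.gr) :
    plain A' B' (gtMap f hf g hg t) =
      TensorProduct.map f.toLinearMap g.toLinearMap (plain A B t) := by
  have : (plain A' B') ∘ₗ (gtMap f hf g hg).toLinearMap =
      TensorProduct.map f.toLinearMap g.toLinearMap ∘ₗ plain A B := by
    apply GradedTensorProduct.hom_ext
    apply TensorProduct.ext'
    intro a b
    have h2 := GradedTensorProduct.tmul_one_mul_one_tmul (R := k) A'.gr B'.gr (f a) (g b)
    exact congrArg (plain A' B') h2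
  exact LinearMap.congr_fun this t

end GradedTensor

section Quotient

variable {k : Type u} [Field k]

theorem SuperAlg.isTwoSided (A : SuperAlg.{u, v} k) (I : Ideal A) (hI : I.IsHomogeneous A.gr) :
    I.IsTwoSided := by
  classical
  constructor
  intro a b ha
  rw [← DirectSum.sum_support_decompose A.gr a, ← DirectSum.sum_support_decompose A.gr b,
    Finset.sum_mul_sum]
  refine Ideal.sum_mem _ fun i _ => Ideal.sum_mem _ fun j _ => ?_
  rw [A.supercomm (SetLike.coe_mem (DirectSum.decompose A.gr b j))
    (SetLike.coe_mem (DirectSum.decompose A.gr a i))]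
  rw [Units.smul_def]
  exact zsmul_mem (I.mul_mem_left _ (hI i ha)) _

section Image

variable {A : Type v} {Q : Type w} [AddCommGroup A] [Module k A] [AddCommGroup Q] [Module k Q]
  (𝒜 : ZMod 2 → Submodule k A) [DirectSum.Decomposition 𝒜] (p : A →ₗ[k] Q)

/-- The map `A → ⨁ i, p(A_i)` which sends `a` to the family of the images of its homogeneous
components. -/
def imageDec : A →ₗ[k] ⨁ i, (𝒜 i).map p :=
  DirectSum.lmap (fun i => p.restrict (p := 𝒜 i) (q := (𝒜 i).map p)
    (fun _ ha => Submodule.mem_map_of_mem ha)) ∘ₗ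
      (DirectSum.decomposeLinearEquiv 𝒜).toLinearMap

theorem imageDec_coe (i : ZMod 2) (a : 𝒜 i) :
    imageDec 𝒜 p (a : A) = DirectSum.lof k (ZMod 2) (fun i => (𝒜 i).map p) i
      ⟨p a, Submodule.mem_map_of_mem a.2⟩ := by
  simp only [imageDec, LinearMap.comp_apply, LinearEquiv.coe_coe,
    DirectSum.decomposeLinearEquiv_apply_coe, DirectSum.lmap_lof]
  rfl

theorem coe_imageDec (a : A) :
    DirectSum.coeLinearMap (fun i => (𝒜 i).map p) (imageDec 𝒜 p a) = p a := by
  suffices h : DirectSum.coeLinearMap (fun i => (𝒜 i).map p) ∘ₗ imageDec 𝒜 p = p from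
    LinearMap.congr_fun h a
  refine DirectSum.decompose_lhom_ext 𝒜 fun i => ?_
  ext a
  simp only [LinearMap.comp_apply, Submodule.subtype_apply]
  rw [imageDec_coe, DirectSum.coeLinearMap_lof]

theorem imageDec_surjective : Function.Surjective (imageDec 𝒜 p) := by
  rw [← LinearMap.range_eq_top, eq_top_iff]
  rintro x -
  induction x using DirectSum.induction_on with
  | zero => exact zero_mem _
  | of i y =>
    obtain ⟨_, a, ha, rfl⟩ := y
    exact ⟨a, imageDec_coe 𝒜 p i ⟨a, ha⟩⟩
  | add x y hx hy => exact add_mem hx hy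

theorem imageDec_eq_zero (hker : ∀ a, p a = 0 → ∀ i, p (DirectSum.decompose 𝒜 a i) = 0)
    {a : A} (ha : p a = 0) : imageDec 𝒜 p a = 0 :=
  DFinsupp.ext fun i => Subtype.ext (hker a ha i)

/-- The decomposition of the image of `A` under a surjection with homogeneous kernel. -/
@[reducible] def imageDecomposition (hp : Function.Surjective p)
    (hker : ∀ a, p a = 0 → ∀ i, p (DirectSum.decompose 𝒜 a i) = 0) :
    DirectSum.Decomposition (fun i => (𝒜 i).map p) where
  decompose' q := imageDec 𝒜 p (Function.surjInv hp q)
  left_inv q := (coe_imageDec 𝒜 p _).trans (Function.surjInv_eq hp q)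
  right_inv x := by
    obtain ⟨a, rfl⟩ := imageDec_surjective 𝒜 p x
    have h := coe_imageDec 𝒜 p a
    rw [← sub_eq_zero, ← map_sub]
    refine imageDec_eq_zero 𝒜 p hker ?_
    rw [map_sub, Function.surjInv_eq hp, sub_eq_zero]
    exact h

end Image

/-- The quotient `A / I` of a super-algebra by a super-ideal, that is a homogeneous ideal (which is
automatically two-sided), with the grading induced from `A`. -/
def SuperAlg.quot (A : SuperAlg.{u, v} k) (I : Ideal A) (hI : I.IsHomogeneous A.gr) :
    SuperAlg.{u, v} k :=
  haveI : I.IsTwoSided := A.isTwoSided I hI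
  { carrier := A ⧸ I
    gr := fun i => (A.gr i).map (Ideal.Quotient.mkₐ k I).toLinearMap
    gradedAlgebra :=
      { imageDecomposition A.gr (Ideal.Quotient.mkₐ k I).toLinearMap
          (Ideal.Quotient.mkₐ_surjective k I)
          (fun _ ha i => Ideal.Quotient.eq_zero_iff_mem.2
            (hI i (Ideal.Quotient.eq_zero_iff_mem.1 ha))) with
        one_mem := ⟨1, SetLike.GradedOne.one_mem, rfl⟩
        mul_mem := by
          rintro i j _ _ ⟨a, ha, rfl⟩ ⟨b, hb, rfl⟩
          exact ⟨a * b, SetLike.GradedMul.mul_mem ha hb, rfl⟩ }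
    supercomm := by
      rintro i j _ _ ⟨a, ha, rfl⟩ ⟨b, hb, rfl⟩
      have h := congrArg (Ideal.Quotient.mkₐ k I) (A.supercomm ha hb)
      rw [Units.smul_def, map_zsmul, map_mul, map_mul] at h
      exact h }

/-- The quotient morphism `A → A / I`. -/
def SuperAlg.quotMk (A : SuperAlg.{u, v} k) (I : Ideal A) (hI : I.IsHomogeneous A.gr) :
    A →ₐ[k] A.quot I hI :=
  haveI : I.IsTwoSided := A.isTwoSided I hI
  Ideal.Quotient.mkₐ k I

theorem SuperAlg.quotMk_even (A : SuperAlg.{u, v} k) (I : Ideal A) (hI : I.IsHomogeneous A.gr) :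
    IsEven A.gr (A.quot I hI).gr (A.quotMk I hI) :=
  fun _ a ha => ⟨a, ha, rfl⟩

theorem SuperAlg.quotMk_surjective (A : SuperAlg.{u, v} k) (I : Ideal A)
    (hI : I.IsHomogeneous A.gr) : Function.Surjective (A.quotMk I hI) :=
  haveI : I.IsTwoSided := A.isTwoSided I hI
  Ideal.Quotient.mkₐ_surjective k I

theorem SuperAlg.quotMk_eq_zero (A : SuperAlg.{u, v} k) (I : Ideal A)
    (hI : I.IsHomogeneous A.gr) (a : A) : A.quotMk I hI a = 0 ↔ a ∈ I :=
  haveI : I.IsTwoSided := A.isTwoSided I hI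
  Ideal.Quotient.eq_zero_iff_mem

/-- Algebra morphisms that kill `I` factor through `A / I`. -/
def SuperAlg.quotLift (A : SuperAlg.{u, v} k) (I : Ideal A) (hI : I.IsHomogeneous A.gr)
    {C : Type w} [Ring C] [Algebra k C] (f : A →ₐ[k] C) (hf : ∀ a ∈ I, f a = 0) :
    A.quot I hI →ₐ[k] C :=
  haveI : I.IsTwoSided := A.isTwoSided I hI
  Ideal.Quotient.liftₐ I f hf

theorem SuperAlg.quotLift_mk (A : SuperAlg.{u, v} k) (I : Ideal A) (hI : I.IsHomogeneous A.gr)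
    {C : Type w} [Ring C] [Algebra k C] (f : A →ₐ[k] C) (hf : ∀ a ∈ I, f a = 0) (a : A) :
    A.quotLift I hI f hf (A.quotMk I hI a) = f a :=
  rfl

end Quotient

section Hbar

variable {k : Type u} [Field k]

/-- The super-ideal `(A_1)` generated by the odd component. -/
def SuperAlg.oddIdeal (A : SuperAlg.{u, v} k) : Ideal A :=
  Ideal.span (A.gr 1 : Set A)

theorem SuperAlg.oddIdeal_homogeneous (A : SuperAlg.{u, v} k) : A.oddIdeal.IsHomogeneous A.gr :=
  Ideal.homogeneous_span A.gr _ fun _ hx => ⟨1, hx⟩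

/-- The largest purely even quotient `A / (A_1)` of a super-algebra. -/
def SuperAlg.bar (A : SuperAlg.{u, v} k) : SuperAlg.{u, v} k :=
  A.quot A.oddIdeal A.oddIdeal_homogeneous

/-- The quotient map `A → A / (A_1)`. -/
def SuperAlg.toBar (A : SuperAlg.{u, v} k) : A →ₐ[k] A.bar :=
  A.quotMk A.oddIdeal A.oddIdeal_homogeneous

theorem SuperAlg.toBar_even (A : SuperAlg.{u, v} k) : IsEven A.gr A.bar.gr A.toBar :=
  A.quotMk_even _ _

theorem SuperAlg.toBar_surjective (A : SuperAlg.{u, v} k) : Function.Surjective A.toBar :=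
  A.quotMk_surjective _ _

theorem SuperAlg.toBar_odd (A : SuperAlg.{u, v} k) {a : A} (ha : a ∈ A.gr 1) : A.toBar a = 0 :=
  (A.quotMk_eq_zero _ _ a).2 (Ideal.subset_span ha)

theorem SuperAlg.bar_odd (A : SuperAlg.{u, v} k) {a : A.bar} (ha : a ∈ A.bar.gr 1) : a = 0 := by
  obtain ⟨a, ha, rfl⟩ := ha
  exact A.toBar_odd ha

theorem zmod_two (i : ZMod 2) : i = 0 ∨ i = 1 := by
  revert i; decide

theorem SuperAlg.bar_even (A : SuperAlg.{u, v} k) (a : A.bar) : a ∈ A.bar.gr 0 := by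
  classical
  rw [← DirectSum.sum_support_decompose A.bar.gr a]
  refine Submodule.sum_mem _ fun i _ => ?_
  rcases zmod_two i with rfl | rfl
  · exact SetLike.coe_mem _
  · rw [A.bar_odd (SetLike.coe_mem (DirectSum.decompose A.bar.gr a 1))]
    exact zero_mem _

theorem SuperAlg.bar_mul_comm (A : SuperAlg.{u, v} k) (a b : A.bar) : a * b = b * a := by
  have h := A.bar.supercomm (A.bar_even b) (A.bar_even a)
  simpa using h

theorem SuperAlg.map_toBar_odd (A : SuperAlg.{u, v} k) {t : A ⊗[k] A}
    (ht : t ∈ tensorGr A.gr A.gr 1) :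
    TensorProduct.map A.toBar.toLinearMap A.toBar.toLinearMap t = 0 := by
  suffices h : tensorGr A.gr A.gr 1 ≤
      LinearMap.ker (TensorProduct.map A.toBar.toLinearMap A.toBar.toLinearMap) from h ht
  refine iSup_le fun j => Submodule.map₂_le.2 fun a ha b hb => ?_
  rw [LinearMap.mem_ker]
  change A.toBar a ⊗ₜ[k] A.toBar b = 0
  rcases zmod_two j with rfl | rfl
  · rw [A.toBar_odd (a := b) (by simpa using hb), TensorProduct.tmul_zero]
  · rw [A.toBar_odd ha, TensorProduct.zero_tmul]

namespace HopfSuperAlg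

variable (H : HopfSuperAlg.{u, v} k)

theorem plain_comulAlg (h : H) :
    plain H.toSuperAlg H.toSuperAlg (H.comulAlg h) = Coalgebra.comul (R := k) h := rfl

/-- The counit as an algebra morphism. -/
def counitAlg : H →ₐ[k] k :=
  AlgHom.ofLinearMap Coalgebra.counit H.counit_one H.counit_mul

/-- The comultiplication of `H / (H_1)`. -/
def comulBar : H.toSuperAlg.bar →ₐ[k] (H.toSuperAlg.bar.gr ᵍ⊗[k] H.toSuperAlg.bar.gr) :=
  H.quotLift _ _
    ((gtMap H.toBar H.toBar_even H.toBar H.toBar_even).comp H.comulAlg)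
    (by
      suffices h : H.oddIdeal ≤ RingHom.ker
          ((gtMap H.toBar H.toBar_even H.toBar H.toBar_even).comp H.comulAlg) from fun a ha => h ha
      refine Ideal.span_le.2 fun a ha => ?_
      refine RingHom.mem_ker.2 ?_
      refine (GradedTensorProduct.of k H.toSuperAlg.bar.gr H.toSuperAlg.bar.gr).symm.injective ?_
      refine Eq.trans (plain_gtMap H.toBar H.toBar_even H.toBar H.toBar_even (H.comulAlg a)) ?_
      rw [plain_comulAlg, map_zero]
      exact H.map_toBar_odd (H.comul_even 1 a ha))

/-- The counit of `H / (H_1)`. -/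
def counitBar : H.toSuperAlg.bar →ₐ[k] k :=
  H.quotLift _ _ H.counitAlg
    (by
      suffices h : H.oddIdeal ≤ RingHom.ker H.counitAlg from fun a ha => h ha
      exact Ideal.span_le.2 fun a ha => H.counit_odd a ha)

/-- The comultiplication of `H / (H_1)` as a linear map. -/
def comulBarLin : H.toSuperAlg.bar →ₗ[k] H.toSuperAlg.bar ⊗[k] H.toSuperAlg.bar :=
  plain _ _ ∘ₗ H.comulBar.toLinearMap

theorem comulBarLin_comp : H.comulBarLin ∘ₗ H.toBar.toLinearMap =
    TensorProduct.map H.toBar.toLinearMap H.toBar.toLinearMap ∘ₗ Coalgebra.comul :=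
  LinearMap.ext fun a => plain_gtMap H.toBar H.toBar_even H.toBar H.toBar_even (H.comulAlg a)

theorem counitBar_comp : H.counitBar.toLinearMap ∘ₗ H.toBar.toLinearMap = Coalgebra.counit :=
  rfl

end HopfSuperAlg

/-- A quotient of a coalgebra to which the structure descends is a coalgebra. -/
@[reducible] def coalgebraOfSurjective {C : Type v} {D : Type w} [AddCommGroup C] [Module k C]
    [AddCommGroup D] [Module k D] [Coalgebra k C] (p : C →ₗ[k] D) (hp : Function.Surjective p)
    (δ : D →ₗ[k] D ⊗[k] D) (e : D →ₗ[k] k)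
    (hδ : δ ∘ₗ p = TensorProduct.map p p ∘ₗ Coalgebra.comul) (he : e ∘ₗ p = Coalgebra.counit) :
    Coalgebra k D where
  comul := δ
  counit := e
  coassoc := by
    rw [← LinearMap.cancel_right hp]
    simp only [coassoc_simps, hδ]
  rTensor_counit_comp_comul := by
    rw [← LinearMap.cancel_right hp]
    simp only [coassoc_simps, hδ, he]
    rw [CoassocSimps.map_counit_comp_comul_left]; rfl
  lTensor_counit_comp_comul := by
    rw [← LinearMap.cancel_right hp]
    simp only [coassoc_simps, hδ, he]
    rw [CoassocSimps.map_counit_comp_comul_right]; rfl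

namespace HopfSuperAlg

variable (H : HopfSuperAlg.{u, v} k)

/-- The composite of the antipode with the quotient map `H → H / (H_1)`. -/
def antiBarLin : H →ₗ[k] H.toSuperAlg.bar := H.toBar.toLinearMap ∘ₗ H.antipode

theorem antipode_one : H.antipode 1 = 1 := by
  have h := LinearMap.congr_fun H.mul_antipode_rTensor_comul 1
  have h1 : Coalgebra.comul (R := k) (1 : H) = 1 ⊗ₜ[k] 1 := H.comul_one
  simp only [LinearMap.comp_apply, h1, LinearMap.rTensor_tmul, LinearMap.mul'_apply, mul_one,
    H.counit_one, Algebra.linearMap_apply, map_one] at h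
  exact h

theorem lTensor_toBar_mul (x y : H.gr ᵍ⊗[k] H.gr) :
    H.toBar.toLinearMap.lTensor H (plain _ _ (x * y)) =
      H.toBar.toLinearMap.lTensor H
        (plain H.toSuperAlg H.toSuperAlg x * plain H.toSuperAlg H.toSuperAlg y) := by
  let P := plain H.toSuperAlg H.toSuperAlg
  let L := H.toBar.toLinearMap.lTensor H.carrier
  let m₁ : (H.gr ᵍ⊗[k] H.gr) →ₗ[k] (H.gr ᵍ⊗[k] H.gr) →ₗ[k] _ :=
    (LinearMap.mul k (H.gr ᵍ⊗[k] H.gr)).compr₂ (L ∘ₗ P)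
  let m₂ : (H.gr ᵍ⊗[k] H.gr) →ₗ[k] (H.gr ᵍ⊗[k] H.gr) →ₗ[k] _ :=
    ((LinearMap.mul k (H.carrier ⊗[k] H.carrier)).compr₂ L).compl₁₂ P P
  suffices h : m₁ = m₂ from LinearMap.congr_fun (LinearMap.congr_fun h x) y
  ext a₁ : 3
  refine DirectSum.decompose_lhom_ext H.gr fun j₁ => ?_
  ext b₁ : 3
  refine DirectSum.decompose_lhom_ext H.gr fun i₂ => ?_
  ext a₂ b₂ : 2
  have e₁ : L (P (GradedTensorProduct.tmul k a₁ (b₁ : H.carrier) *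
      GradedTensorProduct.tmul k (a₂ : H.carrier) b₂)) =
        L ((a₁ * a₂) ⊗ₜ[k] ((b₁ : H.carrier) * b₂)) := by
    rw [GradedTensorProduct.tmul_coe_mul_coe_tmul]
    rcases zmod_two j₁ with rfl | rfl
    · rw [zero_mul, uzpow_zero, one_smul]; rfl
    · have hz : L ((a₁ * a₂) ⊗ₜ[k] ((b₁ : H.carrier) * b₂)) = 0 := by
        change (a₁ * a₂ : H.carrier) ⊗ₜ[k] H.toBar ((b₁ : H.carrier) * b₂) = 0
        rw [map_mul, H.toBar_odd b₁.2, zero_mul, TensorProduct.tmul_zero]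
      rw [hz, Units.smul_def, map_zsmul, map_zsmul]
      refine Eq.trans (congrArg _ hz) (smul_zero _)
  have e₂ : L (((a₁ ⊗ₜ[k] (b₁ : H.carrier)) : H.carrier ⊗[k] H.carrier) *
      (((a₂ : H.carrier) ⊗ₜ[k] b₂) : H.carrier ⊗[k] H.carrier)) =
        L ((a₁ * a₂) ⊗ₜ[k] ((b₁ : H.carrier) * b₂)) := by
    rw [Algebra.TensorProduct.tmul_mul_tmul]
  exact e₁.trans e₂.symm

open WithConv in
theorem antiBarLin_mul (a b : H) :
    H.antiBarLin (a * b) = H.antiBarLin a * H.antiBarLin b := by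
  let T := H.antiBarLin
  let p : H.carrier →ₗ[k] H.toSuperAlg.bar.carrier := H.toBar.toLinearMap
  let Θ : H.carrier ⊗[k] H.carrier →ₗ[k] H.toSuperAlg.bar.carrier :=
    LinearMap.mul' k _ ∘ₗ TensorProduct.map T p
  let Θ' : H.carrier ⊗[k] H.carrier →ₗ[k] H.toSuperAlg.bar.carrier :=
    LinearMap.mul' k _ ∘ₗ TensorProduct.map p T
  have hΘ (c : H) : Θ (Coalgebra.comul c) = algebraMap k _ (Coalgebra.counit (R := k) c) := by
    have h := congrArg H.toBar (LinearMap.congr_fun H.mul_antipode_rTensor_comul c)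
    have h2 : ∀ t : H.carrier ⊗[k] H.carrier,
        H.toBar (LinearMap.mul' k _ (H.antipode.rTensor _ t)) = Θ t := fun t => by
      induction t using TensorProduct.induction_on with
      | zero => simp
      | tmul x y => exact map_mul H.toBar _ _
      | add x y hx hy => simp only [map_add, hx, hy]
    rw [← h2]
    exact h.trans (H.toBar.commutes _)
  have hΘ' (c : H) : Θ' (Coalgebra.comul c) = algebraMap k _ (Coalgebra.counit (R := k) c) := by
    have h := congrArg H.toBar (LinearMap.congr_fun H.mul_antipode_lTensor_comul c)
    have h2 : ∀ t : H.carrier ⊗[k] H.carrier,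
        H.toBar (LinearMap.mul' k _ (H.antipode.lTensor _ t)) = Θ' t := fun t => by
      induction t using TensorProduct.induction_on with
      | zero => simp
      | tmul x y => exact map_mul H.toBar _ _
      | add x y hx hy => simp only [map_add, hx, hy]
    rw [← h2]
    exact h.trans (H.toBar.commutes _)
  have hΘm (x y : H.gr ᵍ⊗[k] H.gr) : Θ (plain _ _ (x * y)) =
      Θ (plain H.toSuperAlg H.toSuperAlg x * plain H.toSuperAlg H.toSuperAlg y) := by
    have h := congrArg (LinearMap.mul' k _ ∘ₗ TensorProduct.map T LinearMap.id)
      (H.lTensor_toBar_mul x y)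
    have h2 : ∀ t : H.carrier ⊗[k] H.carrier, (LinearMap.mul' k _ ∘ₗ
        TensorProduct.map T LinearMap.id) (H.toBar.toLinearMap.lTensor H.carrier t) = Θ t := by
      intro t
      induction t using TensorProduct.induction_on with
      | zero => simp
      | tmul x y => rfl
      | add x y hx hy => simp only [map_add, hx, hy]
    rwa [h2, h2] at h
  let F : WithConv (H.carrier ⊗[k] H.carrier →ₗ[k] H.toSuperAlg.bar.carrier) :=
    toConv (T ∘ₗ LinearMap.mul' k _)
  let P : WithConv (H.carrier ⊗[k] H.carrier →ₗ[k] H.toSuperAlg.bar.carrier) :=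
    toConv (p ∘ₗ LinearMap.mul' k _)
  let G : WithConv (H.carrier ⊗[k] H.carrier →ₗ[k] H.toSuperAlg.bar.carrier) :=
    toConv (LinearMap.mul' k _ ∘ₗ TensorProduct.map T T)
  have hFP : F * P = 1 := by
    ext a b
    have key : ∀ x y : H.carrier ⊗[k] H.carrier, LinearMap.mul' k _
        (TensorProduct.map F.ofConv P.ofConv
          (TensorProduct.AlgebraTensorModule.tensorTensorTensorComm k k k k _ _ _ _
            (x ⊗ₜ y))) = Θ (x * y) := by
      intro x y
      induction x using TensorProduct.induction_on with
      | zero => simp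
      | add x x' hx hx' => simp only [TensorProduct.add_tmul, map_add, hx, hx', add_mul]
      | tmul x₁ x₂ =>
        induction y using TensorProduct.induction_on with
        | zero => simp
        | add x x' hx hx' => simp only [TensorProduct.tmul_add, map_add, hx, hx', mul_add]
        | tmul y₁ y₂ =>
          rw [Algebra.TensorProduct.tmul_mul_tmul]
          rfl
    have h1 : Θ (Coalgebra.comul (R := k) a * Coalgebra.comul (R := k) b) =
        algebraMap k _ (Coalgebra.counit (R := k) (a * b)) := by
      rw [← hΘ]
      exact (hΘm (H.comulAlg a) (H.comulAlg b)).symm.trans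
        (congrArg (fun t => Θ (plain _ _ t)) (map_mul H.comulAlg a b).symm)
    refine (key (Coalgebra.comul a) (Coalgebra.comul b)).trans (h1.trans ?_)
    rw [H.counit_mul]
    simp [TensorProduct.counit_def, mul_comm]
  have hPG : P * G = 1 := by
    ext a b
    have key : ∀ x y : H.carrier ⊗[k] H.carrier, LinearMap.mul' k _
        (TensorProduct.map P.ofConv G.ofConv
          (TensorProduct.AlgebraTensorModule.tensorTensorTensorComm k k k k _ _ _ _
            (x ⊗ₜ y))) = Θ' x * Θ' y := by
      intro x y
      induction x using TensorProduct.induction_on with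
      | zero => simp
      | add x x' hx hx' => simp only [TensorProduct.add_tmul, map_add, hx, hx', add_mul]
      | tmul x₁ x₂ =>
        induction y using TensorProduct.induction_on with
        | zero => simp
        | add x x' hx hx' => simp only [TensorProduct.tmul_add, map_add, hx, hx', mul_add]
        | tmul y₁ y₂ =>
          change p (x₁ * y₁) * (T x₂ * T y₂) = (p x₁ * T x₂) * (p y₁ * T y₂)
          rw [show p (x₁ * y₁) = p x₁ * p y₁ from map_mul H.toBar _ _, mul_assoc, mul_assoc,
            ← mul_assoc (p y₁), H.bar_mul_comm (p y₁), mul_assoc]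
    refine (key (Coalgebra.comul a) (Coalgebra.comul b)).trans ?_
    rw [hΘ', hΘ']
    simp [TensorProduct.counit_def, mul_comm]
  have hFG : F = G := left_inv_eq_right_inv hFP hPG
  exact LinearMap.congr_fun (congrArg WithConv.ofConv hFG) (a ⊗ₜ b)

/-- The antipode of `H / (H_1)`. -/
def antiBar : H.toSuperAlg.bar →ₐ[k] H.toSuperAlg.bar :=
  H.quotLift _ _
    (AlgHom.ofLinearMap H.antiBarLin (by simp [antiBarLin, antipode_one]) H.antiBarLin_mul)
    (by
      intro a ha
      refine Submodule.span_induction (p := fun a _ => H.antiBarLin a = 0) ?_ (map_zero _) ?_ ?_ ha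
      · intro a ha
        exact H.toBar_odd (H.antipode_even 1 a ha)
      · intro a b _ _ ha hb
        rw [map_add, ha, hb, add_zero]
      · intro r a _ ha
        rw [smul_eq_mul, antiBarLin_mul, ha, mul_zero])

theorem antiBar_comp : H.antiBar.toLinearMap ∘ₗ H.toBar.toLinearMap =
    H.toBar.toLinearMap ∘ₗ H.antipode := rfl

/-- The quotient `H / (H_1)` of a Hopf super-algebra `H`, with the structure induced from `H`; it is
a purely even Hopf super-algebra, that is an ordinary commutative Hopf algebra. -/
def bar : HopfSuperAlg.{u, v} k where
  toSuperAlg := H.toSuperAlg.bar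
  coalgebra := coalgebraOfSurjective H.toBar.toLinearMap H.toBar_surjective H.comulBarLin
    H.counitBar.toLinearMap H.comulBarLin_comp H.counitBar_comp
  comul_even := by
    rintro i _ ⟨a, ha, rfl⟩
    refine Eq.mpr (congrArg (· ∈ _) (LinearMap.congr_fun H.comulBarLin_comp a)) ?_
    have h := H.comul_even i a ha
    suffices hs : tensorGr H.gr H.gr i ≤ (tensorGr H.toSuperAlg.bar.gr H.toSuperAlg.bar.gr i).comap
      (TensorProduct.map H.toBar.toLinearMap H.toBar.toLinearMap) from hs h
    refine iSup_le fun j => Submodule.map₂_le.2 fun a ha b hb => ?_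
    exact Submodule.mem_iSup_of_mem j (Submodule.apply_mem_map₂ _
      (H.toBar_even _ _ ha) (H.toBar_even _ _ hb))
  comul_one := map_one H.comulBar
  comul_mul := map_mul H.comulBar
  counit_odd := by
    rintro _ ⟨a, ha, rfl⟩
    exact H.counit_odd a ha
  counit_one := map_one H.counitBar
  counit_mul := map_mul H.counitBar
  antipode := H.antiBar.toLinearMap
  antipode_even := by
    rintro i _ ⟨a, ha, rfl⟩
    exact H.toBar_even _ _ (H.antipode_even i a ha)
  mul_antipode_rTensor_comul := by
    refine LinearMap.ext fun b => ?_
    obtain ⟨a, rfl⟩ := H.toBar_surjective b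
    have h2 : ∀ t : H.carrier ⊗[k] H.carrier,
        LinearMap.mul' k _ (H.antiBar.toLinearMap.rTensor _
          (TensorProduct.map H.toBar.toLinearMap H.toBar.toLinearMap t)) =
          H.toBar (LinearMap.mul' k _ (H.antipode.rTensor _ t)) := fun t => by
      induction t using TensorProduct.induction_on with
      | zero => simp
      | tmul x y => exact (map_mul H.toBar _ _).symm
      | add x y hx hy => simp only [map_add, hx, hy]
    have h3 := congrArg H.toBar (LinearMap.congr_fun H.mul_antipode_rTensor_comul a)
    have h4 := LinearMap.congr_fun H.comulBarLin_comp a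
    exact (congrArg (fun t => LinearMap.mul' k _ (H.antiBar.toLinearMap.rTensor _ t)) h4).trans
      ((h2 _).trans (h3.trans (H.toBar.commutes _)))
  mul_antipode_lTensor_comul := by
    refine LinearMap.ext fun b => ?_
    obtain ⟨a, rfl⟩ := H.toBar_surjective b
    have h2 : ∀ t : H.carrier ⊗[k] H.carrier,
        LinearMap.mul' k _ (H.antiBar.toLinearMap.lTensor _
          (TensorProduct.map H.toBar.toLinearMap H.toBar.toLinearMap t)) =
          H.toBar (LinearMap.mul' k _ (H.antipode.lTensor _ t)) := fun t => by
      induction t using TensorProduct.induction_on with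
      | zero => simp
      | tmul x y => exact (map_mul H.toBar _ _).symm
      | add x y hx hy => simp only [map_add, hx, hy]
    have h3 := congrArg H.toBar (LinearMap.congr_fun H.mul_antipode_lTensor_comul a)
    have h4 := LinearMap.congr_fun H.comulBarLin_comp a
    exact (congrArg (fun t => LinearMap.mul' k _ (H.antiBar.toLinearMap.lTensor _ t)) h4).trans
      ((h2 _).trans (h3.trans (H.toBar.commutes _)))

/-- The quotient map `H → H / (H_1)`, written `h ↦ h̄`. -/
def toHbar : H →ₐ[k] H.bar := H.toSuperAlg.toBar

theorem toHbar_even : IsEven H.gr H.bar.gr H.toHbar := H.toSuperAlg.toBar_even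

theorem toHbar_surjective : Function.Surjective H.toHbar := H.toSuperAlg.toBar_surjective

theorem comul_toHbar (h : H) : Coalgebra.comul (R := k) (H.toHbar h) =
    TensorProduct.map H.toHbar.toLinearMap H.toHbar.toLinearMap (Coalgebra.comul (R := k) h) :=
  LinearMap.congr_fun H.comulBarLin_comp h

theorem counit_toHbar (h : H) :
    Coalgebra.counit (R := k) (H.toHbar h) = Coalgebra.counit (R := k) h := rfl

end HopfSuperAlg

end Hbar

section Coinvariants

variable {k : Type u} [Field k]

theorem isEven_id (A : SuperAlg.{u, v} k) : IsEven A.gr A.gr (AlgHom.id k A) := fun _ _ h => h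

namespace HopfSuperAlg

variable (H : HopfSuperAlg.{u, v} k)

/-- The left coaction `H → H̄ ⊗ H`, `h ↦ h̄₍₁₎ ⊗ h₍₂₎`, as an algebra morphism. -/
def leftCoact : H →ₐ[k] (H.bar.gr ᵍ⊗[k] H.gr) :=
  (gtMap H.toHbar H.toHbar_even (AlgHom.id k H) (isEven_id H.toSuperAlg)).comp H.comulAlg

/-- The left coaction `H → H̄ ⊗ H` as a linear map. -/
def leftCoactLin : H →ₗ[k] H.bar ⊗[k] H :=
  plain H.bar.toSuperAlg H.toSuperAlg ∘ₗ H.leftCoact.toLinearMap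

theorem leftCoactLin_apply (h : H) :
    H.leftCoactLin h = H.toHbar.toLinearMap.rTensor H (Coalgebra.comul (R := k) h) :=
  plain_gtMap H.toHbar H.toHbar_even (AlgHom.id k H) (isEven_id H.toSuperAlg) (H.comulAlg h)

/-- The subalgebra `R` of left `H̄`-coinvariants: those `h` with `h̄₍₁₎ ⊗ h₍₂₎ = 1 ⊗ h`. -/
def coinv : Subalgebra k H :=
  AlgHom.equalizer H.leftCoact (GradedTensorProduct.includeRight H.bar.gr H.gr)

theorem mem_coinv (h : H) : h ∈ H.coinv ↔ H.leftCoactLin h = 1 ⊗ₜ[k] h := Iff.rfl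

/-- The map `h ↦ h̄₍₁₎ ⊗ h₍₂₎ - 1 ⊗ h`, whose kernel is the space of left coinvariants. -/
def coinvDefect : H →ₗ[k] H.bar ⊗[k] H :=
  H.leftCoactLin - TensorProduct.mk k H.bar H 1

theorem comul_coinv (h : H.coinv) : Coalgebra.comul (R := k) (h : H) ∈
    LinearMap.range (H.coinv.val.toLinearMap.rTensor H) := by
  have hex : Function.Exact H.coinv.val.toLinearMap H.coinvDefect := by
    intro x
    constructor
    · intro hx
      exact ⟨⟨x, (H.mem_coinv x).2 (sub_eq_zero.1 hx)⟩, rfl⟩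
    · rintro ⟨y, rfl⟩
      exact sub_eq_zero.2 ((H.mem_coinv _).1 y.2)
  have hex2 := Module.Flat.rTensor_exact H.carrier hex
  refine (hex2 _).1 ?_
  have e₁ : ∀ t : H.carrier ⊗[k] H.carrier, H.leftCoactLin.rTensor H.carrier t =
      (TensorProduct.assoc k H.bar H H).symm (H.toHbar.toLinearMap.rTensor (H ⊗[k] H)
        (TensorProduct.assoc k H H H ((Coalgebra.comul (R := k)).rTensor H.carrier t))) := by
    intro t
    induction t using TensorProduct.induction_on with
    | zero => simp
    | add x y hx hy => simp only [map_add, hx, hy]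
    | tmul x y =>
      rw [LinearMap.rTensor_tmul, leftCoactLin_apply, LinearMap.rTensor_tmul]
      generalize Coalgebra.comul (R := k) x = z
      induction z using TensorProduct.induction_on with
      | zero => simp
      | add x y hx hy => simp only [map_add, TensorProduct.add_tmul, hx, hy]
      | tmul a b => rfl
  have e₂ : ∀ t : H.carrier ⊗[k] H.carrier,
      (TensorProduct.assoc k H.bar H H).symm (H.toHbar.toLinearMap.rTensor (H ⊗[k] H)
        ((Coalgebra.comul (R := k)).lTensor H.carrier t)) =
      (TensorProduct.assoc k H.bar H H).symm ((Coalgebra.comul (R := k)).lTensor H.bar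
        (H.toHbar.toLinearMap.rTensor H t)) := by
    intro t
    congr 1
    induction t using TensorProduct.induction_on with
    | zero => simp
    | add x y hx hy => simp only [map_add, hx, hy]
    | tmul x y => rfl
  have e₃ : ∀ t : H.carrier ⊗[k] H.carrier,
      (TensorProduct.assoc k H.bar H H).symm ((1 : H.bar) ⊗ₜ[k] t) =
        (TensorProduct.mk k H.bar H 1).rTensor H.carrier t := by
    intro t
    induction t using TensorProduct.induction_on with
    | zero => simp
    | add x y hx hy => simp only [map_add, TensorProduct.tmul_add, hx, hy]
    | tmul x y => rfl
  rw [coinvDefect, LinearMap.rTensor_sub, LinearMap.sub_apply, e₁, Coalgebra.coassoc_apply, e₂,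
    ← leftCoactLin_apply, (H.mem_coinv _).1 h.2, LinearMap.lTensor_tmul, e₃, sub_self]

theorem rTensor_val_injective : Function.Injective (H.coinv.val.toLinearMap.rTensor H.carrier) :=
  Module.Flat.rTensor_preserves_injective_linearMap _ Subtype.val_injective

/-- The right coaction `R → R ⊗ H` obtained by restriction of the comultiplication of `H`. -/
def coinvCoact : H.coinv →ₗ[k] H.coinv ⊗[k] H :=
  (LinearEquiv.ofInjective _ H.rTensor_val_injective).symm.toLinearMap ∘ₗ
    (Coalgebra.comul (R := k) ∘ₗ H.coinv.val.toLinearMap).codRestrict _ H.comul_coinv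

theorem rTensor_val_coinvCoact (h : H.coinv) :
    H.coinv.val.toLinearMap.rTensor H.carrier (H.coinvCoact h) =
      Coalgebra.comul (R := k) (h : H) :=
  congrArg Subtype.val ((LinearEquiv.ofInjective _ H.rTensor_val_injective).apply_symm_apply
    ⟨Coalgebra.comul (R := k) (h : H), H.comul_coinv h⟩)

/-- The projection of `H` to its component of degree `i`. -/
def proj (i : ZMod 2) : H →ₗ[k] H :=
  (H.gr i).subtype ∘ₗ DirectSum.component k (ZMod 2) (fun i => H.gr i) i ∘ₗ
    (DirectSum.decomposeLinearEquiv H.gr).toLinearMap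

theorem leftCoactLin_proj (i : ZMod 2) (h : H) :
    H.leftCoactLin (H.proj i h) = (H.proj i).lTensor H.bar (H.leftCoactLin h) := by
  suffices hs : H.leftCoactLin ∘ₗ H.proj i = (H.proj i).lTensor H.bar ∘ₗ H.leftCoactLin from
    LinearMap.congr_fun hs h
  refine DirectSum.decompose_lhom_ext H.gr fun j => ?_
  ext a
  simp only [LinearMap.comp_apply, Submodule.subtype_apply]
  have hpr : ∀ b ∈ H.gr j, H.proj i b = if j = i then b else 0 := by
    intro b hb
    split_ifs with hij
    · subst hij
      exact DirectSum.decompose_of_mem_same H.gr hb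
    · exact DirectSum.decompose_of_mem_ne H.gr hb hij
  have hle : tensorGr H.gr H.gr j ≤ LinearMap.ker
      (((H.proj i).lTensor H.bar - if j = i then LinearMap.id else 0) ∘ₗ
        H.toHbar.toLinearMap.rTensor H.carrier) := by
    refine iSup_le fun l => Submodule.map₂_le.2 fun b hb c hc => ?_
    rw [LinearMap.mem_ker]
    rcases zmod_two l with rfl | rfl
    · rw [sub_zero] at hc
      have := hpr c hc
      split_ifs at this ⊢ <;>
        simp [this]
    · have : H.toHbar b = 0 := H.toSuperAlg.toBar_odd hb
      simp [this]
  have h := hle (H.comul_even j a a.2)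
  rw [LinearMap.mem_ker, LinearMap.comp_apply, ← leftCoactLin_apply, LinearMap.sub_apply,
    sub_eq_zero] at h
  rw [h, hpr a a.2]
  split_ifs <;> simp

theorem proj_mem_coinv (i : ZMod 2) {h : H} (hh : h ∈ H.coinv) : H.proj i h ∈ H.coinv := by
  rw [mem_coinv, leftCoactLin_proj, (H.mem_coinv h).1 hh, LinearMap.lTensor_tmul]

theorem proj_add_proj (h : H) : H.proj 0 h + H.proj 1 h = h := by
  suffices hs : H.proj 0 + H.proj 1 = LinearMap.id from LinearMap.congr_fun hs h
  refine DirectSum.decompose_lhom_ext H.gr fun j => ?_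
  ext a
  have hsame : H.proj j (a : H) = a := DirectSum.decompose_of_mem_same H.gr a.2
  have hne : ∀ i, j ≠ i → H.proj i (a : H) = 0 := fun i hij =>
    DirectSum.decompose_of_mem_ne H.gr a.2 hij
  simp only [LinearMap.comp_apply, Submodule.subtype_apply, LinearMap.add_apply,
    LinearMap.id_apply]
  rcases zmod_two j with rfl | rfl
  · rw [hsame, hne 1 (by decide), add_zero]
  · rw [hsame, hne 0 (by decide), zero_add]

theorem counit_proj (i : ZMod 2) {h : H} (hh : Coalgebra.counit (R := k) h = 0) :
    Coalgebra.counit (R := k) (H.proj i h) = 0 := by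
  have h1 : ∀ x : H, Coalgebra.counit (R := k) (H.proj 1 x) = 0 := fun x =>
    H.counit_odd _ (SetLike.coe_mem (DirectSum.decompose H.gr x 1))
  rcases zmod_two i with rfl | rfl
  · have := congrArg (Coalgebra.counit (R := k)) (H.proj_add_proj h)
    rwa [map_add, h1, add_zero, hh] at this
  · exact h1 h

end HopfSuperAlg

end Coinvariants

section Comodules

variable {k : Type u} [Field k]

/-- The linear map `A → A ⊗ H` underlying an algebra morphism `ρ : A → A ⊗ H`. -/
def coactLin {A : SuperAlg.{u, w} k} {H : HopfSuperAlg.{u, v} k}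
    (ρ : A →ₐ[k] (A.gr ᵍ⊗[k] H.gr)) : A →ₗ[k] A ⊗[k] H :=
  plain A H.toSuperAlg ∘ₗ ρ.toLinearMap

/-- The algebra morphism `ρ : A → A ⊗ H` makes `A` a right `H`-super-comodule, so that `(A, ρ)` is an
algebra in the tensor category of right `H`-super-comodules. -/
structure IsCoaction {A : SuperAlg.{u, w} k} {H : HopfSuperAlg.{u, v} k}
    (ρ : A →ₐ[k] (A.gr ᵍ⊗[k] H.gr)) : Prop where
  even : IsEven A.gr (tensorGr A.gr H.gr) (coactLin ρ)
  coassoc : ∀ a : A, TensorProduct.assoc k A H H ((coactLin ρ).rTensor H (coactLin ρ a)) =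
    (Coalgebra.comul (R := k)).lTensor A (coactLin ρ a)
  counit : ∀ a : A, (Coalgebra.counit (R := k)).lTensor A (coactLin ρ a) = a ⊗ₜ[k] 1

/-- The co-tensor product `D □_{H̄} H`: the elements `∑ dᵢ ⊗ hᵢ` of `D ⊗ H` such that
`∑ ρ(dᵢ) ⊗ hᵢ = ∑ dᵢ ⊗ (h̄ᵢ)₍₁₎ ⊗ (hᵢ)₍₂₎`. -/
def cotensor (H : HopfSuperAlg.{u, v} k) {D : SuperAlg.{u, w} k}
    (ρ : D →ₐ[k] (D.gr ᵍ⊗[k] H.bar.gr)) : Submodule k (D ⊗[k] H) :=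
  LinearMap.eqLocus
    ((TensorProduct.assoc k D H.bar H).toLinearMap ∘ₗ (coactLin ρ).rTensor H)
    (H.leftCoactLin.lTensor D)

end Comodules

section Flatness

variable {k : Type u} [Field k]

/-- A (left) super-module over the super-algebra `B`. -/
structure SuperMod (B : SuperAlg.{u, w} k) where
  carrier : Type v
  [addCommGroup : AddCommGroup carrier]
  [module : Module k carrier]
  gr : ZMod 2 → Submodule k carrier
  [decomposition : DirectSum.Decomposition gr]
  act : B →ₐ[k] Module.End k carrier
  act_mem : ∀ {i j : ZMod 2} {b : B} {n : carrier}, b ∈ B.gr i → n ∈ gr j → act b n ∈ gr (i + j)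

attribute [instance] SuperMod.addCommGroup SuperMod.module SuperMod.decomposition

/-- Morphisms of super-modules: even `B`-linear maps. -/
structure SuperMod.Hom {B : SuperAlg.{u, w} k} (M N : SuperMod.{u, v, w} B) where
  toLin : M.carrier →ₗ[k] N.carrier
  even : IsEven M.gr N.gr toLin
  map_act : ∀ (b : B) (m : M.carrier), toLin (M.act b m) = N.act b (toLin m)

section

variable {A : SuperAlg.{u, x} k} {B : SuperAlg.{u, w} k} (η : B →ₐ[k] A)
  {N : Type v} [AddCommGroup N] [Module k N] (l : B →ₐ[k] Module.End k N)

/-- The subspace of `A ⊗ N` spanned by the elements `a b ⊗ n - a ⊗ b n` with `b ∈ B`. -/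
def balanced : Submodule k (A ⊗[k] N) :=
  Submodule.span k {t | ∃ (a : A) (b : B) (n : N), t = (a * η b) ⊗ₜ[k] n - a ⊗ₜ[k] (l b n)}

/-- The tensor product `A ⊗_B N`, where `A` is a right `B`-module through `η : B → A`, and `B` acts
on `N` on the left by `l`. -/
abbrev RelTensor : Type (max x v) := (A ⊗[k] N) ⧸ balanced η l

end

/-- The map `id ⊗_B g : A ⊗_B M → A ⊗_B N` induced by a morphism `g : M → N`. -/
def relTensorMap {A : SuperAlg.{u, x} k} {B : SuperAlg.{u, w} k} (η : B →ₐ[k] A)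
    {M N : SuperMod.{u, v, w} B} (g : M.Hom N) : RelTensor η M.act →ₗ[k] RelTensor η N.act :=
  Submodule.mapQ _ _ (g.toLin.lTensor A)
    (by
      refine Submodule.span_le.2 ?_
      rintro _ ⟨a, b, n, rfl⟩
      refine Submodule.subset_span ⟨a, b, g.toLin n, ?_⟩
      rw [map_sub, LinearMap.lTensor_tmul, LinearMap.lTensor_tmul, g.map_act])

/-- `η : B → A` is faithfully flat: the functor `A ⊗_B -` on `B`-super-modules preserves and
reflects exact sequences. -/
def FaithfullyFlat {A : SuperAlg.{u, x} k} {B : SuperAlg.{u, w} k} (η : B →ₐ[k] A) : Prop :=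
  ∀ (L M N : SuperMod.{u, w, w} B) (f : L.Hom M) (g : M.Hom N),
    Function.Exact f.toLin g.toLin ↔ Function.Exact (relTensorMap η f) (relTensorMap η g)

end Flatness

section Galois

variable {k : Type u} [Field k]

/-- The map `β : A ⊗_B A → A ⊗ H`, `β(a ⊗ a') = a ρ(a')`. It is well defined as `B` consists of
coinvariants. -/
def beta {H : HopfSuperAlg.{u, v} k} {A : SuperAlg.{u, w} k} {B : SuperAlg.{u, x} k}
    (ρ : A →ₐ[k] (A.gr ᵍ⊗[k] H.gr)) (η : B →ₐ[k] A)
    (hη : ∀ b : B, ρ (η b) = GradedTensorProduct.tmul k (η b) (1 : H)) :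
    RelTensor η ((Algebra.lmul k A).comp η) →ₗ[k] (A.gr ᵍ⊗[k] H.gr) :=
  (balanced η ((Algebra.lmul k A).comp η)).liftQ
    (LinearMap.mul' k (A.gr ᵍ⊗[k] H.gr) ∘ₗ
      TensorProduct.map (GradedTensorProduct.includeLeft A.gr H.gr).toLinearMap ρ.toLinearMap)
    (by
      refine Submodule.span_le.2 ?_
      rintro _ ⟨a, b, n, rfl⟩
      refine LinearMap.mem_ker.2 ?_
      have h : GradedTensorProduct.includeLeft A.gr H.gr (η b) = ρ (η b) := (hη b).symm
      rw [map_sub, sub_eq_zero]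
      change GradedTensorProduct.includeLeft A.gr H.gr (a * η b) * ρ n =
        GradedTensorProduct.includeLeft A.gr H.gr a * ρ (η b * n)
      rw [map_mul, map_mul, h, mul_assoc])

/-- `A = (A, ρ)` is an `H`-Galois extension over `B`: it is an algebra in the category of right
`H`-super-comodules, `η` identifies `B` with the super-subalgebra `{a | ρ(a) = a ⊗ 1}` of
`H`-coinvariants of `A`, the inclusion `B → A` is faithfully flat, and `β` is bijective. -/
structure IsGalois (H : HopfSuperAlg.{u, v} k) (A : SuperAlg.{u, w} k)
    (ρ : A →ₐ[k] (A.gr ᵍ⊗[k] H.gr)) (B : SuperAlg.{u, x} k) (η : B →ₐ[k] A) : Prop where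
  coaction : IsCoaction ρ
  even : IsEven B.gr A.gr η
  injective : Function.Injective η
  coinv : ∀ a : A, a ∈ η.range ↔ ρ a = GradedTensorProduct.tmul k a (1 : H)
  faithfullyFlat : FaithfullyFlat η
  beta_bijective : Function.Bijective (beta ρ η fun b => (coinv _).1 ⟨b, rfl⟩)

/-- `φ` is an isomorphism from `A` onto the inflation `D □_{H̄} H` of `D`, as algebras in the
category of right `H`-super-comodules and over `B`. Here `D □_{H̄} H ⊆ D ⊗ H` has the algebra
structure, the grading and the coaction `id ⊗ Δ` inherited from `D ⊗ H`, and `B` is mapped into it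
by `b ↦ b ⊗ 1`; thus `φ` is given as an algebra morphism `A → D ⊗ H`. -/
structure IsInflationIso {H : HopfSuperAlg.{u, v} k} {A : SuperAlg.{u, w} k}
    (ρ : A →ₐ[k] (A.gr ᵍ⊗[k] H.gr)) {B : SuperAlg.{u, x} k} (η : B →ₐ[k] A)
    {D : SuperAlg.{u, w} k} (ρD : D →ₐ[k] (D.gr ᵍ⊗[k] H.bar.gr)) (ηD : B →ₐ[k] D)
    (φ : A →ₐ[k] (D.gr ᵍ⊗[k] H.gr)) : Prop where
  injective : Function.Injective φ
  range : LinearMap.range (plain D H.toSuperAlg ∘ₗ φ.toLinearMap) = cotensor H ρD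
  even : IsEven A.gr (tensorGr D.gr H.gr) (plain D H.toSuperAlg ∘ₗ φ.toLinearMap)
  colinear : ∀ a : A,
    TensorProduct.assoc k D H H
        ((plain D H.toSuperAlg ∘ₗ φ.toLinearMap).rTensor H (coactLin ρ a)) =
      (Coalgebra.comul (R := k)).lTensor D (plain D H.toSuperAlg (φ a))
  map_base : ∀ b : B, φ (η b) = GradedTensorProduct.tmul k (ηD b) (1 : H)

/-- The `H`-Galois extension `A / B` arises from the `H̄`-Galois extension `D / B`. -/
def ArisesFrom {H : HopfSuperAlg.{u, v} k} {A : SuperAlg.{u, w} k}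
    (ρ : A →ₐ[k] (A.gr ᵍ⊗[k] H.gr)) {B : SuperAlg.{u, x} k} (η : B →ₐ[k] A)
    {D : SuperAlg.{u, w} k} (ρD : D →ₐ[k] (D.gr ᵍ⊗[k] H.bar.gr)) (ηD : B →ₐ[k] D) : Prop :=
  ∃ φ : A →ₐ[k] (D.gr ᵍ⊗[k] H.gr), IsInflationIso ρ η ρD ηD φ

/-- `f : R → A` is a morphism of algebras in the category of right `H`-super-comodules, where `R` is
the algebra of left `H̄`-coinvariants of `H`, graded as a subspace of `H`. -/
structure IsCoinvMorphism {H : HopfSuperAlg.{u, v} k} {A : SuperAlg.{u, w} k}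
    (ρ : A →ₐ[k] (A.gr ᵍ⊗[k] H.gr)) (f : H.coinv →ₐ[k] A) : Prop where
  even : ∀ (i : ZMod 2) (x : H.coinv), (x : H) ∈ H.gr i → f x ∈ A.gr i
  colinear : ∀ x : H.coinv, coactLin ρ (f x) = f.toLinearMap.rTensor H (H.coinvCoact x)

section

variable {H : HopfSuperAlg.{u, v} k} {A : SuperAlg.{u, w} k}
  {ρ : A →ₐ[k] (A.gr ᵍ⊗[k] H.gr)} {f : H.coinv →ₐ[k] A}

/-- The super-ideal `(f(R⁺))` of `A` generated by the image of `R⁺ = R ∩ Ker ε`. -/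
def augIdeal (f : H.coinv →ₐ[k] A) : Ideal A :=
  Ideal.span (f '' {x : H.coinv | Coalgebra.counit (R := k) (x : H) = 0})

theorem augIdeal_homogeneous (hf : IsCoinvMorphism ρ f) : (augIdeal f).IsHomogeneous A.gr := by
  have h : augIdeal f = Ideal.span (f '' {x : H.coinv |
      Coalgebra.counit (R := k) (x : H) = 0 ∧ ∃ i, (x : H) ∈ H.gr i}) := by
    apply le_antisymm
    · refine Ideal.span_le.2 ?_
      rintro _ ⟨x, hx, rfl⟩
      let y (i : ZMod 2) : H.coinv := ⟨H.proj i x, H.proj_mem_coinv i x.2⟩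
      have hxy : x = y 0 + y 1 := Subtype.ext (H.proj_add_proj x).symm
      have hy (i : ZMod 2) : f (y i) ∈ Ideal.span (f '' {x : H.coinv |
          Coalgebra.counit (R := k) (x : H) = 0 ∧ ∃ i, (x : H) ∈ H.gr i}) :=
        Ideal.subset_span ⟨y i, ⟨H.counit_proj i hx, i,
          SetLike.coe_mem (DirectSum.decompose H.gr (x : H) i)⟩, rfl⟩
      rw [hxy, map_add]
      exact add_mem (hy 0) (hy 1)
    · exact Ideal.span_mono (Set.image_mono fun x hx => hx.1)
  rw [h]
  refine Ideal.homogeneous_span A.gr _ ?_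
  rintro _ ⟨x, ⟨-, i, hi⟩, rfl⟩
  exact ⟨i, hf.even i x hi⟩

/-- The quotient super-algebra `D_f = A / (f(R⁺))`. -/
def Df (hf : IsCoinvMorphism ρ f) : SuperAlg.{u, w} k :=
  A.quot (augIdeal f) (augIdeal_homogeneous hf)

/-- The quotient map `A → D_f`, `a ↦ ā`. -/
def toDf (hf : IsCoinvMorphism ρ f) : A →ₐ[k] Df hf :=
  A.quotMk (augIdeal f) (augIdeal_homogeneous hf)

theorem toDf_even (hf : IsCoinvMorphism ρ f) : IsEven A.gr (Df hf).gr (toDf hf) :=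
  A.quotMk_even _ _

/-- The map `ι : A → D_f ⊗ H`, `a ↦ ā₍₀₎ ⊗ a₍₁₎`, where `ρ(a) = a₍₀₎ ⊗ a₍₁₎`. -/
def iota (hf : IsCoinvMorphism ρ f) : A →ₐ[k] ((Df hf).gr ᵍ⊗[k] H.gr) :=
  (gtMap (toDf hf) (toDf_even hf) (AlgHom.id k H) (isEven_id H.toSuperAlg)).comp ρ

end

end Galois

end SuperHopf

end

open scoped TensorProduct

/-! Everything rests on one fact about `H` alone: since 2 is invertible, the quotient map from `H`
to `H̄ = H/(H_1)` has an even section γ that is an algebra morphism and is left `H̄`-colinear.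

To find γ, regard `H` as the functions on a supergroup `G`. Even algebra morphisms `H → H` are
points of `G`, multiplied by convolution. The identity is the generic point g, and the parity
automorphism σ, which multiplies odd elements by -1, gives the point σ(g). Put w = σ(g) g⁻¹, so that
σ(w) = w⁻¹ and w becomes trivial modulo `(H_1)`. Odd elements have square zero, so w - 1 is locally
nilpotent for convolution and w has a square root. Let m = w^{1/2} g, the geometric mean of g and
σ(g). Then σ(m) = w^{-1/2} w g = m. As m is an even map whose values are fixed by σ, it kills `H_1`,
hence factors through `H̄`; modulo `(H_1)` it is g. The left coaction sends g to ḡg and w to ḡwḡ⁻¹,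
hence m to ḡm, which is colinearity (`leftCoact_mean`).

In general w^{1/2} is not a Laurent polynomial in w, but on any finite set of elements of `H` it
agrees with one, namely with P(w) where P² ≡ T modulo a high power of T - 1. Such a P is unique
modulo that power. This uniqueness gives independence of choices, invariance under σ (compare P with
T·P(T⁻¹)) and multiplicativity (compare P(T ⊗ T) with P ⊗ P).

Given γ, the points g⁻¹m and m⁻¹g are invariant under left translation by ḡ, so they take values in
`R`, and they are inverse to each other. For a morphism f from `R` to `A`, the endomorphism a ↦ a₍₀₎
f((g⁻¹m)(a₍₁₎)) of `A` sends f(r) to ε(r). It therefore induces an algebra section s of `A → D_f`,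
and d ⊗ h ↦ s(d) f((m⁻¹g)(h)) inverts ι on the cotensor product (`iotaRetract_iota`,
`iota_iotaRetract`).

The Galois properties descend along s and ι. As right `B`-modules, `D_f` is a retract of `A` and `A`
is a retract of `H ⊗ D_f`, so faithful flatness passes to `D_f` (`FaithfullyFlat.of_retract`).
Coinvariants of `D_f` are lifted to `B` by s, and β for `D_f` is compared with β for `A`
(`beta_rhoDf_injective`). Conversely, r ↦ 1 ⊗ r embeds `R` into any cotensor product `D □ H`, which
gives a morphism from `R` to `A` whenever `A` is an inflation (`IsInflationIso.isCoinvMorphism`). -/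

noncomputable section

namespace SuperHopf

universe u v w x y z

open WithConv LaurentPolynomial

/-! ### Convolution algebras and their action through a coaction. -/

section Convolution

variable {k : Type u} [Field k]

/-- Composition with an algebra morphism `T → T'` is a morphism of convolution algebras. -/
def convMap (X : Type v) [AddCommGroup X] [Module k X] [Coalgebra k X] {T : Type w} {T' : Type x}
    [Ring T] [Algebra k T] [Ring T'] [Algebra k T'] (h : T →ₐ[k] T') :
    WithConv (X →ₗ[k] T) →ₐ[k] WithConv (X →ₗ[k] T') :=
  AlgHom.ofLinearMap
    { toFun := fun f => toConv (h.toLinearMap ∘ₗ f.ofConv)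
      map_add' := fun f g => by simp [LinearMap.comp_add]
      map_smul' := fun c f => by simp [LinearMap.comp_smul] }
    (by
      refine WithConv.ext (LinearMap.ext fun c => ?_)
      exact h.commutes _)
    (fun f g => WithConv.ext (LinearMap.algHom_comp_convMul_distrib h f g))

/-- The action `(α ⋆ φ)(a) = α(a₍₀₎) φ(a₍₁₎)` of `Hom(H, T)` on `Hom(A, T)` given by a linear map
`r : A → A ⊗ H`. -/
def coactMul {A : Type v} {H : Type w} {T : Type x} [AddCommGroup A] [Module k A]
    [AddCommGroup H] [Module k H] [Ring T] [Algebra k T] (r : A →ₗ[k] A ⊗[k] H)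
    (α : A →ₗ[k] T) (φ : H →ₗ[k] T) : A →ₗ[k] T :=
  LinearMap.mul' k T ∘ₗ TensorProduct.map α φ ∘ₗ r

/-- Coassociativity makes `Hom(A, T)` a right module over the convolution algebra `Hom(H, T)`. With
`coactMul_one`, this turns later computations with a₍₀₎, a₍₁₎, a₍₂₎ into identities between
convolution products. -/
theorem coactMul_coactMul {A : Type v} {H : Type w} {T : Type x} [AddCommGroup A] [Module k A]
    [AddCommGroup H] [Module k H] [Coalgebra k H] [Ring T] [Algebra k T] {r : A →ₗ[k] A ⊗[k] H}
    (hr : ∀ a : A, TensorProduct.assoc k A H H (r.rTensor H (r a)) =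
      (Coalgebra.comul (R := k)).lTensor A (r a))
    (α : A →ₗ[k] T) (φ ψ : WithConv (H →ₗ[k] T)) :
    coactMul r (coactMul r α φ.ofConv) ψ.ofConv = coactMul r α (φ * ψ).ofConv := by
  let G : A ⊗[k] (H ⊗[k] H) →ₗ[k] T :=
    LinearMap.mul' k T ∘ₗ TensorProduct.map α (LinearMap.mul' k T ∘ₗ
      TensorProduct.map φ.ofConv ψ.ofConv)
  have h₁ : ∀ t : A ⊗[k] H, LinearMap.mul' k T
      (TensorProduct.map (coactMul r α φ.ofConv) ψ.ofConv t) =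
        G (TensorProduct.assoc k A H H (r.rTensor H t)) := by
    intro t
    induction t using TensorProduct.induction_on with
    | zero => simp
    | add x y hx hy => simp only [map_add, hx, hy]
    | tmul a h =>
      simp only [TensorProduct.map_tmul, LinearMap.rTensor_tmul, coactMul, LinearMap.comp_apply,
        LinearMap.mul'_apply]
      generalize r a = s
      induction s using TensorProduct.induction_on with
      | zero => simp
      | add x y hx hy => simp only [map_add, add_mul, TensorProduct.add_tmul, hx, hy]
      | tmul a' h' => simp [G, mul_assoc]
  have h₂ : ∀ t : A ⊗[k] H, LinearMap.mul' k T
      (TensorProduct.map α (φ * ψ).ofConv t) = G ((Coalgebra.comul (R := k)).lTensor A t) := by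
    intro t
    induction t using TensorProduct.induction_on with
    | zero => simp
    | add x y hx hy => simp only [map_add, hx, hy]
    | tmul a h => rfl
  refine LinearMap.ext fun a => ?_
  refine (h₁ (r a)).trans ?_
  rw [hr]
  exact (h₂ (r a)).symm

theorem coactMul_one {A : Type v} {H : Type w} {T : Type x} [AddCommGroup A] [Module k A]
    [AddCommGroup H] [Module k H] [Coalgebra k H] [Ring T] [Algebra k T] {r : A →ₗ[k] A ⊗[k] H}
    (hr : ∀ a : A, (Coalgebra.counit (R := k)).lTensor A (r a) = a ⊗ₜ[k] 1)
    (α : A →ₗ[k] T) : coactMul r α (1 : WithConv (H →ₗ[k] T)).ofConv = α := by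
  have h : ∀ t : A ⊗[k] H, LinearMap.mul' k T
      (TensorProduct.map α (1 : WithConv (H →ₗ[k] T)).ofConv t) =
        LinearMap.mul' k T (TensorProduct.map α (Algebra.linearMap k T)
          ((Coalgebra.counit (R := k)).lTensor A t)) := by
    intro t
    induction t using TensorProduct.induction_on with
    | zero => simp
    | add x y hx hy => simp only [map_add, hx, hy]
    | tmul a h => rfl
  refine LinearMap.ext fun a => ?_
  refine (h (r a)).trans ?_
  rw [hr]
  simp

theorem comp_coactMul {A : Type v} {H : Type w} {T : Type x} {T' : Type*} [AddCommGroup A]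
    [Module k A] [AddCommGroup H] [Module k H] [Ring T] [Algebra k T] [Ring T'] [Algebra k T']
    (r : A →ₗ[k] A ⊗[k] H) (h : T →ₐ[k] T') (α : A →ₗ[k] T) (φ : H →ₗ[k] T) :
    h.toLinearMap ∘ₗ coactMul r α φ =
      coactMul r (h.toLinearMap ∘ₗ α) (h.toLinearMap ∘ₗ φ) := by
  refine LinearMap.ext fun a => ?_
  simp only [coactMul, LinearMap.comp_apply]
  generalize r a = s
  induction s using TensorProduct.induction_on with
  | zero => simp
  | add x y hx hy => simp only [map_add, hx, hy]
  | tmul a' h' => simp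

end Convolution

/-! ### Even algebra morphisms into a super-commutative algebra. -/

section Points

variable {k : Type u} [Field k]

/-- The algebra morphism `A ⊗ B → T`, `a ⊗ b ↦ α(a) φ(b)`, into a super-commutative algebra. -/
def mulLift {A : SuperAlg.{u, v} k} {B : SuperAlg.{u, w} k} {T : SuperAlg.{u, x} k}
    (α : A →ₐ[k] T) (hα : IsEven A.gr T.gr α) (φ : B →ₐ[k] T) (hφ : IsEven B.gr T.gr φ) :
    (A.gr ᵍ⊗[k] B.gr) →ₐ[k] T :=
  GradedTensorProduct.lift A.gr B.gr α φ fun _ _ a b =>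
    T.supercomm (hφ _ _ b.2) (hα _ _ a.2)

theorem tensorGr_le_iff {V : Type v} {W : Type w} {X : Type x} [AddCommGroup V] [Module k V]
    [AddCommGroup W] [Module k W] [AddCommGroup X] [Module k X] {𝒱 : ZMod 2 → Submodule k V}
    {𝒲 : ZMod 2 → Submodule k W} {i : ZMod 2} {F : V ⊗[k] W →ₗ[k] X} {P : Submodule k X} :
    tensorGr 𝒱 𝒲 i ≤ P.comap F ↔
      ∀ j l : ZMod 2, j + l = i → ∀ a ∈ 𝒱 j, ∀ b ∈ 𝒲 l, F (a ⊗ₜ[k] b) ∈ P := by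
  constructor
  · rintro h j l rfl a ha b hb
    refine h (Submodule.mem_iSup_of_mem j (Submodule.apply_mem_map₂ _ ha ?_))
    rwa [add_sub_cancel_left]
  · intro h
    exact iSup_le fun j => Submodule.map₂_le.2 fun a ha b hb =>
      h j (i - j) (add_sub_cancel _ _) a ha b hb

theorem tmul_mem_tensorGr {V : Type v} {W : Type w} [AddCommGroup V] [Module k V]
    [AddCommGroup W] [Module k W] {𝒱 : ZMod 2 → Submodule k V} {𝒲 : ZMod 2 → Submodule k W}
    {j l : ZMod 2} {a : V} {b : W} (ha : a ∈ 𝒱 j) (hb : b ∈ 𝒲 l) :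
    a ⊗ₜ[k] b ∈ tensorGr 𝒱 𝒲 (j + l) :=
  tensorGr_le_iff (F := LinearMap.id).1 (by simp) j l rfl a ha b hb

theorem mulLift_mem {A : SuperAlg.{u, v} k} {B : SuperAlg.{u, w} k} {T : SuperAlg.{u, x} k}
    (α : A →ₐ[k] T) (hα : IsEven A.gr T.gr α) (φ : B →ₐ[k] T) (hφ : IsEven B.gr T.gr φ)
    {t : A.gr ᵍ⊗[k] B.gr} {i : ZMod 2} (ht : plain A B t ∈ tensorGr A.gr B.gr i) :
    mulLift α hα φ hφ t ∈ T.gr i := by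
  refine tensorGr_le_iff (P := T.gr i) (F := LinearMap.mul' k T ∘ₗ
    TensorProduct.map α.toLinearMap φ.toLinearMap) |>.2 ?_ ht
  rintro j l rfl a ha b hb
  exact SetLike.mul_mem_graded (hα _ _ ha) (hφ _ _ hb)

/-- The algebra morphism `a ↦ α(a₍₀₎) φ(a₍₁₎)`. -/
def coactMulAlg {A : SuperAlg.{u, w} k} {H : HopfSuperAlg.{u, v} k} {T : SuperAlg.{u, x} k}
    (ρ : A →ₐ[k] (A.gr ᵍ⊗[k] H.gr)) (α : A →ₐ[k] T) (hα : IsEven A.gr T.gr α) (φ : H →ₐ[k] T)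
    (hφ : IsEven H.gr T.gr φ) : A →ₐ[k] T :=
  (mulLift α hα φ hφ).comp ρ

theorem coactMulAlg_even {A : SuperAlg.{u, w} k} {H : HopfSuperAlg.{u, v} k}
    {T : SuperAlg.{u, x} k} {ρ : A →ₐ[k] (A.gr ᵍ⊗[k] H.gr)}
    (hρ : IsEven A.gr (tensorGr A.gr H.gr) (coactLin ρ)) (α : A →ₐ[k] T)
    (hα : IsEven A.gr T.gr α) (φ : H →ₐ[k] T) (hφ : IsEven H.gr T.gr φ) :
    IsEven A.gr T.gr (coactMulAlg ρ α hα φ hφ) :=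
  fun i a ha => mulLift_mem α hα φ hφ (hρ i a ha)

end Points

/-! ### The antipode is an algebra morphism. -/

section Antipode

variable {k : Type u} [Field k] (H : HopfSuperAlg.{u, v} k)

namespace HopfSuperAlg

/-- The map `a ⊗ b ↦ a φ(b₍₁₎) ⊗ b₍₂₎`. -/
def translate (φ : H →ₗ[k] H) : H ⊗[k] H →ₗ[k] H ⊗[k] H :=
  (LinearMap.mul' k H).rTensor H ∘ₗ (TensorProduct.assoc k H H H).symm.toLinearMap ∘ₗ
    (φ.rTensor H ∘ₗ Coalgebra.comul).lTensor H

theorem translate_tmul (φ : H →ₗ[k] H) (a b : H) : H.translate φ (a ⊗ₜ[k] b) =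
    TensorProduct.map (LinearMap.mulLeft k a ∘ₗ φ) LinearMap.id (Coalgebra.comul (R := k) b) := by
  simp only [translate, LinearMap.comp_apply, LinearMap.lTensor_tmul]
  generalize (Coalgebra.comul (R := k) b) = s
  induction s using TensorProduct.induction_on with
  | zero => simp
  | add x y hx hy => simp only [map_add, TensorProduct.tmul_add, hx, hy]
  | tmul x y => simp

/-- By coassociativity, translations compose through convolution. For `id` and the antipode this
shows that the two translations are inverse to each other. -/
theorem translate_translate (φ ψ : WithConv (H →ₗ[k] H)) (t : H ⊗[k] H) :
    H.translate φ.ofConv (H.translate ψ.ofConv t) = H.translate (ψ * φ).ofConv t := by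
  induction t using TensorProduct.induction_on with
  | zero => simp
  | add x y hx hy => simp only [map_add, hx, hy]
  | tmul a b =>
    let G : H ⊗[k] (H ⊗[k] H) →ₗ[k] H ⊗[k] H :=
      TensorProduct.map (LinearMap.mulLeft k a ∘ₗ LinearMap.mul' k H ∘ₗ
        TensorProduct.map ψ.ofConv φ.ofConv) LinearMap.id ∘ₗ
        (TensorProduct.assoc k H H H).symm.toLinearMap
    have h₁ : ∀ s : H ⊗[k] H, H.translate φ.ofConv
        (TensorProduct.map (LinearMap.mulLeft k a ∘ₗ ψ.ofConv) LinearMap.id s) =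
          G ((Coalgebra.comul (R := k)).lTensor H s) := by
      intro s
      induction s using TensorProduct.induction_on with
      | zero => simp
      | add x y hx hy => simp only [map_add, hx, hy]
      | tmul x y =>
        rw [TensorProduct.map_tmul, LinearMap.id_apply, translate_tmul, LinearMap.lTensor_tmul]
        generalize (Coalgebra.comul (R := k) y) = s
        induction s using TensorProduct.induction_on with
        | zero => simp
        | add x y hx hy => simp only [map_add, TensorProduct.tmul_add, hx, hy]
        | tmul x y => simp [G]
    have h₂ : ∀ s : H ⊗[k] H,
        TensorProduct.map (LinearMap.mulLeft k a ∘ₗ (ψ * φ).ofConv) LinearMap.id s =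
          G (TensorProduct.assoc k H H H ((Coalgebra.comul (R := k)).rTensor H s)) := by
      intro s
      induction s using TensorProduct.induction_on with
      | zero => simp
      | add x y hx hy => simp only [map_add, hx, hy]
      | tmul x y => simp [G]
    rw [translate_tmul, translate_tmul, h₁, h₂, Coalgebra.coassoc_apply]

theorem translate_one (t : H ⊗[k] H) :
    H.translate (1 : WithConv (H →ₗ[k] H)).ofConv t = t := by
  induction t using TensorProduct.induction_on with
  | zero => simp
  | add x y hx hy => simp only [map_add, hx, hy]
  | tmul a b =>
    have h : ∀ s : H ⊗[k] H, TensorProduct.map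
        (LinearMap.mulLeft k a ∘ₗ (1 : WithConv (H →ₗ[k] H)).ofConv) LinearMap.id s =
          TensorProduct.map (LinearMap.toSpanSingleton k H a) LinearMap.id
            ((Coalgebra.counit (R := k)).rTensor H s) := by
      intro s
      induction s using TensorProduct.induction_on with
      | zero => simp
      | add x y hx hy => simp only [map_add, hx, hy]
      | tmul x y =>
        simp [Algebra.algebraMap_eq_smul_one]
    rw [translate_tmul, h, Coalgebra.rTensor_counit_comul]
    simp

theorem antipode_conv : toConv H.antipode * toConv (LinearMap.id : H →ₗ[k] H) = 1 :=
  WithConv.ext H.mul_antipode_rTensor_comul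

theorem conv_antipode : toConv (LinearMap.id : H →ₗ[k] H) * toConv H.antipode = 1 :=
  WithConv.ext H.mul_antipode_lTensor_comul

theorem includeLeft_mul_of (a : H) (t : H ⊗[k] H) :
    GradedTensorProduct.includeLeft H.gr H.gr a * GradedTensorProduct.of k H.gr H.gr t =
      GradedTensorProduct.of k H.gr H.gr ((LinearMap.mulLeft k a).rTensor H t) := by
  induction t using TensorProduct.induction_on with
  | zero => simp
  | add x y hx hy => simp only [map_add, mul_add, hx, hy]
  | tmul x y =>
    have h := GradedTensorProduct.tmul_one_mul_one_tmul (R := k) H.gr H.gr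
    rw [LinearMap.rTensor_tmul]
    refine (congrArg (_ * ·) (h x y).symm).trans ((mul_assoc _ _ _).symm.trans ?_)
    refine Eq.trans ?_ (h _ y)
    congr 1
    exact (map_mul (GradedTensorProduct.includeLeft H.gr H.gr) a x).symm

/-- `a ⊗ 1` super-commutes with homogeneous elements of `H ⊗ H`, and Δ preserves degrees. This is
the sign condition under which `GradedTensorProduct.lift` produces the algebra morphism
`translateAlg`. -/
theorem includeLeft_mul_comulAlg {i j : ZMod 2} (a : H.gr i) (b : H.gr j) :
    GradedTensorProduct.includeLeft H.gr H.gr (a : H) * H.comulAlg b =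
      (-1 : ℤˣ) ^ (j * i) •
        (H.comulAlg b * GradedTensorProduct.includeLeft H.gr H.gr (a : H)) := by
  let L := LinearMap.mulLeft k (GradedTensorProduct.includeLeft H.gr H.gr (a : H)) -
    (((-1 : ℤˣ) ^ (j * i) : ℤˣ) : ℤ) •
      LinearMap.mulRight k (GradedTensorProduct.includeLeft H.gr H.gr (a : H))
  suffices h : tensorGr H.gr H.gr j ≤
      Submodule.comap (L ∘ₗ (GradedTensorProduct.of k H.gr H.gr).toLinearMap) ⊥ from
    sub_eq_zero.1 ((Submodule.mem_bot k).1 (h (H.comul_even j b b.2)))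
  refine tensorGr_le_iff.2 ?_
  rintro l m rfl x hx y hy
  rw [Submodule.mem_bot]
  refine sub_eq_zero.2 ?_
  have h₁ : GradedTensorProduct.includeLeft H.gr H.gr (a : H) *
      GradedTensorProduct.tmul k x y = GradedTensorProduct.tmul k ((a : H) * x) y :=
    H.includeLeft_mul_of a (x ⊗ₜ y)
  have h₂ := GradedTensorProduct.tmul_coe_mul_coe_tmul (R := k) H.gr H.gr
    x (⟨y, hy⟩ : H.gr m) a (1 : H)
  rw [mul_one] at h₂
  refine h₁.trans ?_
  refine Eq.trans ?_ (congrArg (fun z => (((-1 : ℤˣ) ^ ((l + m) * i) : ℤˣ) : ℤ) • z) h₂.symm)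
  have h₃ := H.supercomm hx a.2
  rw [h₃, Units.smul_def, Units.smul_def, smul_smul, add_mul]
  -- The sign for moving `a` past `y` occurs twice and cancels; only the one for moving `a` past `x`
  -- remains.
  have h₄ : ((((-1 : ℤˣ) ^ (l * i + m * i) : ℤˣ) : ℤ) * (((-1 : ℤˣ) ^ (m * i) : ℤˣ) : ℤ)) =
      (((-1 : ℤˣ) ^ (l * i) : ℤˣ) : ℤ) := by
    rw [uzpow_add, Units.val_mul, mul_assoc, ← Units.val_mul, Int.units_mul_self, Units.val_one,
      mul_one]
  rw [h₄]
  change GradedTensorProduct.of k H.gr H.gr (((_ : ℤ) • (x * (a : H))) ⊗ₜ[k] y) = _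
  exact (congrArg (GradedTensorProduct.of k H.gr H.gr)
    (map_zsmul ((TensorProduct.mk k H H).flip y) _ _)).trans (map_zsmul _ _ _)

/-- The isomorphism `a ⊗ b ↦ a b₍₁₎ ⊗ b₍₂₎` is an algebra morphism. -/
def translateAlg : (H.gr ᵍ⊗[k] H.gr) →ₐ[k] (H.gr ᵍ⊗[k] H.gr) :=
  GradedTensorProduct.lift H.gr H.gr (GradedTensorProduct.includeLeft H.gr H.gr) H.comulAlg
    fun _ _ a b => H.includeLeft_mul_comulAlg a b

theorem translateAlg_apply (t : H ⊗[k] H) :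
    H.translateAlg (GradedTensorProduct.of k H.gr H.gr t) =
      GradedTensorProduct.of k H.gr H.gr (H.translate LinearMap.id t) := by
  induction t using TensorProduct.induction_on with
  | zero => simp
  | add x y hx hy => simp only [map_add, hx, hy]
  | tmul a b =>
    rw [translate_tmul]
    exact H.includeLeft_mul_of a _

/-- Translation by the antipode is the inverse of the bijective algebra morphism `translateAlg`,
hence is itself multiplicative. -/
theorem translate_antipode_mul (x y : H.gr ᵍ⊗[k] H.gr) :
    GradedTensorProduct.of k H.gr H.gr (H.translate H.antipode
      (plain H.toSuperAlg H.toSuperAlg (x * y))) =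
      GradedTensorProduct.of k H.gr H.gr (H.translate H.antipode (plain _ _ x)) *
      GradedTensorProduct.of k H.gr H.gr (H.translate H.antipode (plain _ _ y)) := by
  have h₁ : ∀ t : H ⊗[k] H, H.translate H.antipode (H.translate LinearMap.id t) = t := fun t => by
    rw [← ofConv_toConv H.antipode, ← ofConv_toConv (LinearMap.id : H →ₗ[k] H),
      translate_translate, conv_antipode, translate_one]
  have h₂ : ∀ t : H ⊗[k] H, H.translate LinearMap.id (H.translate H.antipode t) = t := fun t => by
    rw [← ofConv_toConv H.antipode, ← ofConv_toConv (LinearMap.id : H →ₗ[k] H),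
      translate_translate, antipode_conv, translate_one]
  have hinj : Function.Injective H.translateAlg := fun s t hst =>
    Function.LeftInverse.injective h₁
      ((H.translateAlg_apply s).symm.trans (hst.trans (H.translateAlg_apply t)))
  apply hinj
  rw [map_mul H.translateAlg, translateAlg_apply, translateAlg_apply, translateAlg_apply, h₂, h₂, h₂]
  rfl

/-- The algebra morphism `id ⊗ ε : H ⊗ H → H`. -/
def idCounit : (H.gr ᵍ⊗[k] H.gr) →ₐ[k] H :=
  mulLift (T := H.toSuperAlg) (AlgHom.id k H) (isEven_id H.toSuperAlg)
    ((Algebra.ofId k H).comp H.counitAlg)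
    (by
      intro i a ha
      rcases zmod_two i with rfl | rfl
      · exact SetLike.algebraMap_mem_graded H.gr _
      · have h : H.counitAlg a = 0 := H.counit_odd a ha
        rw [AlgHom.comp_apply, h, map_zero]
        exact zero_mem _)

theorem idCounit_translate (φ : H →ₗ[k] H) (a b : H) :
    H.idCounit (GradedTensorProduct.of k H.gr H.gr (H.translate φ (a ⊗ₜ b))) = a * φ b := by
  have h : ∀ s : H ⊗[k] H, H.idCounit (GradedTensorProduct.of k H.gr H.gr
      (TensorProduct.map (LinearMap.mulLeft k a ∘ₗ φ) LinearMap.id s)) =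
        a * φ (TensorProduct.rid k H ((Coalgebra.counit (R := k)).lTensor H s)) := by
    intro s
    induction s using TensorProduct.induction_on with
    | zero => simp
    | add x y hx hy => simp only [map_add, mul_add, hx, hy]
    | tmul x y =>
      have h' : H.idCounit (GradedTensorProduct.tmul k (a * φ x) y) =
        a * φ x * algebraMap k H (Coalgebra.counit (R := k) y) := rfl
      simpa [Algebra.algebraMap_eq_smul_one] using h'
  rw [translate_tmul, h, Coalgebra.lTensor_counit_comul]
  simp

/-- The antipode is the composite of c ↦ 1 ⊗ c, translation by the antipode, and id ⊗ ε, all of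
which are multiplicative. -/
theorem antipode_mul (a b : H) : H.antipode (a * b) = H.antipode a * H.antipode b := by
  have h := congrArg H.idCounit (H.translate_antipode_mul
    (GradedTensorProduct.includeRight H.gr H.gr a) (GradedTensorProduct.includeRight H.gr H.gr b))
  rw [map_mul H.idCounit, ← map_mul (GradedTensorProduct.includeRight H.gr H.gr)] at h
  have h' : ∀ c : H, H.idCounit (GradedTensorProduct.of k H.gr H.gr (H.translate H.antipode
      (plain _ _ (GradedTensorProduct.includeRight H.gr H.gr c)))) = H.antipode c := fun c =>
    (H.idCounit_translate H.antipode 1 c).trans (one_mul _)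
  rwa [h', h', h'] at h

/-- The antipode of a super-commutative Hopf super-algebra is an algebra morphism. -/
def antipodeAlg : H →ₐ[k] H :=
  AlgHom.ofLinearMap H.antipode H.antipode_one H.antipode_mul

end HopfSuperAlg

end Antipode

/-! ### Nilpotent ideals generated by odd elements. -/

section Nilpotence

variable {k : Type u} [Field k] (A : SuperAlg.{u, v} k)

namespace SuperAlg

theorem odd_mul_self (hchar : (2 : k) ≠ 0) {a : A} (ha : a ∈ A.gr 1) : a * a = 0 := by
  have h := A.supercomm ha ha
  rw [mul_one, uzpow_one, Units.smul_def, Units.val_neg, Units.val_one, neg_one_smul,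
    eq_neg_iff_add_eq_zero, ← two_smul k] at h
  exact (smul_eq_zero.1 h).resolve_left hchar

/-- A homogeneous element commutes with homogeneous elements up to sign, so the left and right
ideals it generates coincide. -/
theorem span_singleton_mul_top {i : ZMod 2} {a : A} (ha : a ∈ A.gr i) :
    Submodule.span k {a} * (⊤ : Submodule k A) = ⊤ * Submodule.span k {a} := by
  classical
  have hb : ∀ (b : A) (j : ZMod 2), a * (DirectSum.decompose A.gr b j : A) =
      (((-1 : ℤˣ) ^ (j * i) : ℤˣ) : ℤ) • ((DirectSum.decompose A.gr b j : A) * a) := fun b j =>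
    A.supercomm (SetLike.coe_mem _) ha
  have hb' : ∀ (b : A) (j : ZMod 2), (DirectSum.decompose A.gr b j : A) * a =
      (((-1 : ℤˣ) ^ (i * j) : ℤˣ) : ℤ) • (a * (DirectSum.decompose A.gr b j : A)) := fun b j =>
    A.supercomm ha (SetLike.coe_mem _)
  apply le_antisymm
  · refine Submodule.mul_le.2 fun x hx b _ => ?_
    obtain ⟨c, rfl⟩ := Submodule.mem_span_singleton.1 hx
    rw [smul_mul_assoc]
    refine Submodule.smul_mem _ _ ?_
    rw [← DirectSum.sum_support_decompose A.gr b, Finset.mul_sum]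
    refine Submodule.sum_mem _ fun j _ => ?_
    rw [hb]
    exact zsmul_mem (Submodule.mul_mem_mul Submodule.mem_top (Submodule.mem_span_singleton_self a)) _
  · refine Submodule.mul_le.2 fun b _ x hx => ?_
    obtain ⟨c, rfl⟩ := Submodule.mem_span_singleton.1 hx
    rw [mul_smul_comm]
    refine Submodule.smul_mem _ _ ?_
    rw [← DirectSum.sum_support_decompose A.gr b, Finset.sum_mul]
    refine Submodule.sum_mem _ fun j _ => ?_
    rw [hb']
    exact zsmul_mem (Submodule.mul_mem_mul (Submodule.mem_span_singleton_self a) Submodule.mem_top) _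

/-- A subspace is a nilpotent two-sided ideal. -/
structure IsNilpotentIdeal (G : Submodule k A) : Prop where
  mul_le_left : ⊤ * G ≤ G
  mul_le_right : G * ⊤ ≤ G
  nilpotent : IsNilpotent G

variable {A}

theorem IsNilpotentIdeal.sup {F G : Submodule k A} (hF : A.IsNilpotentIdeal F)
    (hG : A.IsNilpotentIdeal G) : A.IsNilpotentIdeal (F ⊔ G) where
  mul_le_left := by
    rw [Submodule.mul_sup]
    exact sup_le_sup hF.mul_le_left hG.mul_le_left
  mul_le_right := by
    rw [Submodule.sup_mul]
    exact sup_le_sup hF.mul_le_right hG.mul_le_right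
  nilpotent := by
    obtain ⟨a, ha⟩ := hF.nilpotent
    obtain ⟨b, hb⟩ := hG.nilpotent
    -- Every product with a factor in the ideal `G` stays in `G`, so modulo `G` only the power of
    -- `F` survives.
    have h : ∀ m, (F ⊔ G) ^ (m + 1) ≤ F ^ (m + 1) ⊔ G := by
      intro m
      induction m with
      | zero => simp
      | succ m ih =>
        rw [pow_succ, pow_succ F]
        refine (mul_le_mul' ih le_rfl).trans ?_
        rw [Submodule.mul_sup, Submodule.sup_mul, Submodule.sup_mul]
        refine sup_le (sup_le le_sup_left ?_) (sup_le ?_ ?_)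
        · exact ((mul_le_mul' le_rfl le_top).trans hG.mul_le_right).trans le_sup_right
        · exact ((mul_le_mul' le_top le_rfl).trans hG.mul_le_left).trans le_sup_right
        · exact ((mul_le_mul' le_top le_rfl).trans hG.mul_le_left).trans le_sup_right
    refine ⟨(a + 1) * b, ?_⟩
    have h' := h a
    rw [pow_succ F, ha, zero_mul, Submodule.zero_eq_bot, bot_sup_eq] at h'
    rw [pow_mul, Submodule.zero_eq_bot, eq_bot_iff]
    exact (pow_le_pow_left' h' b).trans hb.le

theorem isNilpotentIdeal_bot : A.IsNilpotentIdeal ⊥ where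
  mul_le_left := by simp
  mul_le_right := by simp
  nilpotent := ⟨1, by simp⟩

/-- The square of the ideal `A a` is contained in `A A a a`, which vanishes because a² = 0. -/
theorem isNilpotentIdeal_odd (hchar : (2 : k) ≠ 0) {a : A} (ha : a ∈ A.gr 1) :
    A.IsNilpotentIdeal (⊤ * Submodule.span k {a}) where
  mul_le_left := by
    rw [← mul_assoc]
    exact mul_le_mul' le_top le_rfl
  mul_le_right := by
    rw [mul_assoc, A.span_singleton_mul_top ha, ← mul_assoc]
    exact mul_le_mul' le_top le_rfl
  nilpotent := by
    refine ⟨2, ?_⟩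
    rw [pow_two, mul_assoc, ← mul_assoc (Submodule.span k {a}), A.span_singleton_mul_top ha,
      mul_assoc, Submodule.span_mul_span, Set.singleton_mul_singleton, A.odd_mul_self hchar ha]
    simp

theorem exists_isNilpotentIdeal_mem (hchar : (2 : k) ≠ 0) {y : A} (hy : y ∈ A.oddIdeal) :
    ∃ G : Submodule k A, A.IsNilpotentIdeal G ∧ y ∈ G := by
  refine Submodule.span_induction (p := fun y _ =>
    ∃ G : Submodule k A, A.IsNilpotentIdeal G ∧ y ∈ G) ?_ ?_ ?_ ?_ hy
  · intro a ha
    refine ⟨_, isNilpotentIdeal_odd hchar ha, ?_⟩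
    have h := Submodule.mul_mem_mul (M := (⊤ : Submodule k A)) (m := 1) trivial
      (Submodule.mem_span_singleton_self (R := k) a)
    rwa [one_mul] at h
  · exact ⟨⊥, isNilpotentIdeal_bot, zero_mem _⟩
  · rintro x y _ _ ⟨F, hF, hx⟩ ⟨G, hG, hy⟩
    exact ⟨F ⊔ G, hF.sup hG, add_mem (Submodule.mem_sup_left hx) (Submodule.mem_sup_right hy)⟩
  · rintro r x _ ⟨F, hF, hx⟩
    exact ⟨F, hF, hF.mul_le_left (Submodule.mul_mem_mul trivial hx)⟩

/-- Finite generation is essential: a finite sum of nilpotent ideals is nilpotent, whereas the whole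
odd ideal need not be. -/
theorem exists_isNilpotentIdeal_le (hchar : (2 : k) ≠ 0) {F : Submodule k A} (hF : F.FG)
    (hFI : ∀ y ∈ F, y ∈ A.oddIdeal) : ∃ G : Submodule k A, A.IsNilpotentIdeal G ∧ F ≤ G := by
  induction F, hF using Submodule.fg_induction with
  | singleton x =>
    obtain ⟨G, hG, hx⟩ := exists_isNilpotentIdeal_mem hchar
      (hFI x (Submodule.mem_span_singleton_self x))
    exact ⟨G, hG, (Submodule.span_singleton_le_iff_mem _ _).2 hx⟩
  | sup M₁ _ M₂ _ h₁ h₂ =>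
    obtain ⟨G₁, hG₁, h₁⟩ := h₁ fun y hy => hFI y (Submodule.mem_sup_left hy)
    obtain ⟨G₂, hG₂, h₂⟩ := h₂ fun y hy => hFI y (Submodule.mem_sup_right hy)
    exact ⟨G₁ ⊔ G₂, hG₁.sup hG₂, sup_le_sup h₁ h₂⟩

end SuperAlg

end Nilpotence

/-! ### Local nilpotence for convolution. -/

section LocalNilpotence

variable {k : Type u} [Field k] {X : Type w} [AddCommGroup X] [Module k X]

/-- The right contraction `φ ↦ (id ⊗ φ)(t)`. -/
def contractRight (t : X ⊗[k] X) : (X →ₗ[k] k) →ₗ[k] X where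
  toFun φ := TensorProduct.rid k X (φ.lTensor X t)
  map_add' φ ψ := by rw [LinearMap.lTensor_add, LinearMap.add_apply, map_add]
  map_smul' c φ := by rw [LinearMap.lTensor_smul, LinearMap.smul_apply, map_smul]; rfl

theorem contractRight_add (s t : X ⊗[k] X) (φ : X →ₗ[k] k) :
    contractRight (s + t) φ = contractRight s φ + contractRight t φ := by
  simp [contractRight]

theorem contractRight_range_fg (t : X ⊗[k] X) : (LinearMap.range (contractRight t)).FG := by
  obtain ⟨s, hs⟩ := TensorProduct.exists_finset t
  classical
  refine Submodule.FG.of_le (T := Submodule.span k ((s.image Prod.fst : Finset X) : Set X))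
    ⟨_, rfl⟩ ?_
  rintro _ ⟨φ, rfl⟩
  rw [hs]
  simp only [contractRight, LinearMap.coe_mk, AddHom.coe_mk, map_sum, LinearMap.lTensor_tmul,
    TensorProduct.rid_tmul]
  refine Submodule.sum_mem _ fun i hi => Submodule.smul_mem _ _ (Submodule.subset_span ?_)
  exact Finset.mem_coe.2 (Finset.mem_image_of_mem _ hi)

variable [Coalgebra k X]

/-- By coassociativity, contracting with φ and then with ψ is the same as contracting once with ψ *
φ. Hence the contractions of Δ(x) form a right coideal. -/
theorem contractRight_comul_mem (x : X) (φ ψ : X →ₗ[k] k) :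
    contractRight (Coalgebra.comul (R := k) (contractRight (Coalgebra.comul (R := k) x) φ)) ψ ∈
      LinearMap.range (contractRight (Coalgebra.comul (R := k) x)) := by
  refine ⟨(toConv ψ * toConv φ).ofConv, ?_⟩
  let G : X ⊗[k] (X ⊗[k] X) →ₗ[k] X := (TensorProduct.rid k X).toLinearMap ∘ₗ
    (LinearMap.mul' k k ∘ₗ TensorProduct.map ψ φ).lTensor X
  have h₁ : ∀ t : X ⊗[k] X, contractRight t (toConv ψ * toConv φ).ofConv =
      G ((Coalgebra.comul (R := k)).lTensor X t) := by
    intro t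
    induction t using TensorProduct.induction_on with
    | zero => simp [contractRight]
    | add x y hx hy => simp only [map_add, contractRight_add, hx, hy]
    | tmul x y => rfl
  have h₂ : ∀ t : X ⊗[k] X,
      contractRight (Coalgebra.comul (R := k) (contractRight t φ)) ψ =
        G (TensorProduct.assoc k X X X ((Coalgebra.comul (R := k)).rTensor X t)) := by
    intro t
    induction t using TensorProduct.induction_on with
    | zero => simp [contractRight]
    | add x y hx hy => simp only [map_add, contractRight_add, hx, hy]
    | tmul x y =>
      have h : contractRight (x ⊗ₜ[k] y) φ = φ y • x := by simp [contractRight]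
      rw [h, map_smul, LinearMap.rTensor_tmul]
      generalize (Coalgebra.comul (R := k) x) = s
      induction s using TensorProduct.induction_on with
      | zero => simp [contractRight]
      | add x y hx hy =>
        simp only [map_add, contractRight_add, TensorProduct.add_tmul, smul_add, hx, hy]
      | tmul x y => simp [contractRight, G, smul_smul, mul_comm]
  rw [h₁, h₂, Coalgebra.coassoc_apply]

/-- `E` consists of all contractions of Δ(x), and ε shows that it contains x. Expand Δ(e) in a basis
of the second factor: the coefficients are contractions of Δ(e), hence lie in `E`. The basis vectors
needed for finitely many generators of `E` span `W`. -/
theorem exists_finite_right_coideal (x : X) : ∃ E W : Submodule k X, x ∈ E ∧ E.FG ∧ W.FG ∧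
    ∀ e ∈ E, ∃ (ι : Type w) (s : Finset ι) (a b : ι → X), (∀ i ∈ s, a i ∈ E) ∧
      (∀ i ∈ s, b i ∈ W) ∧ Coalgebra.comul (R := k) e = ∑ i ∈ s, a i ⊗ₜ[k] b i := by
  classical
  let E := LinearMap.range (contractRight (Coalgebra.comul (R := k) x))
  have hE : E.FG := contractRight_range_fg _
  let β := Module.Basis.ofVectorSpace k X
  let c : X →ₗ[k] (Module.Basis.ofVectorSpaceIndex k X →₀ X) :=
    (TensorProduct.equivFinsuppOfBasisRight β).toLinearMap ∘ₗ Coalgebra.comul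
  have hc : ∀ e i, c e i = contractRight (Coalgebra.comul (R := k) e) (β.coord i) := by
    intro e i
    simp only [c, LinearMap.comp_apply]
    generalize (Coalgebra.comul (R := k) e) = s
    induction s using TensorProduct.induction_on with
    | zero => simp [contractRight]
    | add x y hx hy => simp only [map_add, contractRight_add, Finsupp.add_apply, hx, hy]
    | tmul x y => simp [contractRight]
  have hsum : ∀ e, Coalgebra.comul (R := k) e = ∑ i ∈ (c e).support, c e i ⊗ₜ[k] β i := by
    intro e
    have h := (TensorProduct.equivFinsuppOfBasisRight β).symm_apply_apply
      (Coalgebra.comul (R := k) e)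
    rw [TensorProduct.equivFinsuppOfBasisRight_symm_apply] at h
    exact h.symm
  obtain ⟨g, hg⟩ := hE
  let S : Finset (Module.Basis.ofVectorSpaceIndex k X) := g.biUnion fun e => (c e).support
  have hS : ∀ e ∈ E, (c e).support ⊆ S := by
    have hle : E ≤ (Finsupp.supported X k (S : Set _)).comap c := by
      rw [← hg]
      refine Submodule.span_le.2 fun e he => ?_
      refine (Finsupp.mem_supported k _).2 ?_
      exact Finset.coe_subset.2 (Finset.subset_biUnion_of_mem (fun e => (c e).support) he)
    exact fun e he => Finset.coe_subset.1 ((Finsupp.mem_supported k _).1 (hle he))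
  refine ⟨E, Submodule.span k ((S.image β : Finset X) : Set X), ⟨Coalgebra.counit, ?_⟩,
    contractRight_range_fg _, ⟨_, rfl⟩, ?_⟩
  · change TensorProduct.rid k X ((Coalgebra.counit (R := k)).lTensor X _) = x
    rw [Coalgebra.lTensor_counit_comul]
    simp
  · intro e he
    refine ⟨_, (c e).support, fun i => c e i, β, ?_, ?_, hsum e⟩
    · intro i _
      change c e i ∈ E
      rw [hc]
      obtain ⟨φ, rfl⟩ := he
      exact contractRight_comul_mem x φ _
    · intro i hi
      exact Submodule.subset_span (Finset.mem_coe.2 (Finset.mem_image_of_mem _ (hS e he hi)))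

theorem conv_apply_eq_sum {T : Type*} [Ring T] [Algebra k T] (f g : WithConv (X →ₗ[k] T)) {x : X}
    {ι : Type*} {s : Finset ι} {a b : ι → X}
    (h : Coalgebra.comul (R := k) x = ∑ i ∈ s, a i ⊗ₜ[k] b i) :
    (f * g) x = ∑ i ∈ s, f (a i) * g (b i) := by
  simp [LinearMap.convMul_apply, h]

/-- Linear maps from a coalgebra to the ideal generated by the odd elements of a super-commutative
super-algebra are locally nilpotent with respect to convolution. -/
theorem exists_pow_mul_apply_eq_zero {A : SuperAlg.{u, v} k} (hchar : (2 : k) ≠ 0)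
    (n : WithConv (X →ₗ[k] A)) (hn : ∀ x, n x ∈ A.oddIdeal) (x : X) :
    ∃ N : ℕ, ∀ c : WithConv (X →ₗ[k] A), (n ^ N * c) x = 0 := by
  obtain ⟨E, W, hxE, -, hW, hEW⟩ := exists_finite_right_coideal (k := k) x
  obtain ⟨G, hG, hle⟩ := SuperAlg.exists_isNilpotentIdeal_le hchar (F := W.map n.ofConv)
    (hW.map _) (by rintro _ ⟨w, -, rfl⟩; exact hn w)
  -- Since Δ(E) ⊆ E ⊗ W, each further convolution factor `n` is evaluated on `W` and contributes one
  -- factor in `G`.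
  have hpow : ∀ j, ∀ e ∈ E, (n ^ (j + 1)) e ∈ G ^ (j + 1) := by
    intro j
    induction j with
    | zero =>
      intro e he
      obtain ⟨ι, s, a, b, ha, hb, hab⟩ := hEW e he
      -- Writing `n` as `1 * n` moves its argument from `E` to `W`, where its values are known to
      -- lie in `G`.
      rw [zero_add, pow_one, pow_one, ← one_mul n, conv_apply_eq_sum _ _ hab]
      refine Submodule.sum_mem _ fun i hi => hG.mul_le_left (Submodule.mul_mem_mul trivial ?_)
      exact hle ⟨_, hb i hi, rfl⟩
    | succ j ih =>
      intro e he
      obtain ⟨ι, s, a, b, ha, hb, hab⟩ := hEW e he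
      rw [pow_succ n, pow_succ G (j + 1), conv_apply_eq_sum _ _ hab]
      exact Submodule.sum_mem _ fun i hi => Submodule.mul_mem_mul (ih _ (ha i hi))
        (hle ⟨_, hb i hi, rfl⟩)
  obtain ⟨N, hN⟩ := hG.nilpotent
  refine ⟨N + 1, fun c => ?_⟩
  obtain ⟨ι, s, a, b, ha, hb, hab⟩ := hEW x hxE
  rw [conv_apply_eq_sum _ _ hab]
  refine Finset.sum_eq_zero fun i hi => ?_
  have h := hpow N _ (ha i hi)
  rw [pow_succ, hN, zero_mul] at h
  rw [(Submodule.mem_bot k).1 h, zero_mul]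

end LocalNilpotence

/-! ### Square roots of T modulo powers of T - 1. -/

section SquareRoot

variable {k : Type u} [Field k]

theorem exists_polynomial_sqrt (hchar : (2 : k) ≠ 0) (N : ℕ) : ∃ P G Q : Polynomial k,
    P ^ 2 = 1 + Polynomial.X + Polynomial.X ^ (N + 1) * G ∧ P = 1 + Polynomial.X * Q := by
  induction N with
  | zero => exact ⟨1, -1, 0, by ring, by ring⟩
  | succ N ih =>
    obtain ⟨P, G, Q, h₁, h₂⟩ := ih
    -- Hensel step: subtracting cX^{N+1} from P changes P² by -2cX^{N+1} up to higher order, because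
    -- P ≡ 1 modulo X. The choice 2c = G(0) cancels the leading error.
    let c : Polynomial k := Polynomial.C (G.coeff 0 / 2)
    have hG : G = G.divX * Polynomial.X + 2 * c := by
      have h2 : (2 : Polynomial k) * c = Polynomial.C (G.coeff 0) := by
        rw [← Polynomial.C_ofNat, ← Polynomial.C_mul, mul_div_cancel₀ _ hchar]
      rw [h2, Polynomial.divX_mul_X_add]
    refine ⟨P - c * Polynomial.X ^ (N + 1), G.divX - 2 * c * Q + c ^ 2 * Polynomial.X ^ N,
      Q - c * Polynomial.X ^ N, ?_, ?_⟩
    · calc (P - c * Polynomial.X ^ (N + 1)) ^ 2 =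
            P ^ 2 - 2 * c * Polynomial.X ^ (N + 1) * P + c ^ 2 * Polynomial.X ^ (2 * (N + 1)) := by
              ring
        _ = _ := by
              rw [h₁, h₂]
              conv_lhs => rw [hG]
              ring
    · rw [h₂]; ring

/-- Uniqueness of square roots near 1: modulo `J`, the element a + b is 2 plus a nilpotent, hence a
unit, and (a + b)(a - b) = 0. -/
theorem sub_mem_of_sq_sub_sq_mem (hchar : (2 : k) ≠ 0) {R : Type v} [CommRing R] [Algebra k R]
    {J : Ideal R} {a b : R} (h : a ^ 2 - b ^ 2 ∈ J) (ha : a - 1 ∈ J.radical)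
    (hb : b - 1 ∈ J.radical) : a - b ∈ J := by
  have hn : IsNilpotent (Ideal.Quotient.mk J (a - 1 + (b - 1))) := by
    obtain ⟨m, hm⟩ := Ideal.add_mem _ ha hb
    exact ⟨m, by rw [← map_pow, Ideal.Quotient.eq_zero_iff_mem]; exact hm⟩
  have h2 : IsUnit (Ideal.Quotient.mk J (algebraMap k R 2)) :=
    ((IsUnit.mk0 (2 : k) hchar).map (algebraMap k R)).map _
  have hu := hn.isUnit_add_left_of_commute h2 (Commute.all _ _)
  rw [← Ideal.Quotient.eq_zero_iff_mem] at h ⊢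
  rw [← map_add, map_ofNat, show (2 : R) + (a - 1 + (b - 1)) = a + b by ring] at hu
  rw [show a ^ 2 - b ^ 2 = (a + b) * (a - b) by ring, map_mul] at h
  exact (hu.mul_right_eq_zero).1 h

/-- `P` is a square root of `T` modulo `(T - 1)^N`, with value `1` at `T = 1`. -/
structure IsSqrt (N : ℕ) (P : k[T;T⁻¹]) : Prop where
  sq : P ^ 2 - T 1 ∈ Ideal.span {(T 1 - 1 : k[T;T⁻¹]) ^ N}
  sub_one : P - 1 ∈ Ideal.span {(T 1 - 1 : k[T;T⁻¹])}

theorem exists_isSqrt (hchar : (2 : k) ≠ 0) (N : ℕ) : ∃ P : k[T;T⁻¹], IsSqrt N P := by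
  obtain ⟨P, G, Q, h₁, h₂⟩ := exists_polynomial_sqrt hchar N
  let F : Polynomial k →ₐ[k] k[T;T⁻¹] := Polynomial.aeval (T 1 - 1)
  have hF : F Polynomial.X = T 1 - 1 := Polynomial.aeval_X _
  refine ⟨F P, ?_, ?_⟩
  · refine Ideal.mem_span_singleton'.2 ⟨(T 1 - 1) * F G, ?_⟩
    rw [← map_pow, h₁]
    simp only [map_add, map_mul, map_pow, map_one, hF]
    ring
  · refine Ideal.mem_span_singleton'.2 ⟨F Q, ?_⟩
    rw [h₂]
    simp only [map_add, map_mul, map_one, hF]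
    ring

theorem IsSqrt.mono {N M : ℕ} (hNM : N ≤ M) {P : k[T;T⁻¹]} (hP : IsSqrt M P) : IsSqrt N P where
  sq := Ideal.span_singleton_le_span_singleton.2 (pow_dvd_pow _ hNM) hP.sq
  sub_one := hP.sub_one

theorem mem_radical_span_pow {N : ℕ} {P : k[T;T⁻¹]}
    (h : P ∈ Ideal.span {(T 1 - 1 : k[T;T⁻¹])}) :
    P ∈ (Ideal.span {(T 1 - 1 : k[T;T⁻¹]) ^ N}).radical := by
  obtain ⟨q, rfl⟩ := Ideal.mem_span_singleton'.1 h
  exact Ideal.mul_mem_left _ _ ⟨N, Ideal.mem_span_singleton_self _⟩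

theorem IsSqrt.sub_mem_span (hchar : (2 : k) ≠ 0) {N : ℕ} {P Q : k[T;T⁻¹]} (hP : IsSqrt N P)
    (hQ : IsSqrt N Q) : P - Q ∈ Ideal.span {(T 1 - 1 : k[T;T⁻¹]) ^ N} := by
  refine sub_mem_of_sq_sub_sq_mem hchar ?_ (mem_radical_span_pow hP.sub_one)
    (mem_radical_span_pow hQ.sub_one)
  have h := sub_mem hP.sq hQ.sq
  rwa [sub_sub_sub_cancel_right] at h

/-- T·P(T⁻¹) squares to approximately T²·T⁻¹ = T, and T⁻¹ - 1 is a unit multiple of T - 1, so the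
precision is unchanged. This symmetry makes the geometric mean invariant under parity. -/
theorem IsSqrt.invert {N : ℕ} {P : k[T;T⁻¹]} (hP : IsSqrt N P) :
    IsSqrt N (T 1 * LaurentPolynomial.invert P) := by
  have hT : (T 1 : k[T;T⁻¹]) * T (-1) = 1 := by rw [← T_add]; simp
  have hi : LaurentPolynomial.invert (T 1 - 1 : k[T;T⁻¹]) = -T (-1) * (T 1 - 1) := by
    rw [map_sub, map_one, invert_T]
    linear_combination hT
  constructor
  · obtain ⟨q, hq⟩ := Ideal.mem_span_singleton'.1 hP.sq
    have h := congrArg LaurentPolynomial.invert hq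
    rw [map_mul, map_pow, hi, map_sub, map_pow, invert_T] at h
    refine Ideal.mem_span_singleton'.2
      ⟨T 1 ^ 2 * LaurentPolynomial.invert q * (-T (-1)) ^ N, ?_⟩
    rw [mul_pow] at h
    linear_combination (T 1 : k[T;T⁻¹]) ^ 2 * h - T 1 * hT
  · obtain ⟨q, hq⟩ := Ideal.mem_span_singleton'.1 hP.sub_one
    have h := congrArg LaurentPolynomial.invert hq
    rw [map_mul, hi, map_sub, map_one] at h
    refine Ideal.mem_span_singleton'.2
      ⟨T 1 * LaurentPolynomial.invert q * (-T (-1)) + 1, ?_⟩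
    linear_combination (T 1 : k[T;T⁻¹]) * h

/-- The diagonal `T ↦ T ⊗ T`. -/
def laurentDiag (k : Type u) [Field k] : k[T;T⁻¹] →ₐ[k] k[T;T⁻¹] ⊗[k] k[T;T⁻¹] :=
  AddMonoidAlgebra.lift k _ ℤ
    { toFun := fun j => T j.toAdd ⊗ₜ[k] T j.toAdd
      map_one' := rfl
      map_mul' := fun i j => by
        rw [Algebra.TensorProduct.tmul_mul_tmul, toAdd_mul, T_add] }

theorem laurentDiag_T (j : ℤ) : laurentDiag k (T j) = T j ⊗ₜ[k] T j := by
  exact (AddMonoidAlgebra.lift_single _ _ _).trans (one_smul k _)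

open Algebra.TensorProduct in
-- Modulo the ideal, P(T ⊗ T) and P ⊗ P are both square roots of T ⊗ T that differ from 1 by a
-- nilpotent, so they agree by uniqueness. Applied to w, this yields multiplicativity of the mean.
theorem IsSqrt.diag_sub_mem_span (hchar : (2 : k) ≠ 0) {N : ℕ} {P : k[T;T⁻¹]} (hP : IsSqrt (2 * N) P) :
    laurentDiag k P - P ⊗ₜ[k] P ∈ Ideal.span
      {((T 1 - 1 : k[T;T⁻¹]) ^ N) ⊗ₜ[k] (1 : k[T;T⁻¹]),
        (1 : k[T;T⁻¹]) ⊗ₜ[k] ((T 1 - 1 : k[T;T⁻¹]) ^ N)} := by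
  set z : k[T;T⁻¹] := T 1 - 1 with hz
  set J := Ideal.span {(z ^ N) ⊗ₜ[k] (1 : k[T;T⁻¹]), (1 : k[T;T⁻¹]) ⊗ₜ[k] (z ^ N)} with hJ
  let iL : k[T;T⁻¹] →ₐ[k] k[T;T⁻¹] ⊗[k] k[T;T⁻¹] := includeLeft
  let iR : k[T;T⁻¹] →ₐ[k] k[T;T⁻¹] ⊗[k] k[T;T⁻¹] := includeRight
  have hLR : ∀ a b : k[T;T⁻¹], a ⊗ₜ[k] b = iL a * iR b := fun a b => by
    simp [iL, iR]
  have hL : iL z ^ N ∈ J := by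
    rw [← map_pow]
    exact Ideal.subset_span (Or.inl rfl)
  have hR : iR z ^ N ∈ J := by
    rw [← map_pow]
    exact Ideal.subset_span (Or.inr rfl)
  have hδT : laurentDiag k (T 1) = iL (T 1) * iR (T 1) := by rw [laurentDiag_T, hLR]
  have hδz : laurentDiag k z = iL z + iR z * iL (T 1) := by
    rw [hz, map_sub, hδT, map_one, map_sub, map_sub, map_one, map_one]
    ring
  -- T ⊗ T - 1 = z ⊗ 1 + T ⊗ z, and in its power of exponent 2N every term has one of the two
  -- summands to a power at least N. This is the reason for the precision 2N.
  have hδ : laurentDiag k z ^ (2 * N) ∈ J := by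
    rw [hδz]
    refine Ideal.add_pow_mem_of_pow_mem_of_le (m := N) (n := N) J hL ?_ (by omega)
    rw [mul_pow]
    exact Ideal.mul_mem_right _ _ hR
  obtain ⟨q, hq⟩ := Ideal.mem_span_singleton'.1 hP.sq
  obtain ⟨r, hr⟩ := Ideal.mem_span_singleton'.1 hP.sub_one
  rw [← hz] at hq hr
  rw [hLR]
  refine sub_mem_of_sq_sub_sq_mem hchar ?_ ?_ ?_
  · have h₁ : laurentDiag k P ^ 2 =
        laurentDiag k q * laurentDiag k z ^ (2 * N) + iL (T 1) * iR (T 1) := by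
      rw [← map_pow, ← map_pow, ← map_mul, hq, map_sub, hδT]
      ring
    have h₂ : iL P ^ 2 = iL q * (iL z ^ N * iL z ^ N) + iL (T 1) := by
      rw [← pow_add, ← two_mul, ← map_pow, ← map_pow, ← map_mul, hq, map_sub]
      ring
    have h₃ : iR P ^ 2 = iR q * (iR z ^ N * iR z ^ N) + iR (T 1) := by
      rw [← pow_add, ← two_mul, ← map_pow, ← map_pow, ← map_mul, hq, map_sub]
      ring
    rw [h₁, mul_pow, h₂, h₃, show laurentDiag k q * laurentDiag k z ^ (2 * N) +
      iL (T 1) * iR (T 1) - (iL q * (iL z ^ N * iL z ^ N) + iL (T 1)) *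
      (iR q * (iR z ^ N * iR z ^ N) + iR (T 1)) =
      laurentDiag k q * laurentDiag k z ^ (2 * N) -
      ((iL q * iL z ^ N * (iR q * (iR z ^ N * iR z ^ N) + iR (T 1))) * iL z ^ N +
        (iL (T 1) * iR q * iR z ^ N) * iR z ^ N) by ring]
    exact sub_mem (Ideal.mul_mem_left _ _ hδ)
      (add_mem (Ideal.mul_mem_left _ _ hL) (Ideal.mul_mem_left _ _ hR))
  · rw [← map_one (laurentDiag k), ← map_sub, ← hr, map_mul]
    exact Ideal.mul_mem_left _ _ ⟨2 * N, hδ⟩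
  · have hP' : P = r * z + 1 := by rw [hr]; ring
    rw [hP', map_add, map_add, map_mul, map_mul, map_one, map_one,
      show (iL r * iL z + 1) * (iR r * iR z + 1) - 1 =
        (iL r * (iR r * iR z + 1)) * iL z + iR r * iR z by ring]
    exact add_mem (Ideal.mul_mem_left _ _ ⟨N, hL⟩) (Ideal.mul_mem_left _ _ ⟨N, hR⟩)

end SquareRoot

/-! ### The parity automorphism. -/

section Parity

variable {k : Type u} [Field k] (H : HopfSuperAlg.{u, v} k)

namespace HopfSuperAlg

theorem proj_of_mem {i : ZMod 2} {a : H} (ha : a ∈ H.gr i) : H.proj i a = a :=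
  DirectSum.decompose_of_mem_same H.gr ha

theorem proj_of_mem_ne {i j : ZMod 2} {a : H} (ha : a ∈ H.gr j) (hij : j ≠ i) : H.proj i a = 0 :=
  DirectSum.decompose_of_mem_ne H.gr ha hij

theorem proj_mem (i : ZMod 2) (a : H) : H.proj i a ∈ H.gr i :=
  SetLike.coe_mem (DirectSum.decompose H.gr a i)

/-- The parity automorphism, as a linear map. -/
def parityLin : H →ₗ[k] H := H.proj 0 - H.proj 1

theorem parityLin_even {a : H} (ha : a ∈ H.gr 0) : H.parityLin a = a := by
  rw [parityLin, LinearMap.sub_apply, H.proj_of_mem ha, H.proj_of_mem_ne ha (by decide), sub_zero]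

theorem parityLin_odd {a : H} (ha : a ∈ H.gr 1) : H.parityLin a = -a := by
  rw [parityLin, LinearMap.sub_apply, H.proj_of_mem ha, H.proj_of_mem_ne ha (by decide), zero_sub]

variable {H} in
theorem induction_homogeneous {M : H → Prop} (hadd : ∀ a b, M a → M b → M (a + b))
    (h : ∀ (i : ZMod 2) (a : H), a ∈ H.gr i → M a) (a : H) : M a := by
  rw [← H.proj_add_proj a]
  exact hadd _ _ (h 0 _ (H.proj_mem 0 a)) (h 1 _ (H.proj_mem 1 a))

/-- The parity automorphism `a ↦ (-1)^{|a|} a`. -/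
def parity : H →ₐ[k] H :=
  AlgHom.ofLinearMap H.parityLin (H.parityLin_even SetLike.GradedOne.one_mem) (by
    intro x y
    induction x using induction_homogeneous with
    | hadd x x' hx hx' => simp only [add_mul, map_add, hx, hx']
    | h i x hx =>
      induction y using induction_homogeneous with
      | hadd y y' hy hy' => simp only [mul_add, map_add, hy, hy']
      | h j y hy =>
        have hxy := SetLike.mul_mem_graded hx hy
        rcases zmod_two i with rfl | rfl <;> rcases zmod_two j with rfl | rfl
        · rw [H.parityLin_even hx, H.parityLin_even hy, H.parityLin_even hxy]
        · rw [H.parityLin_even hx, H.parityLin_odd hy, H.parityLin_odd hxy, mul_neg]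
        · rw [H.parityLin_odd hx, H.parityLin_even hy, H.parityLin_odd hxy, neg_mul]
        · rw [H.parityLin_odd hx, H.parityLin_odd hy, H.parityLin_even hxy, neg_mul_neg])

theorem parity_of_even {a : H} (ha : a ∈ H.gr 0) : H.parity a = a := H.parityLin_even ha

theorem parity_of_odd {a : H} (ha : a ∈ H.gr 1) : H.parity a = -a := H.parityLin_odd ha

theorem parity_even : IsEven H.gr H.gr H.parity := by
  intro i a ha
  rcases zmod_two i with rfl | rfl
  · rwa [H.parity_of_even ha]
  · rw [H.parity_of_odd ha]
    exact neg_mem ha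

theorem parity_parity (a : H) : H.parity (H.parity a) = a := by
  induction a using induction_homogeneous with
  | hadd x y hx hy => simp only [map_add, hx, hy]
  | h i a ha =>
    rcases zmod_two i with rfl | rfl
    · rw [H.parity_of_even ha, H.parity_of_even ha]
    · rw [H.parity_of_odd ha, map_neg, H.parity_of_odd ha, neg_neg]

theorem toBar_parity (a : H) : H.toBar (H.parity a) = H.toBar a := by
  induction a using induction_homogeneous with
  | hadd x y hx hy => simp only [map_add, hx, hy]
  | h i a ha =>
    rcases zmod_two i with rfl | rfl
    · rw [H.parity_of_even ha]
    · rw [H.parity_of_odd ha, map_neg, H.toBar_odd ha, neg_zero]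

/-- The map σ ⊗ σ acts by the sign of the total degree on `H ⊗ H`, and Δ preserves degrees. -/
theorem comul_parity (a : H) : Coalgebra.comul (R := k) (H.parity a) =
    TensorProduct.map H.parity.toLinearMap H.parity.toLinearMap (Coalgebra.comul (R := k) a) := by
  induction a using induction_homogeneous with
  | hadd x y hx hy => simp only [map_add, hx, hy]
  | h i a ha =>
    rcases zmod_two i with rfl | rfl
    · rw [H.parity_of_even ha]
      have hle : tensorGr H.gr H.gr 0 ≤ Submodule.comap (LinearMap.id -
          TensorProduct.map H.parity.toLinearMap H.parity.toLinearMap) ⊥ := by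
        refine tensorGr_le_iff.2 fun j l hjl x hx y hy => ?_
        rw [Submodule.mem_bot, LinearMap.sub_apply, sub_eq_zero]
        change x ⊗ₜ[k] y = H.parity x ⊗ₜ[k] H.parity y
        rcases zmod_two j with rfl | rfl <;> rcases zmod_two l with rfl | rfl
        · rw [H.parity_of_even hx, H.parity_of_even hy]
        · exact absurd hjl (by decide)
        · exact absurd hjl (by decide)
        · rw [H.parity_of_odd hx, H.parity_of_odd hy, TensorProduct.neg_tmul,
            TensorProduct.tmul_neg, neg_neg]
      exact sub_eq_zero.1 ((Submodule.mem_bot k).1 (hle (H.comul_even 0 a ha)))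
    · rw [H.parity_of_odd ha, map_neg]
      have hle : tensorGr H.gr H.gr 1 ≤ Submodule.comap (-LinearMap.id -
          TensorProduct.map H.parity.toLinearMap H.parity.toLinearMap) ⊥ := by
        refine tensorGr_le_iff.2 fun j l hjl x hx y hy => ?_
        rw [Submodule.mem_bot, LinearMap.sub_apply, sub_eq_zero]
        change -(x ⊗ₜ[k] y) = H.parity x ⊗ₜ[k] H.parity y
        rcases zmod_two j with rfl | rfl <;> rcases zmod_two l with rfl | rfl
        · exact absurd hjl (by decide)
        · rw [H.parity_of_even hx, H.parity_of_odd hy, TensorProduct.tmul_neg]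
        · rw [H.parity_of_odd hx, H.parity_of_even hy, TensorProduct.neg_tmul]
        · exact absurd hjl (by decide)
      exact sub_eq_zero.1 ((Submodule.mem_bot k).1 (hle (H.comul_even 1 a ha)))

end HopfSuperAlg

end Parity

/-! ### The geometric mean of the identity and the parity. -/

section ConvolutionPoints

variable {k : Type u} [Field k] (H : HopfSuperAlg.{u, v} k)

namespace HopfSuperAlg

/-- The identity of `H` as an element of the convolution algebra. -/
def idConv : WithConv (H →ₗ[k] H) := toConv LinearMap.id

/-- The parity automorphism as an element of the convolution algebra. -/
def parityConv : WithConv (H →ₗ[k] H) := toConv H.parity.toLinearMap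

/-- The antipode as an element of the convolution algebra. -/
def antiConv : WithConv (H →ₗ[k] H) := toConv H.antipode

/-- The composite of the antipode and the parity as an element of the convolution algebra. -/
def parityAntiConv : WithConv (H →ₗ[k] H) := toConv (H.parity.toLinearMap ∘ₗ H.antipode)

theorem antiConv_mul_idConv : H.antiConv * H.idConv = 1 := H.antipode_conv

theorem idConv_mul_antiConv : H.idConv * H.antiConv = 1 := H.conv_antipode

theorem parityAntiConv_mul_parityConv : H.parityAntiConv * H.parityConv = 1 := by
  have h := congrArg (convMap H H.parity) H.antiConv_mul_idConv
  rw [map_mul, map_one] at h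
  exact h

theorem parityConv_mul_parityAntiConv : H.parityConv * H.parityAntiConv = 1 := by
  have h := congrArg (convMap H H.parity) H.idConv_mul_antiConv
  rw [map_mul, map_one] at h
  exact h

/-- The map `h ↦ (-1)^{|h₍₁₎|} h₍₁₎ S(h₍₂₎)`. -/
def twist : (WithConv (H →ₗ[k] H))ˣ where
  val := H.parityConv * H.antiConv
  inv := H.idConv * H.parityAntiConv
  val_inv := by
    rw [mul_assoc, ← mul_assoc H.antiConv, antiConv_mul_idConv, one_mul,
      parityConv_mul_parityAntiConv]
  inv_val := by
    rw [mul_assoc, ← mul_assoc H.parityAntiConv, parityAntiConv_mul_parityConv, one_mul,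
      idConv_mul_antiConv]

theorem twist_mul_idConv : (H.twist : WithConv (H →ₗ[k] H)) * H.idConv = H.parityConv := by
  change H.parityConv * H.antiConv * H.idConv = _
  rw [mul_assoc, antiConv_mul_idConv, mul_one]

/-- Parity is an involution, so it exchanges g and σ(g) and sends σ(g) g⁻¹ to g σ(g)⁻¹. -/
theorem convMap_parity_twist : convMap H H.parity (H.twist : WithConv (H →ₗ[k] H)) =
    ((H.twist⁻¹ : (WithConv (H →ₗ[k] H))ˣ) : WithConv (H →ₗ[k] H)) := by
  change convMap H H.parity (H.parityConv * H.antiConv) = H.idConv * H.parityAntiConv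
  rw [map_mul]
  congr 1
  exact WithConv.ext (LinearMap.ext fun a => H.parity_parity a)

/-- Modulo the odd ideal parity is the identity, so σ(g) and g have the same reduction. -/
theorem convMap_toBar_twist : convMap H H.toBar (H.twist : WithConv (H →ₗ[k] H)) = 1 := by
  change convMap H H.toBar (H.parityConv * H.antiConv) = 1
  have h : convMap H H.toBar H.parityConv = convMap H H.toBar H.idConv :=
    WithConv.ext (LinearMap.ext fun a => H.toBar_parity a)
  rw [map_mul, h, ← map_mul, idConv_mul_antiConv, map_one]

/-- The elements of the convolution algebra which are even algebra morphisms. -/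
def IsPoint (f : WithConv (H →ₗ[k] H)) : Prop :=
  ∃ φ : H →ₐ[k] H, IsEven H.gr H.gr φ ∧ f = toConv φ.toLinearMap

variable {H}

theorem IsPoint.mul {f g : WithConv (H →ₗ[k] H)} (hf : H.IsPoint f) (hg : H.IsPoint g) :
    H.IsPoint (f * g) := by
  obtain ⟨φ, hφ, rfl⟩ := hf
  obtain ⟨ψ, hψ, rfl⟩ := hg
  exact ⟨coactMulAlg H.comulAlg φ hφ ψ hψ, coactMulAlg_even H.comul_even φ hφ ψ hψ, rfl⟩

theorem isPoint_one : H.IsPoint 1 := by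
  refine ⟨(Algebra.ofId k H).comp H.counitAlg, ?_, rfl⟩
  intro i a ha
  rcases zmod_two i with rfl | rfl
  · exact SetLike.algebraMap_mem_graded H.gr _
  · have h : H.counitAlg a = 0 := H.counit_odd a ha
    rw [AlgHom.comp_apply, h, map_zero]
    exact zero_mem _

theorem isPoint_idConv : H.IsPoint H.idConv := ⟨AlgHom.id k H, isEven_id H.toSuperAlg, rfl⟩

theorem isPoint_twist_zpow (j : ℤ) : H.IsPoint ((H.twist ^ j : (WithConv (H →ₗ[k] H))ˣ) :
    WithConv (H →ₗ[k] H)) := by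
  have hS : H.IsPoint H.antiConv := ⟨H.antipodeAlg, H.antipode_even, rfl⟩
  have hσ : H.IsPoint H.parityConv := ⟨H.parity, H.parity_even, rfl⟩
  have hσS : H.IsPoint H.parityAntiConv :=
    ⟨H.parity.comp H.antipodeAlg, fun i a ha => H.parity_even i _ (H.antipode_even i a ha), rfl⟩
  have hpow : ∀ (w : (WithConv (H →ₗ[k] H))ˣ), H.IsPoint (w : WithConv (H →ₗ[k] H)) →
      ∀ n : ℕ, H.IsPoint ((w ^ n : (WithConv (H →ₗ[k] H))ˣ) : WithConv (H →ₗ[k] H)) := by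
    intro w hw n
    induction n with
    | zero => exact isPoint_one
    | succ n ih =>
      rw [pow_succ, Units.val_mul]
      exact ih.mul hw
  cases j with
  | ofNat n =>
    rw [Int.ofNat_eq_natCast, zpow_natCast]
    exact hpow _ (hσ.mul hS) n
  | negSucc n =>
    rw [zpow_negSucc, ← inv_pow]
    exact hpow _ (isPoint_idConv.mul hσS) _

variable (H)

/-- The evaluation of Laurent polynomials at `twist`. -/
def twistEval : k[T;T⁻¹] →ₐ[k] WithConv (H →ₗ[k] H) :=
  AddMonoidAlgebra.lift k _ ℤ ((Units.coeHom _).comp (zpowersHom _ H.twist))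

theorem twistEval_T (j : ℤ) : H.twistEval (T j) =
    ((H.twist ^ j : (WithConv (H →ₗ[k] H))ˣ) : WithConv (H →ₗ[k] H)) :=
  (AddMonoidAlgebra.lift_single _ _ _).trans (one_smul k _)

/-- The linear map `T^j ↦ twist^j * id`. -/
def powMap : k[T;T⁻¹] →ₗ[k] (H →ₗ[k] H) :=
  (WithConv.linearEquiv k (H →ₗ[k] H)).toLinearMap ∘ₗ LinearMap.mulRight k H.idConv ∘ₗ
    H.twistEval.toLinearMap

theorem toConv_powMap (P : k[T;T⁻¹]) : toConv (H.powMap P) = H.twistEval P * H.idConv := rfl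

theorem exists_algHom_powMap_T (j : ℤ) : ∃ φ : H →ₐ[k] H, IsEven H.gr H.gr φ ∧
    H.powMap (T j) = φ.toLinearMap := by
  obtain ⟨φ, hφ, h⟩ := (H.isPoint_twist_zpow j).mul isPoint_idConv
  refine ⟨φ, hφ, ?_⟩
  rw [← H.twistEval_T] at h
  exact congrArg WithConv.ofConv h

theorem laurent_ext {M : Type*} [AddCommGroup M] [Module k M] {F G : k[T;T⁻¹] →ₗ[k] M}
    (h : ∀ j, F (T j) = G (T j)) : F = G := by
  refine LinearMap.ext fun P => ?_
  induction P using LaurentPolynomial.induction_on' with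
  | add p q hp hq => rw [map_add, map_add, hp, hq]
  | C_mul_T n a => rw [← smul_eq_C_mul, map_smul, map_smul, h]

theorem powMap_even (P : k[T;T⁻¹]) : IsEven H.gr H.gr (H.powMap P) := by
  intro i a ha
  induction P using LaurentPolynomial.induction_on' with
  | add p q hp hq =>
    rw [map_add]
    exact add_mem hp hq
  | C_mul_T n c =>
    rw [← smul_eq_C_mul, map_smul]
    obtain ⟨φ, hφ, h⟩ := H.exists_algHom_powMap_T n
    rw [h]
    exact Submodule.smul_mem _ _ (hφ i a ha)

/-- On monomials: σ(wʲg) = w⁻ʲσ(g) = w⁻ʲ·w g, which corresponds to T·T⁻ʲ. -/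
theorem parity_powMap (P : k[T;T⁻¹]) (x : H) :
    H.parity (H.powMap P x) = H.powMap (T 1 * LaurentPolynomial.invert P) x := by
  have h₁ : (convMap H H.parity).comp H.twistEval =
      H.twistEval.comp (LaurentPolynomial.invert (R := k)).toAlgHom := by
    refine AlgHom.toLinearMap_injective (laurent_ext fun j => ?_)
    change convMap H H.parity (H.twistEval (T j)) = H.twistEval (LaurentPolynomial.invert (T j))
    rw [twistEval_T, invert_T, twistEval_T, zpow_neg, ← inv_zpow]
    have h := map_zpow (Units.map (convMap H H.parity).toRingHom.toMonoidHom) H.twist j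
    have h' : Units.map (convMap H H.parity).toRingHom.toMonoidHom H.twist = H.twist⁻¹ :=
      Units.ext H.convMap_parity_twist
    rw [h'] at h
    exact congrArg Units.val h
  have h₂ : convMap H H.parity (toConv (H.powMap P)) =
      toConv (H.powMap (T 1 * LaurentPolynomial.invert P)) := by
    rw [toConv_powMap, toConv_powMap, map_mul, mul_comm (T 1), map_mul H.twistEval, twistEval_T,
      zpow_one, mul_assoc, twist_mul_idConv]
    exact congrArg (· * H.parityConv) (DFunLike.congr_fun h₁ P)
  exact LinearMap.congr_fun (congrArg WithConv.ofConv h₂) x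

theorem twist_sub_one_mem (x : H) :
    ((H.twist : WithConv (H →ₗ[k] H)) - 1) x ∈ H.oddIdeal := by
  rw [← H.quotMk_eq_zero H.oddIdeal H.oddIdeal_homogeneous]
  have h : convMap H H.toBar ((H.twist : WithConv (H →ₗ[k] H)) - 1) = 0 := by
    rw [map_sub, convMap_toBar_twist, map_one, sub_self]
  exact LinearMap.congr_fun (congrArg WithConv.ofConv h) x

theorem twistEval_T_sub_one : H.twistEval (T 1 - 1) =
    (H.twist : WithConv (H →ₗ[k] H)) - 1 := by
  rw [map_sub, twistEval_T, zpow_one, map_one]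

/-- All multiples of `(T - 1)^N` vanish at `x`. -/
def Kills (N : ℕ) (x : H) : Prop :=
  ∀ P ∈ Ideal.span {(T 1 - 1 : k[T;T⁻¹]) ^ N}, H.powMap P x = 0

variable {H} in
theorem Kills.mono {N M : ℕ} (hNM : N ≤ M) {x : H} (h : H.Kills N x) : H.Kills M x :=
  fun P hP => h P (Ideal.span_singleton_le_span_singleton.2 (pow_dvd_pow _ hNM) hP)

/-- w - 1 takes values in the odd ideal, so it is locally nilpotent for convolution. Evaluation at
`x` thus factors through Laurent polynomials modulo some (T - 1)^N. -/
theorem exists_kills (hchar : (2 : k) ≠ 0) (x : H) : ∃ N, H.Kills N x := by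
  obtain ⟨N, hN⟩ := exists_pow_mul_apply_eq_zero hchar _ H.twist_sub_one_mem x
  refine ⟨N, fun P hP => ?_⟩
  obtain ⟨Q, rfl⟩ := Ideal.mem_span_singleton'.1 hP
  rw [mul_comm]
  have h : toConv (H.powMap ((T 1 - 1) ^ N * Q)) =
      ((H.twist : WithConv (H →ₗ[k] H)) - 1) ^ N * (H.twistEval Q * H.idConv) := by
    rw [toConv_powMap, map_mul, map_pow, twistEval_T_sub_one, mul_assoc]
  exact (LinearMap.congr_fun (congrArg WithConv.ofConv h) x).trans (hN _)

theorem exists_kills_finset (hchar : (2 : k) ≠ 0) (s : Finset H) : ∃ N, ∀ x ∈ s, H.Kills N x := by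
  choose N hN using H.exists_kills hchar
  exact ⟨s.sup N, fun x hx => (hN x).mono (Finset.le_sup hx)⟩

theorem powMap_eq_of_isSqrt (hchar : (2 : k) ≠ 0) {N M : ℕ} {P Q : k[T;T⁻¹]} (hP : IsSqrt N P)
    (hQ : IsSqrt M Q) {x : H} (hN : H.Kills N x) (hM : H.Kills M x) :
    H.powMap P x = H.powMap Q x := by
  rw [← sub_eq_zero, ← LinearMap.sub_apply, ← map_sub]
  rcases le_total N M with h | h
  · exact hN _ (hP.sub_mem_span hchar (hQ.mono h))
  · exact hM _ ((hP.mono h).sub_mem_span hchar hQ)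

/-- The precision required of the root depends on `x`, so w^{1/2} * id is defined element by
element. Uniqueness of approximate roots makes the value independent of the precision and of the
polynomial. -/
theorem exists_meanMap (hchar : (2 : k) ≠ 0) : ∃ g : H → H, ∀ (N : ℕ) (P : k[T;T⁻¹]) (x : H),
    IsSqrt N P → H.Kills N x → g x = H.powMap P x := by
  choose N hN using H.exists_kills hchar
  choose P hP using exists_isSqrt hchar (k := k)
  exact ⟨fun x => H.powMap (P (N x)) x, fun M Q x hQ hM =>
    H.powMap_eq_of_isSqrt hchar (hP _) hQ (hN x) hM⟩

/-- The geometric mean `twist^{1/2} * id` of the identity and the parity automorphism. -/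
def meanFun (hchar : (2 : k) ≠ 0) : H → H := (H.exists_meanMap hchar).choose

theorem meanFun_eq (hchar : (2 : k) ≠ 0) {N : ℕ} {P : k[T;T⁻¹]} {x : H} (hP : IsSqrt N P)
    (hx : H.Kills N x) : H.meanFun hchar x = H.powMap P x :=
  (H.exists_meanMap hchar).choose_spec N P x hP hx

theorem exists_meanFun_eq (hchar : (2 : k) ≠ 0) (s : Finset H) :
    ∃ P : k[T;T⁻¹], P - 1 ∈ Ideal.span {(T 1 - 1 : k[T;T⁻¹])} ∧
      ∀ x ∈ s, H.meanFun hchar x = H.powMap P x := by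
  obtain ⟨N, hN⟩ := H.exists_kills_finset hchar s
  obtain ⟨P, hP⟩ := exists_isSqrt hchar (k := k) N
  exact ⟨P, hP.sub_one, fun x hx => H.meanFun_eq hchar hP (hN x hx)⟩

/-- The geometric mean of the identity and the parity automorphism as a linear map. -/
def meanLin (hchar : (2 : k) ≠ 0) : H →ₗ[k] H where
  toFun := H.meanFun hchar
  map_add' x y := by
    classical
    obtain ⟨P, -, hP⟩ := H.exists_meanFun_eq hchar {x, y, x + y}
    rw [hP x (by simp), hP y (by simp), hP (x + y) (by simp), map_add]
  map_smul' c x := by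
    classical
    obtain ⟨P, -, hP⟩ := H.exists_meanFun_eq hchar {x, c • x}
    rw [hP x (by simp), hP (c • x) (by simp), map_smul, RingHom.id_apply]

/-- Each wʲ * id is an algebra morphism, so P evaluated at `x * y` is P(T ⊗ T) evaluated at the pair
`x`, `y`. The difference between P(T ⊗ T) and P ⊗ P is invisible at that pair. -/
theorem powMap_mul {N : ℕ} (hchar : (2 : k) ≠ 0) {P : k[T;T⁻¹]} (hP : IsSqrt (2 * N) P) {x y : H}
    (hx : H.Kills N x) (hy : H.Kills N y) :
    H.powMap P (x * y) = H.powMap P x * H.powMap P y := by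
  let B : k[T;T⁻¹] ⊗[k] k[T;T⁻¹] →ₗ[k] H := LinearMap.mul' k H ∘ₗ
    TensorProduct.map (LinearMap.applyₗ x ∘ₗ H.powMap) (LinearMap.applyₗ y ∘ₗ H.powMap)
  have h₁ : LinearMap.applyₗ (x * y) ∘ₗ H.powMap = B ∘ₗ (laurentDiag k).toLinearMap := by
    refine laurent_ext fun j => ?_
    change H.powMap (T j) (x * y) = B (laurentDiag k (T j))
    obtain ⟨φ, -, hφ⟩ := H.exists_algHom_powMap_T j
    rw [laurentDiag_T]
    change _ = H.powMap (T j) x * H.powMap (T j) y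
    rw [hφ]
    exact map_mul φ x y
  have h₂ : ∀ t ∈ Ideal.span
      {((T 1 - 1 : k[T;T⁻¹]) ^ N) ⊗ₜ[k] (1 : k[T;T⁻¹]),
        (1 : k[T;T⁻¹]) ⊗ₜ[k] ((T 1 - 1 : k[T;T⁻¹]) ^ N)}, B t = 0 := by
    intro t ht
    obtain ⟨a, b, rfl⟩ := Ideal.mem_span_pair.1 ht
    clear ht
    rw [map_add]
    have ha : B (a * ((T 1 - 1 : k[T;T⁻¹]) ^ N) ⊗ₜ[k] (1 : k[T;T⁻¹])) = 0 := by
      induction a using TensorProduct.induction_on with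
      | zero => rw [zero_mul, map_zero]
      | add a b ha hb => rw [add_mul, map_add, ha, hb, add_zero]
      | tmul p q =>
        rw [Algebra.TensorProduct.tmul_mul_tmul]
        change H.powMap (p * (T 1 - 1) ^ N) x * H.powMap (q * 1) y = 0
        rw [hx _ (Ideal.mul_mem_left _ _ (Ideal.mem_span_singleton_self _)), zero_mul]
    have hb : B (b * (1 : k[T;T⁻¹]) ⊗ₜ[k] ((T 1 - 1 : k[T;T⁻¹]) ^ N)) = 0 := by
      induction b using TensorProduct.induction_on with
      | zero => rw [zero_mul, map_zero]
      | add a b ha hb => rw [add_mul, map_add, ha, hb, add_zero]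
      | tmul p q =>
        rw [Algebra.TensorProduct.tmul_mul_tmul]
        change H.powMap (p * 1) x * H.powMap (q * (T 1 - 1) ^ N) y = 0
        rw [hy _ (Ideal.mul_mem_left _ _ (Ideal.mem_span_singleton_self _)), mul_zero]
    rw [ha, hb, add_zero]
  have h₃ := h₂ _ (hP.diag_sub_mem_span hchar)
  rw [map_sub, sub_eq_zero] at h₃
  exact (LinearMap.congr_fun h₁ P).trans h₃

theorem meanFun_mul (hchar : (2 : k) ≠ 0) (x y : H) :
    H.meanFun hchar (x * y) = H.meanFun hchar x * H.meanFun hchar y := by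
  classical
  obtain ⟨N, hN⟩ := H.exists_kills_finset hchar {x, y, x * y}
  have hx : H.Kills N x := hN x (by simp)
  have hy : H.Kills N y := hN y (by simp)
  have hxy : H.Kills N (x * y) := hN (x * y) (by simp)
  have hle : N ≤ 2 * N := by omega
  -- Order N of vanishing at `x` and `y` requires a root of precision 2N, since the comparison of
  -- P(T ⊗ T) with P ⊗ P halves the precision.
  obtain ⟨P, hP⟩ := exists_isSqrt hchar (k := k) (2 * N)
  rw [H.meanFun_eq hchar hP (hx.mono hle), H.meanFun_eq hchar hP (hy.mono hle),
    H.meanFun_eq hchar hP (hxy.mono hle), H.powMap_mul hchar hP hx hy]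

theorem twist_sub_one_one : ((H.twist : WithConv (H →ₗ[k] H)) - 1) (1 : H) = 0 := by
  obtain ⟨φ, -, h⟩ := H.isPoint_twist_zpow 1
  rw [zpow_one] at h
  rw [h]
  change φ 1 - algebraMap k H (Coalgebra.counit (R := k) (1 : H)) = 0
  rw [map_one, H.counit_one, map_one, sub_self]

theorem powMap_eq_add {P : k[T;T⁻¹]} (hP : P - 1 ∈ Ideal.span {(T 1 - 1 : k[T;T⁻¹])}) :
    ∃ c : WithConv (H →ₗ[k] H), toConv (H.powMap P) =
      H.idConv + ((H.twist : WithConv (H →ₗ[k] H)) - 1) * c := by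
  obtain ⟨Q, hQ⟩ := Ideal.mem_span_singleton'.1 hP
  refine ⟨H.twistEval Q * H.idConv, ?_⟩
  rw [eq_sub_iff_add_eq] at hQ
  rw [toConv_powMap, ← hQ, mul_comm Q, map_add, map_mul, map_one, twistEval_T_sub_one, add_mul,
    one_mul, mul_assoc, add_comm]

theorem meanFun_one (hchar : (2 : k) ≠ 0) : H.meanFun hchar 1 = 1 := by
  obtain ⟨P, hP, h⟩ := H.exists_meanFun_eq hchar {1}
  rw [h 1 (by simp)]
  obtain ⟨c, hc⟩ := H.powMap_eq_add hP
  refine (LinearMap.congr_fun (congrArg WithConv.ofConv hc) 1).trans ?_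
  have h1 : Coalgebra.comul (R := k) (1 : H) = ∑ i ∈ {()}, (fun _ : Unit => (1 : H)) i ⊗ₜ[k]
      (fun _ : Unit => (1 : H)) i := by
    rw [Finset.sum_singleton]
    exact H.comul_one
  have h2 := conv_apply_eq_sum ((H.twist : WithConv (H →ₗ[k] H)) - 1) c h1
  rw [Finset.sum_singleton, twist_sub_one_one, zero_mul] at h2
  change (1 : H) + (((H.twist : WithConv (H →ₗ[k] H)) - 1) * c) (1 : H) = 1
  rw [h2, add_zero]

/-- The geometric mean of the identity and the parity automorphism as an algebra morphism. -/
def mean (hchar : (2 : k) ≠ 0) : H →ₐ[k] H :=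
  AlgHom.ofLinearMap (H.meanLin hchar) (H.meanFun_one hchar) (H.meanFun_mul hchar)

theorem toBar_mean (hchar : (2 : k) ≠ 0) (x : H) : H.toBar (H.mean hchar x) = H.toBar x := by
  obtain ⟨P, hP, h⟩ := H.exists_meanFun_eq hchar {x}
  obtain ⟨c, hc⟩ := H.powMap_eq_add hP
  have h' := congrArg (convMap H H.toBar) hc
  rw [map_add, map_mul, map_sub, convMap_toBar_twist, map_one, sub_self, zero_mul, add_zero] at h'
  refine (congrArg H.toBar (h x (by simp))).trans ?_
  exact LinearMap.congr_fun (congrArg WithConv.ofConv h') x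

theorem parity_mean (hchar : (2 : k) ≠ 0) (x : H) : H.parity (H.mean hchar x) = H.mean hchar x := by
  obtain ⟨N, hN⟩ := H.exists_kills hchar x
  obtain ⟨P, hP⟩ := exists_isSqrt hchar (k := k) N
  have h₁ : H.mean hchar x = H.powMap P x := H.meanFun_eq hchar hP hN
  have h₂ : H.mean hchar x = H.powMap (T 1 * LaurentPolynomial.invert P) x :=
    H.meanFun_eq hchar hP.invert hN
  rw [h₁, parity_powMap, ← h₂, h₁]

theorem mean_even (hchar : (2 : k) ≠ 0) : IsEven H.gr H.gr (H.mean hchar) := by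
  intro i x hx
  obtain ⟨P, -, h⟩ := H.exists_meanFun_eq hchar {x}
  have h' : H.mean hchar x = H.powMap P x := h x (by simp)
  rw [h']
  exact H.powMap_even P i x hx

/-- The value is odd because the mean preserves degrees, and it is fixed by parity, hence equals its
own negative. This makes the mean factor through `H̄`. -/
theorem mean_odd (hchar : (2 : k) ≠ 0) {x : H} (hx : x ∈ H.gr 1) : H.mean hchar x = 0 := by
  have h := H.parity_mean hchar x
  rw [H.parity_of_odd (H.mean_even hchar 1 x hx), neg_eq_iff_add_eq_zero, ← two_smul k] at h
  exact (smul_eq_zero.1 h).resolve_left hchar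

theorem mean_oddIdeal (hchar : (2 : k) ≠ 0) (x : H) (hx : x ∈ H.oddIdeal) :
    H.mean hchar x = 0 := by
  suffices h : H.oddIdeal ≤ RingHom.ker (H.mean hchar) from h hx
  exact Ideal.span_le.2 fun a ha => H.mean_odd hchar ha

/-- The embedding of `H` into `H̄ ⊗ H` through the quotient map `H → H̄`. -/
def barConv : WithConv (H →ₗ[k] (H.bar.gr ᵍ⊗[k] H.gr)) :=
  toConv ((GradedTensorProduct.includeLeft H.bar.gr H.gr).toLinearMap ∘ₗ H.toHbar.toLinearMap)

theorem barConv_mul (φ : WithConv (H →ₗ[k] H)) :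
    H.barConv * convMap H (GradedTensorProduct.includeRight H.bar.gr H.gr) φ =
      toConv ((GradedTensorProduct.of k H.bar.gr H.gr).toLinearMap ∘ₗ
        TensorProduct.map H.toHbar.toLinearMap φ.ofConv ∘ₗ Coalgebra.comul) := by
  refine WithConv.ext (LinearMap.ext fun x => ?_)
  rw [LinearMap.convMul_apply]
  simp only [LinearMap.comp_apply]
  generalize (Coalgebra.comul (R := k) x) = t
  induction t using TensorProduct.induction_on with
  | zero => simp
  | add x y hx hy => simp only [map_add, hx, hy]
  | tmul a b =>
    exact GradedTensorProduct.tmul_one_mul_one_tmul (R := k) H.bar.gr H.gr (H.toHbar a)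
      (φ.ofConv b)

theorem leftCoact_apply (h : H) : H.leftCoact h = GradedTensorProduct.of k H.bar.gr H.gr
    (TensorProduct.map H.toHbar.toLinearMap LinearMap.id (Coalgebra.comul (R := k) h)) :=
  plain_gtMap H.toHbar H.toHbar_even (AlgHom.id k H) (isEven_id H.toSuperAlg) (H.comulAlg h)

theorem convMap_leftCoact_idConv : convMap H H.leftCoact H.idConv =
    H.barConv * convMap H (GradedTensorProduct.includeRight H.bar.gr H.gr) H.idConv := by
  rw [barConv_mul]
  exact WithConv.ext (LinearMap.ext fun h => H.leftCoact_apply h)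

theorem convMap_leftCoact_parityConv : convMap H H.leftCoact H.parityConv =
    H.barConv * convMap H (GradedTensorProduct.includeRight H.bar.gr H.gr) H.parityConv := by
  rw [barConv_mul]
  refine WithConv.ext (LinearMap.ext fun h => ?_)
  refine (H.leftCoact_apply (H.parity h)).trans ?_
  rw [comul_parity]
  change _ = GradedTensorProduct.of k H.bar.gr H.gr
    (TensorProduct.map H.toHbar.toLinearMap H.parity.toLinearMap (Coalgebra.comul (R := k) h))
  rw [TensorProduct.map_map]
  congr 2
  exact congrArg₂ TensorProduct.map (LinearMap.ext fun a => H.toBar_parity a) rfl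

/-- The left coaction translates g to ḡg, hence g⁻¹ to g⁻¹ḡ⁻¹; here ḡ is `barConv`. -/
theorem convMap_leftCoact_antiConv_mul : convMap H H.leftCoact H.antiConv * H.barConv =
    convMap H (GradedTensorProduct.includeRight H.bar.gr H.gr) H.antiConv := by
  have h₁ : convMap H (GradedTensorProduct.includeRight H.bar.gr H.gr) H.idConv *
      convMap H (GradedTensorProduct.includeRight H.bar.gr H.gr) H.antiConv = 1 := by
    rw [← map_mul, idConv_mul_antiConv, map_one]
  rw [← mul_one H.barConv, ← h₁, ← mul_assoc H.barConv, ← convMap_leftCoact_idConv, ← mul_assoc,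
    ← map_mul, antiConv_mul_idConv, map_one, one_mul]

/-- Parity fixes ḡ, so translation by ḡ sends σ(g) g⁻¹ to ḡσ(g) g⁻¹ḡ⁻¹, a conjugate of w. -/
theorem semiconj_twist : SemiconjBy H.barConv
    (convMap H (GradedTensorProduct.includeRight H.bar.gr H.gr) H.twist)
    (convMap H H.leftCoact H.twist) := by
  change H.barConv * convMap H _ (H.parityConv * H.antiConv) =
    convMap H _ (H.parityConv * H.antiConv) * H.barConv
  rw [map_mul, map_mul, mul_assoc (convMap H H.leftCoact _), convMap_leftCoact_antiConv_mul,
    convMap_leftCoact_parityConv, mul_assoc]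

/-- Conjugation is compatible with powers: wʲg is sent to ḡwʲḡ⁻¹·ḡg = ḡwʲg. -/
theorem convMap_leftCoact_powMap (P : k[T;T⁻¹]) :
    convMap H H.leftCoact (toConv (H.powMap P)) =
      H.barConv * convMap H (GradedTensorProduct.includeRight H.bar.gr H.gr)
        (toConv (H.powMap P)) := by
  have h : ∀ j : ℤ, H.barConv *
      convMap H (GradedTensorProduct.includeRight H.bar.gr H.gr) (H.twistEval (T j)) =
        convMap H H.leftCoact (H.twistEval (T j)) * H.barConv := by
    intro j
    have h' := SemiconjBy.units_zpow_right
      (x := Units.map (convMap H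
        (GradedTensorProduct.includeRight H.bar.gr H.gr)).toRingHom.toMonoidHom H.twist)
      (y := Units.map (convMap H H.leftCoact).toRingHom.toMonoidHom H.twist)
      H.semiconj_twist j
    rw [← map_zpow, ← map_zpow] at h'
    rw [twistEval_T]
    exact h'
  have h' : LinearMap.mulLeft k H.barConv ∘ₗ (convMap H
      (GradedTensorProduct.includeRight H.bar.gr H.gr)).toLinearMap ∘ₗ H.twistEval.toLinearMap =
      LinearMap.mulRight k H.barConv ∘ₗ (convMap H H.leftCoact).toLinearMap ∘ₗ
        H.twistEval.toLinearMap := laurent_ext h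
  rw [toConv_powMap, map_mul, map_mul, convMap_leftCoact_idConv, ← mul_assoc, ← mul_assoc]
  exact congrArg (· * _) (LinearMap.congr_fun h' P).symm

theorem leftCoact_mean (hchar : (2 : k) ≠ 0) :
    convMap H H.leftCoact (toConv (H.mean hchar).toLinearMap) =
      H.barConv * convMap H (GradedTensorProduct.includeRight H.bar.gr H.gr)
        (toConv (H.mean hchar).toLinearMap) := by
  classical
  refine WithConv.ext (LinearMap.ext fun x => ?_)
  obtain ⟨s, hs⟩ := TensorProduct.exists_finset (Coalgebra.comul (R := k) x)
  -- A single polynomial has to serve at `x` and at all second tensor factors of Δ(x), where the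
  -- right-hand side evaluates the mean.
  obtain ⟨P, -, hP⟩ := H.exists_meanFun_eq hchar (insert x (s.image Prod.snd))
  have h₁ : H.mean hchar x = H.powMap P x := hP x (by simp)
  have h₂ : ∀ i ∈ s, H.mean hchar i.2 = H.powMap P i.2 := fun i hi =>
    hP i.2 (Finset.mem_insert_of_mem (Finset.mem_image_of_mem _ hi))
  have h₃ := LinearMap.congr_fun (congrArg WithConv.ofConv (H.convMap_leftCoact_powMap P)) x
  have h₄ : convMap H H.leftCoact (toConv (H.mean hchar).toLinearMap) x =
      convMap H H.leftCoact (toConv (H.powMap P)) x := congrArg H.leftCoact h₁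
  refine h₄.trans (h₃.trans ?_)
  rw [barConv_mul, barConv_mul]
  simp only [LinearMap.comp_apply]
  rw [hs, map_sum, map_sum, map_sum, map_sum]
  exact Finset.sum_congr rfl fun i hi =>
    congrArg (fun z => GradedTensorProduct.tmul k (H.toHbar i.1) z) (h₂ i hi).symm

end HopfSuperAlg

end ConvolutionPoints

/-! ### The section of H → H̄ and the projections to coinvariants. -/

section Splitting

variable {k : Type u} [Field k] (H : HopfSuperAlg.{u, v} k) (hchar : (2 : k) ≠ 0)

namespace HopfSuperAlg

/-- The `H̄`-colinear algebra section of the quotient map `H → H̄`. -/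
def barSection : H.bar →ₐ[k] H :=
  H.quotLift H.oddIdeal H.oddIdeal_homogeneous (H.mean hchar) (H.mean_oddIdeal hchar)

theorem barSection_toHbar (h : H) : H.barSection hchar (H.toHbar h) = H.mean hchar h := rfl

/-- Apply id ⊗ ε to the coinvariance equation for `r`. -/
theorem toHbar_coinv {r : H} (hr : r ∈ H.coinv) :
    H.toHbar r = algebraMap k H.bar (Coalgebra.counit (R := k) r) := by
  have h₁ := (H.mem_coinv r).1 hr
  rw [leftCoactLin_apply] at h₁
  have h₂ := congrArg (TensorProduct.rid k H.bar) (congrArg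
    ((Coalgebra.counit (R := k)).lTensor H.bar) h₁)
  have h₃ : ∀ t : H ⊗[k] H, (Coalgebra.counit (R := k)).lTensor H.bar
      (H.toHbar.toLinearMap.rTensor H t) =
        H.toHbar.toLinearMap.rTensor k ((Coalgebra.counit (R := k)).lTensor H t) := fun t => by
    induction t using TensorProduct.induction_on with
    | zero => simp
    | add x y hx hy => simp only [map_add, hx, hy]
    | tmul x y => rfl
  rw [h₃, Coalgebra.lTensor_counit_comul, LinearMap.lTensor_tmul, LinearMap.rTensor_tmul,
    TensorProduct.rid_tmul, TensorProduct.rid_tmul, one_smul] at h₂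
  rw [Algebra.algebraMap_eq_smul_one]
  exact h₂

theorem mean_coinv {r : H} (hr : r ∈ H.coinv) :
    H.mean hchar r = algebraMap k H (Coalgebra.counit (R := k) r) := by
  rw [← barSection_toHbar, H.toHbar_coinv hr, AlgHom.commutes]

theorem counit_mean (h : H) :
    Coalgebra.counit (R := k) (H.mean hchar h) = Coalgebra.counit (R := k) h := by
  rw [← counit_toHbar, ← counit_toHbar H h]
  exact congrArg _ (H.toBar_mean hchar h)

/-- The section as an element of the convolution algebra. -/
def meanConv : WithConv (H →ₗ[k] H) := toConv (H.mean hchar).toLinearMap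

/-- The composite of the section with the antipode as an element of the convolution algebra. -/
def meanAntiConv : WithConv (H →ₗ[k] H) := convMap H (H.mean hchar) H.antiConv

theorem meanConv_mul_meanAntiConv : H.meanConv hchar * H.meanAntiConv hchar = 1 := by
  have h := congrArg (convMap H (H.mean hchar)) H.idConv_mul_antiConv
  rwa [map_mul, map_one] at h

theorem meanAntiConv_mul_meanConv : H.meanAntiConv hchar * H.meanConv hchar = 1 := by
  have h := congrArg (convMap H (H.mean hchar)) H.antiConv_mul_idConv
  rwa [map_mul, map_one] at h

/-- The algebra morphism `h ↦ S(h₍₁₎) γ(h̄₍₂₎)`, where `γ` is the section. -/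
def antiMean : H →ₐ[k] H :=
  coactMulAlg (T := H.toSuperAlg) H.comulAlg H.antipodeAlg H.antipode_even (H.mean hchar)
    (H.mean_even hchar)

theorem antiMean_even : IsEven H.gr H.gr (H.antiMean hchar) :=
  coactMulAlg_even H.comul_even _ _ _ _

theorem toConv_antiMean : toConv (H.antiMean hchar).toLinearMap =
    H.antiConv * H.meanConv hchar := rfl

/-- The algebra morphism `h ↦ γ(S(h̄₍₁₎)) h₍₂₎`, where `γ` is the section; it is a projection onto
the algebra of coinvariants. -/
def coinvProj : H →ₐ[k] H :=
  coactMulAlg (T := H.toSuperAlg) H.comulAlg ((H.mean hchar).comp H.antipodeAlg)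
    (fun i a ha => H.mean_even hchar i _ (H.antipode_even i a ha)) (AlgHom.id k H)
    (isEven_id H.toSuperAlg)

theorem coinvProj_even : IsEven H.gr H.gr (H.coinvProj hchar) :=
  coactMulAlg_even H.comul_even _ _ _ _

theorem toConv_coinvProj : toConv (H.coinvProj hchar).toLinearMap =
    H.meanAntiConv hchar * H.idConv := rfl

theorem idConv_mul_antiMean :
    H.idConv * toConv (H.antiMean hchar).toLinearMap = H.meanConv hchar := by
  rw [toConv_antiMean, ← mul_assoc, idConv_mul_antiConv, one_mul]

theorem meanConv_mul_coinvProj :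
    H.meanConv hchar * toConv (H.coinvProj hchar).toLinearMap = H.idConv := by
  rw [toConv_coinvProj, ← mul_assoc, meanConv_mul_meanAntiConv, one_mul]

theorem antiMean_mul_coinvProj :
    toConv (H.antiMean hchar).toLinearMap * toConv (H.coinvProj hchar).toLinearMap = 1 := by
  rw [toConv_antiMean, mul_assoc, meanConv_mul_coinvProj, antiConv_mul_idConv]

/-- Left translation sends g⁻¹m to g⁻¹ḡ⁻¹·ḡm = g⁻¹m; colinearity of the mean enters here. -/
theorem antiMean_mem (h : H) : H.antiMean hchar h ∈ H.coinv := by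
  refine (AlgHom.mem_equalizer _ _ _).2 ?_
  have h' : convMap H H.leftCoact (H.antiConv * H.meanConv hchar) =
      convMap H (GradedTensorProduct.includeRight H.bar.gr H.gr)
        (H.antiConv * H.meanConv hchar) := by
    rw [map_mul, map_mul, meanConv, leftCoact_mean, ← mul_assoc, convMap_leftCoact_antiConv_mul]
  exact LinearMap.congr_fun (congrArg WithConv.ofConv h') h

/-- Left translation sends m⁻¹g to m⁻¹ḡ⁻¹·ḡg = m⁻¹g. -/
theorem coinvProj_mem (h : H) : H.coinvProj hchar h ∈ H.coinv := by
  refine (AlgHom.mem_equalizer _ _ _).2 ?_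
  have h₁ : convMap H (GradedTensorProduct.includeRight H.bar.gr H.gr) (H.meanConv hchar) *
      convMap H (GradedTensorProduct.includeRight H.bar.gr H.gr) (H.meanAntiConv hchar) = 1 := by
    rw [← map_mul, meanConv_mul_meanAntiConv, map_one]
  have h₂ : convMap H H.leftCoact (H.meanAntiConv hchar) * H.barConv =
      convMap H (GradedTensorProduct.includeRight H.bar.gr H.gr) (H.meanAntiConv hchar) := by
    rw [← mul_one H.barConv, ← h₁, ← mul_assoc H.barConv, meanConv, ← leftCoact_mean, ← mul_assoc,
      ← map_mul]
    change convMap H H.leftCoact (H.meanAntiConv hchar * H.meanConv hchar) * _ = _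
    rw [meanAntiConv_mul_meanConv, map_one, one_mul]
  have h' : convMap H H.leftCoact (H.meanAntiConv hchar * H.idConv) =
      convMap H (GradedTensorProduct.includeRight H.bar.gr H.gr)
        (H.meanAntiConv hchar * H.idConv) := by
    rw [map_mul, map_mul, convMap_leftCoact_idConv, ← mul_assoc, h₂]
  exact LinearMap.congr_fun (congrArg WithConv.ofConv h') h

/-- `antiMean` as a morphism to the algebra of coinvariants. -/
def antiMeanCoinv : H →ₐ[k] H.coinv := (H.antiMean hchar).codRestrict _ (H.antiMean_mem hchar)

/-- `coinvProj` as a morphism to the algebra of coinvariants. -/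
def coinvProjCoinv : H →ₐ[k] H.coinv := (H.coinvProj hchar).codRestrict _ (H.coinvProj_mem hchar)

theorem antiMeanCoinv_mul_coinvProjCoinv :
    toConv (H.antiMeanCoinv hchar).toLinearMap * toConv (H.coinvProjCoinv hchar).toLinearMap =
      1 := by
  have h : convMap H H.coinv.val (toConv (H.antiMeanCoinv hchar).toLinearMap *
      toConv (H.coinvProjCoinv hchar).toLinearMap) = convMap H H.coinv.val 1 := by
    rw [map_mul, map_one]
    exact H.antiMean_mul_coinvProj hchar
  refine WithConv.ext (LinearMap.ext fun x => Subtype.ext ?_)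
  exact LinearMap.congr_fun (congrArg WithConv.ofConv h) x

theorem counit_antiMean (h : H) :
    Coalgebra.counit (R := k) (H.antiMean hchar h) = Coalgebra.counit (R := k) h := by
  have h₁ : convMap H H.counitAlg (H.meanConv hchar) = convMap H H.counitAlg H.idConv :=
    WithConv.ext (LinearMap.ext fun x => H.counit_mean hchar x)
  have h₂ : convMap H H.counitAlg (H.antiConv * H.meanConv hchar) = 1 := by
    rw [map_mul, h₁, ← map_mul, antiConv_mul_idConv, map_one]
  exact LinearMap.congr_fun (congrArg WithConv.ofConv h₂) h

end HopfSuperAlg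

end Splitting

/-! ### The quotient D_f, its section, and a left inverse of ι. -/

section Quotient

variable {k : Type u} [Field k] {H : HopfSuperAlg.{u, v} k} {A : SuperAlg.{u, w} k}
  {ρ : A →ₐ[k] (A.gr ᵍ⊗[k] H.gr)} {f : H.coinv →ₐ[k] A}

theorem toDf_coinv (hf : IsCoinvMorphism ρ f) (r : H.coinv) :
    toDf hf (f r) = algebraMap k (Df hf) (Coalgebra.counit (R := k) (r : H)) := by
  have h : toDf hf (f (r - algebraMap k H.coinv (Coalgebra.counit (R := k) (r : H)))) = 0 := by
    refine (A.quotMk_eq_zero _ _ _).2 (Ideal.subset_span ⟨_, ?_, rfl⟩)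
    change H.counitAlg ((r : H) - algebraMap k H _) = 0
    rw [map_sub, AlgHom.commutes]
    exact sub_self _
  rwa [map_sub, map_sub, AlgHom.commutes, AlgHom.commutes, sub_eq_zero] at h

/-- ρ(f(r)) = f(r₍₁₎) ⊗ r₍₂₎ with r₍₁₎ in `R`, and in `D_f` the element f(r₍₁₎) becomes the scalar
ε(r₍₁₎). -/
theorem map_toDf_coactLin (hf : IsCoinvMorphism ρ f) {W : Type*} [AddCommGroup W] [Module k W]
    (g : H →ₗ[k] W) (r : H.coinv) :
    TensorProduct.map (toDf hf).toLinearMap g (coactLin ρ (f r)) = 1 ⊗ₜ[k] g r := by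
  have h : ∀ t : H.coinv ⊗[k] H, TensorProduct.map (toDf hf).toLinearMap g
      (f.toLinearMap.rTensor H t) = TensorProduct.map (Algebra.linearMap k (Df hf)) g
        ((Coalgebra.counit (R := k)).rTensor H (H.coinv.val.toLinearMap.rTensor H t)) := fun t => by
    induction t using TensorProduct.induction_on with
    | zero => simp
    | add x y hx hy => simp only [map_add, hx, hy]
    | tmul x y => exact congrArg (· ⊗ₜ[k] g y) (toDf_coinv hf x)
  rw [hf.colinear, h, H.rTensor_val_coinvCoact, Coalgebra.rTensor_counit_comul,
    TensorProduct.map_tmul, Algebra.linearMap_apply, map_one]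

/-- The coaction of `H̄` on `D_f`. -/
def rhoDf (hf : IsCoinvMorphism ρ f) : Df hf →ₐ[k] ((Df hf).gr ᵍ⊗[k] H.bar.gr) :=
  A.quotLift _ _ ((gtMap (toDf hf) (toDf_even hf) H.toHbar H.toHbar_even).comp ρ) (by
    suffices h : augIdeal f ≤ RingHom.ker
        ((gtMap (toDf hf) (toDf_even hf) H.toHbar H.toHbar_even).comp ρ) from fun a ha => h ha
    refine Ideal.span_le.2 ?_
    rintro _ ⟨r, hr, rfl⟩
    refine RingHom.mem_ker.2 ((plain_gtMap _ (toDf_even hf) _ H.toHbar_even (ρ (f r))).trans ?_)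
    refine (map_toDf_coactLin hf H.toHbar.toLinearMap r).trans ?_
    change 1 ⊗ₜ[k] H.toHbar r = 0
    rw [H.toHbar_coinv r.2, hr, map_zero, TensorProduct.tmul_zero])

theorem rhoDf_toDf (hf : IsCoinvMorphism ρ f) (a : A) : rhoDf hf (toDf hf a) =
    gtMap (toDf hf) (toDf_even hf) H.toHbar H.toHbar_even (ρ a) := rfl

theorem coactLin_rhoDf_toDf (hf : IsCoinvMorphism ρ f) (a : A) :
    coactLin (rhoDf hf) (toDf hf a) =
      TensorProduct.map (toDf hf).toLinearMap H.toHbar.toLinearMap (coactLin ρ a) :=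
  plain_gtMap _ (toDf_even hf) _ H.toHbar_even (ρ a)

theorem toDf_surjective (hf : IsCoinvMorphism ρ f) : Function.Surjective (toDf hf) :=
  A.quotMk_surjective _ _

theorem plain_iota (hf : IsCoinvMorphism ρ f) (a : A) :
    plain (Df hf) H.toSuperAlg (iota hf a) =
      TensorProduct.map (toDf hf).toLinearMap LinearMap.id (coactLin ρ a) :=
  plain_gtMap _ (toDf_even hf) _ (isEven_id H.toSuperAlg) (ρ a)

theorem iota_coinv (hf : IsCoinvMorphism ρ f) (r : H.coinv) :
    iota hf (f r) = GradedTensorProduct.includeRight (Df hf).gr H.gr r :=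
  (plain_iota hf (f r)).trans (map_toDf_coactLin hf LinearMap.id r)

theorem coactMul_include {D : SuperAlg.{u, x} k} (r : A →ₗ[k] A ⊗[k] H) (α : A →ₗ[k] D)
    (φ : H →ₗ[k] H) (a : A) :
    coactMul r ((GradedTensorProduct.includeLeft D.gr H.gr).toLinearMap ∘ₗ α)
      ((GradedTensorProduct.includeRight D.gr H.gr).toLinearMap ∘ₗ φ) a =
        GradedTensorProduct.of k D.gr H.gr (TensorProduct.map α φ (r a)) := by
  simp only [coactMul, LinearMap.comp_apply]
  generalize r a = t
  induction t using TensorProduct.induction_on with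
  | zero => simp
  | add x y hx hy => simp only [map_add, hx, hy]
  | tmul x y => exact GradedTensorProduct.tmul_one_mul_one_tmul (R := k) D.gr H.gr (α x) (φ y)

theorem iota_toLinearMap (hf : IsCoinvMorphism ρ f) : (iota hf).toLinearMap =
    coactMul (coactLin ρ)
      ((GradedTensorProduct.includeLeft (Df hf).gr H.gr).toLinearMap ∘ₗ (toDf hf).toLinearMap)
      ((GradedTensorProduct.includeRight (Df hf).gr H.gr).toLinearMap ∘ₗ LinearMap.id) :=
  LinearMap.ext fun a => (plain_iota hf a).trans (coactMul_include (coactLin ρ) _ _ a).symm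

variable (hchar : (2 : k) ≠ 0)

/-- The composite of `antiMean` with `f`. -/
def compAntiMean (f : H.coinv →ₐ[k] A) : H →ₐ[k] A := f.comp (H.antiMeanCoinv hchar)

/-- The composite of `coinvProj` with `f`. -/
def compCoinvProj (f : H.coinv →ₐ[k] A) : H →ₐ[k] A := f.comp (H.coinvProjCoinv hchar)

theorem compAntiMean_even (hf : IsCoinvMorphism ρ f) :
    IsEven H.gr A.gr (compAntiMean hchar f) :=
  fun i h hh => hf.even i _ (H.antiMean_even hchar i h hh)

theorem compCoinvProj_even (hf : IsCoinvMorphism ρ f) :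
    IsEven H.gr A.gr (compCoinvProj hchar f) :=
  fun i h hh => hf.even i _ (H.coinvProj_even hchar i h hh)

theorem compAntiMean_mul_compCoinvProj (f : H.coinv →ₐ[k] A) :
    toConv (compAntiMean hchar f).toLinearMap * toConv (compCoinvProj hchar f).toLinearMap =
      1 := by
  have h := congrArg (convMap H f) (H.antiMeanCoinv_mul_coinvProjCoinv hchar)
  rw [map_mul, map_one] at h
  exact h

/-- The algebra endomorphism `a ↦ a₍₀₎ f(S(a₍₁₎) γ(ā₍₂₎))` of `A`. -/
def retract (hf : IsCoinvMorphism ρ f) : A →ₐ[k] A :=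
  coactMulAlg ρ (AlgHom.id k A) (isEven_id A) (compAntiMean hchar f) (compAntiMean_even hchar hf)

theorem retract_toLinearMap (hf : IsCoinvMorphism ρ f) : (retract hchar hf).toLinearMap =
    coactMul (coactLin ρ) LinearMap.id (compAntiMean hchar f).toLinearMap := rfl

/-- The computation takes place in `R` before applying f: r₍₁₎S(r₍₂₎)m(r₍₃₎) = m(r), and m factors
through `H̄`, where r is the scalar ε(r). -/
theorem retract_coinv (hf : IsCoinvMorphism ρ f) (r : H.coinv) :
    retract hchar hf (f r) = algebraMap k A (Coalgebra.counit (R := k) (r : H)) := by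
  have h₁ : ∀ t : H.coinv ⊗[k] H, LinearMap.mul' k A (TensorProduct.map LinearMap.id
      (compAntiMean hchar f).toLinearMap (f.toLinearMap.rTensor H t)) =
        f (LinearMap.mul' k H.coinv (TensorProduct.map LinearMap.id
          (H.antiMeanCoinv hchar).toLinearMap t)) := fun t => by
    induction t using TensorProduct.induction_on with
    | zero => simp
    | add x y hx hy => simp only [map_add, hx, hy]
    | tmul x y => exact (map_mul f _ _).symm
  have h₂ : ∀ t : H.coinv ⊗[k] H, H.coinv.val (LinearMap.mul' k H.coinv
      (TensorProduct.map LinearMap.id (H.antiMeanCoinv hchar).toLinearMap t)) =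
        LinearMap.mul' k H (TensorProduct.map LinearMap.id (H.antiMean hchar).toLinearMap
          (H.coinv.val.toLinearMap.rTensor H t)) := fun t => by
    induction t using TensorProduct.induction_on with
    | zero => simp
    | add x y hx hy => simp only [map_add, hx, hy]
    | tmul x y => rfl
  have h₃ : LinearMap.mul' k H.coinv (TensorProduct.map LinearMap.id
      (H.antiMeanCoinv hchar).toLinearMap (H.coinvCoact r)) =
        algebraMap k H.coinv (Coalgebra.counit (R := k) (r : H)) := by
    refine Subtype.ext ((h₂ _).trans ?_)
    rw [H.rTensor_val_coinvCoact]
    refine (LinearMap.congr_fun (congrArg WithConv.ofConv (H.idConv_mul_antiMean hchar))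
      (r : H)).trans ?_
    exact H.mean_coinv hchar r.2
  change LinearMap.mul' k A (TensorProduct.map LinearMap.id
    (compAntiMean hchar f).toLinearMap (coactLin ρ (f r))) = _
  rw [hf.colinear, h₁, h₃, AlgHom.commutes]

/-- The section `D_f → A` of the quotient map `A → D_f`. -/
def secDf (hf : IsCoinvMorphism ρ f) : Df hf →ₐ[k] A :=
  A.quotLift _ _ (retract hchar hf) (by
    suffices h : augIdeal f ≤ RingHom.ker (retract hchar hf) from fun a ha => h ha
    refine Ideal.span_le.2 ?_
    rintro _ ⟨r, hr, rfl⟩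
    refine RingHom.mem_ker.2 ((retract_coinv hchar hf r).trans ?_)
    rw [hr, map_zero])

theorem secDf_toDf (hf : IsCoinvMorphism ρ f) (a : A) :
    secDf hchar hf (toDf hf a) = retract hchar hf a := rfl

theorem secDf_even (hρ : IsCoaction ρ) (hf : IsCoinvMorphism ρ f) :
    IsEven (Df hf).gr A.gr (secDf hchar hf) := by
  rintro i _ ⟨a, ha, rfl⟩
  exact coactMulAlg_even hρ.even (AlgHom.id k A) (isEven_id A) (compAntiMean hchar f)
    (compAntiMean_even hchar hf) i a ha

/-- `antiMean` takes values in `R` and preserves ε, so its composite with `R → A → D_f` is the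
convolution unit, which acts trivially. -/
theorem toDf_secDf (hρ : IsCoaction ρ) (hf : IsCoinvMorphism ρ f) (d : Df hf) :
    toDf hf (secDf hchar hf d) = d := by
  obtain ⟨a, rfl⟩ := toDf_surjective hf d
  have h₁ : (toDf hf).toLinearMap ∘ₗ (compAntiMean hchar f).toLinearMap =
      (1 : WithConv (H →ₗ[k] Df hf)).ofConv := by
    refine LinearMap.ext fun h => ?_
    refine (toDf_coinv hf (H.antiMeanCoinv hchar h)).trans ?_
    exact congrArg _ (H.counit_antiMean hchar h)
  have h₂ : (toDf hf).toLinearMap ∘ₗ (retract hchar hf).toLinearMap = (toDf hf).toLinearMap := by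
    rw [retract_toLinearMap, comp_coactMul, h₁, coactMul_one hρ.counit, LinearMap.comp_id]
  exact LinearMap.congr_fun h₂ a

/-- ι sends a₍₀₎f((g⁻¹m)(a₍₁₎)) to ā₍₀₎ ⊗ (g·g⁻¹m)(a₍₁₎) = ā₍₀₎ ⊗ m(a₍₁₎), since ι restricted to
f(R) is r ↦ 1 ⊗ r. -/
theorem iota_secDf (hρ : IsCoaction ρ) (hf : IsCoinvMorphism ρ f) (d : Df hf) :
    iota hf (secDf hchar hf d) = GradedTensorProduct.of k (Df hf).gr H.gr
      ((H.barSection hchar).toLinearMap.lTensor (Df hf) (coactLin (rhoDf hf) d)) := by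
  obtain ⟨a, rfl⟩ := toDf_surjective hf d
  have h₁ : (iota hf).toLinearMap ∘ₗ (compAntiMean hchar f).toLinearMap =
      (GradedTensorProduct.includeRight (Df hf).gr H.gr).toLinearMap ∘ₗ
        (H.antiMean hchar).toLinearMap :=
    LinearMap.ext fun h => iota_coinv hf (H.antiMeanCoinv hchar h)
  have h₂ : toConv ((GradedTensorProduct.includeRight (Df hf).gr H.gr).toLinearMap ∘ₗ
      LinearMap.id) * toConv ((GradedTensorProduct.includeRight (Df hf).gr H.gr).toLinearMap ∘ₗ
        (H.antiMean hchar).toLinearMap) =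
      toConv ((GradedTensorProduct.includeRight (Df hf).gr H.gr).toLinearMap ∘ₗ
        (H.mean hchar).toLinearMap) := by
    have h := congrArg (convMap H (GradedTensorProduct.includeRight (Df hf).gr H.gr))
      (H.idConv_mul_antiMean hchar)
    rw [map_mul] at h
    exact h
  have h₃ : (iota hf).toLinearMap ∘ₗ (retract hchar hf).toLinearMap =
      coactMul (coactLin ρ)
        ((GradedTensorProduct.includeLeft (Df hf).gr H.gr).toLinearMap ∘ₗ (toDf hf).toLinearMap)
        ((GradedTensorProduct.includeRight (Df hf).gr H.gr).toLinearMap ∘ₗ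
          (H.mean hchar).toLinearMap) := by
    rw [retract_toLinearMap, comp_coactMul, LinearMap.comp_id, h₁, iota_toLinearMap]
    have h := coactMul_coactMul hρ.coassoc
      ((GradedTensorProduct.includeLeft (Df hf).gr H.gr).toLinearMap ∘ₗ (toDf hf).toLinearMap)
      (toConv ((GradedTensorProduct.includeRight (Df hf).gr H.gr).toLinearMap ∘ₗ LinearMap.id))
      (toConv ((GradedTensorProduct.includeRight (Df hf).gr H.gr).toLinearMap ∘ₗ
        (H.antiMean hchar).toLinearMap))
    rw [h₂] at h
    exact h
  refine (LinearMap.congr_fun h₃ a).trans ((coactMul_include (coactLin ρ) _ _ a).trans ?_)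
  rw [coactLin_rhoDf_toDf]
  refine congrArg (GradedTensorProduct.of k (Df hf).gr H.gr) ?_
  generalize coactLin ρ a = t
  induction t using TensorProduct.induction_on with
  | zero => simp
  | add x y hx hy => simp only [map_add, hx, hy]
  | tmul x y => rfl

/-- The algebra morphism `D_f ⊗ H → A`, `d ⊗ h ↦ s(d) f(p(h))`, where `s` is the section of the
quotient map `A → D_f` and `p` is the projection of `H` onto its coinvariants. -/
def iotaRetract (hρ : IsCoaction ρ) (hf : IsCoinvMorphism ρ f) :
    ((Df hf).gr ᵍ⊗[k] H.gr) →ₐ[k] A :=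
  mulLift (secDf hchar hf) (secDf_even hchar hρ hf) (compCoinvProj hchar f)
    (compCoinvProj_even hchar hf)

theorem iotaRetract_tmul (hρ : IsCoaction ρ) (hf : IsCoinvMorphism ρ f) (d : Df hf) (h : H) :
    iotaRetract hchar hρ hf (GradedTensorProduct.tmul k d h) =
      secDf hchar hf d * compCoinvProj hchar f h := rfl

/-- The composite is the action of (f∘g⁻¹m)(f∘m⁻¹g) = 1 on the identity of `A`. -/
theorem iotaRetract_iota (hρ : IsCoaction ρ) (hf : IsCoinvMorphism ρ f) (a : A) :
    iotaRetract hchar hρ hf (iota hf a) = a := by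
  have h₁ : (iotaRetract hchar hρ hf).toLinearMap ∘ₗ
      (GradedTensorProduct.includeLeft (Df hf).gr H.gr).toLinearMap ∘ₗ (toDf hf).toLinearMap =
        (retract hchar hf).toLinearMap := LinearMap.ext fun a => by
    change secDf hchar hf (toDf hf a) * compCoinvProj hchar f 1 = retract hchar hf a
    rw [map_one, mul_one, secDf_toDf]
  have h₂ : (iotaRetract hchar hρ hf).toLinearMap ∘ₗ
      (GradedTensorProduct.includeRight (Df hf).gr H.gr).toLinearMap ∘ₗ LinearMap.id =
        (compCoinvProj hchar f).toLinearMap := LinearMap.ext fun h => by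
    change secDf hchar hf 1 * compCoinvProj hchar f h = compCoinvProj hchar f h
    rw [map_one, one_mul]
  have h₃ : (iotaRetract hchar hρ hf).toLinearMap ∘ₗ (iota hf).toLinearMap = LinearMap.id := by
    rw [iota_toLinearMap, comp_coactMul, h₁, h₂, retract_toLinearMap]
    have h := coactMul_coactMul hρ.coassoc LinearMap.id (toConv (compAntiMean hchar f).toLinearMap)
      (toConv (compCoinvProj hchar f).toLinearMap)
    rw [compAntiMean_mul_compCoinvProj, coactMul_one hρ.counit] at h
    exact h
  exact LinearMap.congr_fun h₃ a

end Quotient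

/-! ### ι is an isomorphism onto the cotensor product. -/

section Inflation

variable {k : Type u} [Field k] {H : HopfSuperAlg.{u, v} k} {A : SuperAlg.{u, w} k}
  {ρ : A →ₐ[k] (A.gr ᵍ⊗[k] H.gr)} {f : H.coinv →ₐ[k] A}

/-- Coassociativity after application of linear maps to the three tensor factors. -/
theorem IsCoaction.assoc_map (hρ : IsCoaction ρ) {D V W : Type*} [AddCommGroup D] [Module k D]
    [AddCommGroup V] [Module k V] [AddCommGroup W] [Module k W] (q : A →ₗ[k] D) (g : H →ₗ[k] V)
    (g' : H →ₗ[k] W) (a : A) :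
    TensorProduct.assoc k D V W
        (TensorProduct.map (TensorProduct.map q g ∘ₗ coactLin ρ) g' (coactLin ρ a)) =
      TensorProduct.map q (TensorProduct.map g g' ∘ₗ Coalgebra.comul) (coactLin ρ a) := by
  have h₁ : ∀ t : A ⊗[k] H, TensorProduct.assoc k D V W
      (TensorProduct.map (TensorProduct.map q g ∘ₗ coactLin ρ) g' t) =
        TensorProduct.map q (TensorProduct.map g g')
          (TensorProduct.assoc k A H H ((coactLin ρ).rTensor H t)) := fun t => by
    induction t using TensorProduct.induction_on with
    | zero => simp
    | add x y hx hy => simp only [map_add, hx, hy]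
    | tmul x y =>
      rw [TensorProduct.map_tmul, LinearMap.rTensor_tmul, LinearMap.comp_apply]
      generalize coactLin ρ x = z
      induction z using TensorProduct.induction_on with
      | zero => simp
      | add x y hx hy => simp only [map_add, TensorProduct.add_tmul, hx, hy]
      | tmul a b => rfl
  rw [h₁, hρ.coassoc]
  generalize coactLin ρ a = t
  induction t using TensorProduct.induction_on with
  | zero => simp
  | add x y hx hy => simp only [map_add, hx, hy]
  | tmul x y => rfl

theorem map_mem_tensorGr {V V' W W' : Type*} [AddCommGroup V] [Module k V] [AddCommGroup V']
    [Module k V'] [AddCommGroup W] [Module k W] [AddCommGroup W'] [Module k W']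
    {𝒱 : ZMod 2 → Submodule k V} {𝒱' : ZMod 2 → Submodule k V'} {𝒲 : ZMod 2 → Submodule k W}
    {𝒲' : ZMod 2 → Submodule k W'} {φ : V →ₗ[k] V'} {ψ : W →ₗ[k] W'} (hφ : IsEven 𝒱 𝒱' φ)
    (hψ : IsEven 𝒲 𝒲' ψ) {i : ZMod 2} {t : V ⊗[k] W} (ht : t ∈ tensorGr 𝒱 𝒲 i) :
    TensorProduct.map φ ψ t ∈ tensorGr 𝒱' 𝒲' i := by
  suffices h : tensorGr 𝒱 𝒲 i ≤ (tensorGr 𝒱' 𝒲' i).comap (TensorProduct.map φ ψ) from h ht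
  refine iSup_le fun j => Submodule.map₂_le.2 fun a ha b hb => ?_
  exact Submodule.mem_iSup_of_mem j (Submodule.apply_mem_map₂ _ (hφ _ _ ha) (hψ _ _ hb))

theorem coactLin_rhoDf_comp (hf : IsCoinvMorphism ρ f) :
    coactLin (rhoDf hf) ∘ₗ (toDf hf).toLinearMap =
      TensorProduct.map (toDf hf).toLinearMap H.toHbar.toLinearMap ∘ₗ coactLin ρ :=
  LinearMap.ext (coactLin_rhoDf_toDf hf)

theorem comul_comp_toHbar : Coalgebra.comul (R := k) ∘ₗ H.toHbar.toLinearMap =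
    TensorProduct.map H.toHbar.toLinearMap H.toHbar.toLinearMap ∘ₗ Coalgebra.comul :=
  LinearMap.ext H.comul_toHbar

theorem leftCoactLin_eq : H.leftCoactLin =
    TensorProduct.map H.toHbar.toLinearMap LinearMap.id ∘ₗ Coalgebra.comul :=
  LinearMap.ext H.leftCoactLin_apply

theorem plain_comp_iota (hf : IsCoinvMorphism ρ f) :
    plain (Df hf) H.toSuperAlg ∘ₗ (iota hf).toLinearMap =
      TensorProduct.map (toDf hf).toLinearMap LinearMap.id ∘ₗ coactLin ρ :=
  LinearMap.ext (plain_iota hf)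

theorem isCoaction_rhoDf (hρ : IsCoaction ρ) (hf : IsCoinvMorphism ρ f) :
    IsCoaction (H := H.bar) (rhoDf hf) where
  even := by
    rintro i _ ⟨a, ha, rfl⟩
    refine Eq.mpr (congrArg (· ∈ _) (coactLin_rhoDf_toDf hf a)) ?_
    exact map_mem_tensorGr (toDf_even hf) H.toHbar_even (hρ.even i a ha)
  coassoc d := by
    obtain ⟨a, rfl⟩ := toDf_surjective hf d
    rw [coactLin_rhoDf_toDf, ← LinearMap.comp_apply (LinearMap.rTensor _ _),
      ← LinearMap.comp_apply (LinearMap.lTensor _ _), LinearMap.rTensor, LinearMap.lTensor,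
      ← TensorProduct.map_comp, ← TensorProduct.map_comp, coactLin_rhoDf_comp,
      LinearMap.id_comp, LinearMap.id_comp, comul_comp_toHbar]
    exact hρ.assoc_map _ _ _ a
  counit d := by
    obtain ⟨a, rfl⟩ := toDf_surjective hf d
    have h : ∀ t : A ⊗[k] H, (Coalgebra.counit (R := k)).lTensor (Df hf)
        (TensorProduct.map (toDf hf).toLinearMap H.toHbar.toLinearMap t) =
          (toDf hf).toLinearMap.rTensor k ((Coalgebra.counit (R := k)).lTensor A t) := fun t => by
      induction t using TensorProduct.induction_on with
      | zero => simp
      | add x y hx hy => simp only [map_add, hx, hy]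
      | tmul x y => rfl
    rw [coactLin_rhoDf_toDf, h, hρ.counit]
    rfl

theorem iota_colinear (hρ : IsCoaction ρ) (hf : IsCoinvMorphism ρ f) (a : A) :
    TensorProduct.assoc k (Df hf) H H
        ((plain (Df hf) H.toSuperAlg ∘ₗ (iota hf).toLinearMap).rTensor H (coactLin ρ a)) =
      (Coalgebra.comul (R := k)).lTensor (Df hf) (plain (Df hf) H.toSuperAlg (iota hf a)) := by
  rw [plain_comp_iota, plain_iota, ← LinearMap.comp_apply (LinearMap.lTensor _ _),
    LinearMap.lTensor, ← TensorProduct.map_comp, LinearMap.id_comp, LinearMap.comp_id]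
  have h := hρ.assoc_map (toDf hf).toLinearMap LinearMap.id LinearMap.id a
  rwa [TensorProduct.map_id, LinearMap.id_comp] at h

theorem plain_iota_mem_cotensor (hρ : IsCoaction ρ) (hf : IsCoinvMorphism ρ f) (a : A) :
    plain (Df hf) H.toSuperAlg (iota hf a) ∈ cotensor H (rhoDf hf) := by
  change TensorProduct.assoc k (Df hf) H.bar H ((coactLin (rhoDf hf)).rTensor H _) =
    H.leftCoactLin.lTensor (Df hf) _
  rw [plain_iota, ← LinearMap.comp_apply (LinearMap.rTensor _ _),
    ← LinearMap.comp_apply (LinearMap.lTensor _ _), LinearMap.rTensor, LinearMap.lTensor,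
    ← TensorProduct.map_comp, ← TensorProduct.map_comp, coactLin_rhoDf_comp,
    LinearMap.id_comp, LinearMap.id_comp, LinearMap.comp_id, leftCoactLin_eq]
  exact hρ.assoc_map _ _ _ a

variable (hchar : (2 : k) ≠ 0)

theorem of_mul_includeRight (D : SuperAlg.{u, x} k) (E : SuperAlg.{u, v} k) (t : D ⊗[k] E)
    (h : E) : GradedTensorProduct.of k D.gr E.gr t * GradedTensorProduct.includeRight D.gr E.gr h =
      GradedTensorProduct.of k D.gr E.gr ((LinearMap.mulRight k h).lTensor D t) := by
  induction t using TensorProduct.induction_on with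
  | zero => simp
  | add x y hx hy => simp only [map_add, add_mul, hx, hy]
  | tmul x y =>
    have e : ∀ y : E, GradedTensorProduct.of k D.gr E.gr (x ⊗ₜ[k] y) =
        GradedTensorProduct.tmul k x (1 : E) * GradedTensorProduct.tmul k (1 : D) y := fun y =>
      (GradedTensorProduct.tmul_one_mul_one_tmul (R := k) D.gr E.gr x y).symm
    rw [LinearMap.lTensor_tmul, e, e, mul_assoc]
    exact congrArg _ (map_mul (GradedTensorProduct.includeRight D.gr E.gr) y h).symm

/-- On d ⊗ h the composite is d₍₀₎ ⊗ γ(d₍₁₎)(m⁻¹g)(h). The cotensor condition replaces d₍₁₎ ⊗ h by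
h̄₍₁₎ ⊗ h₍₂₎, and m·m⁻¹g = g. -/
theorem iota_iotaRetract (hρ : IsCoaction ρ) (hf : IsCoinvMorphism ρ f) {t : Df hf ⊗[k] H}
    (ht : t ∈ cotensor H (rhoDf hf)) :
    iota hf (iotaRetract hchar hρ hf (GradedTensorProduct.of k (Df hf).gr H.gr t)) =
      GradedTensorProduct.of k (Df hf).gr H.gr t := by
  have h₁ : ∀ t : Df hf ⊗[k] H,
      iota hf (iotaRetract hchar hρ hf (GradedTensorProduct.of k (Df hf).gr H.gr t)) =
        GradedTensorProduct.of k (Df hf).gr H.gr ((LinearMap.mul' k H ∘ₗ TensorProduct.map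
          (H.barSection hchar).toLinearMap (H.coinvProj hchar).toLinearMap).lTensor (Df hf)
            (TensorProduct.assoc k (Df hf) H.bar H ((coactLin (rhoDf hf)).rTensor H t))) :=
      fun t => by
    induction t using TensorProduct.induction_on with
    | zero => simp
    | add x y hx hy => simp only [map_add, hx, hy]
    | tmul d h =>
      have e₁ := iotaRetract_tmul hchar hρ hf d h
      have e₂ : iota hf (compCoinvProj hchar f h) =
          GradedTensorProduct.includeRight (Df hf).gr H.gr (H.coinvProj hchar h) :=
        iota_coinv hf (H.coinvProjCoinv hchar h)
      refine (congrArg (iota hf) e₁).trans ?_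
      rw [map_mul, iota_secDf hchar hρ hf, e₂, of_mul_includeRight, LinearMap.rTensor_tmul]
      refine congrArg (GradedTensorProduct.of k (Df hf).gr H.gr) ?_
      generalize coactLin (rhoDf hf) d = z
      induction z using TensorProduct.induction_on with
      | zero => simp
      | add x y hx hy => simp only [map_add, TensorProduct.add_tmul, hx, hy]
      | tmul a b => rfl
  have h₂ : (LinearMap.mul' k H ∘ₗ TensorProduct.map (H.barSection hchar).toLinearMap
      (H.coinvProj hchar).toLinearMap) ∘ₗ H.leftCoactLin = LinearMap.id := by
    refine LinearMap.ext fun h => ?_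
    refine Eq.trans ?_ (LinearMap.congr_fun (congrArg WithConv.ofConv
      (H.meanConv_mul_coinvProj hchar)) h)
    change LinearMap.mul' k H (TensorProduct.map _ _ (H.leftCoactLin h)) =
      LinearMap.mul' k H (TensorProduct.map _ _ (Coalgebra.comul h))
    rw [H.leftCoactLin_apply]
    generalize Coalgebra.comul (R := k) h = z
    induction z using TensorProduct.induction_on with
    | zero => simp
    | add x y hx hy => simp only [map_add, hx, hy]
    | tmul a b => rfl
  have h₃ : TensorProduct.assoc k (Df hf) H.bar H ((coactLin (rhoDf hf)).rTensor H t) =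
    H.leftCoactLin.lTensor (Df hf) t := ht
  rw [h₁, h₃, ← LinearMap.lTensor_comp_apply, h₂, LinearMap.lTensor_id]
  rfl

theorem isInflationIso_iota (hchar : (2 : k) ≠ 0) (hρ : IsCoaction ρ) (hf : IsCoinvMorphism ρ f)
    {B : SuperAlg.{u, x} k} {η : B →ₐ[k] A}
    (hη : ∀ b : B, ρ (η b) = GradedTensorProduct.tmul k (η b) (1 : H)) :
    IsInflationIso ρ η (rhoDf hf) ((toDf hf).comp η) (iota hf) where
  injective := Function.LeftInverse.injective (iotaRetract_iota hchar hρ hf)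
  range := by
    refine le_antisymm ?_ fun t ht => ⟨_, iota_iotaRetract hchar hρ hf ht⟩
    rintro _ ⟨a, rfl⟩
    exact plain_iota_mem_cotensor hρ hf a
  even i a ha := by
    refine Eq.mpr (congrArg (· ∈ _) (plain_iota hf a)) ?_
    exact map_mem_tensorGr (toDf_even hf) (isEven_id H.toSuperAlg) (hρ.even i a ha)
  colinear := iota_colinear hρ hf
  map_base b := by
    have h : coactLin ρ (η b) = η b ⊗ₜ[k] (1 : H) := hη b
    refine (plain_iota hf (η b)).trans ?_
    rw [h]
    rfl

end Inflation

/-! ### Tensor products over B and faithful flatness under retracts. -/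

section RelTensor

variable {k : Type u} [Field k]

section Maps

variable {A : SuperAlg.{u, x} k} {A' : SuperAlg.{u, y} k} {B : SuperAlg.{u, w} k}
  {η : B →ₐ[k] A} {η' : B →ₐ[k] A'}
  {N : Type v} [AddCommGroup N] [Module k N] {l : B →ₐ[k] Module.End k N}
  {N' : Type z} [AddCommGroup N'] [Module k N'] {l' : B →ₐ[k] Module.End k N'}

/-- The class of `a ⊗ n` in `A ⊗_B N`. -/
def relTmul (η : B →ₐ[k] A) (l : B →ₐ[k] Module.End k N) (a : A) (n : N) : RelTensor η l :=
  (balanced η l).mkQ (a ⊗ₜ[k] n)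

theorem relTmul_balanced (a : A) (b : B) (n : N) :
    relTmul η l (a * η b) n = relTmul η l a (l b n) := by
  rw [← sub_eq_zero, relTmul, relTmul, ← map_sub]
  exact (Submodule.Quotient.mk_eq_zero _).2 (Submodule.subset_span ⟨a, b, n, rfl⟩)

theorem relTensor_hom_ext {V : Type*} [AddCommGroup V] [Module k V]
    {F G : RelTensor η l →ₗ[k] V} (h : ∀ a n, F (relTmul η l a n) = G (relTmul η l a n)) :
    F = G :=
  Submodule.linearMap_qext _ (TensorProduct.ext' h)

/-- The map `A ⊗_B N → A' ⊗_B N'` induced by a right linear and a left linear map. -/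
def relTensorMap₂ (α : A →ₗ[k] A') (hα : ∀ a b, α (a * η b) = α a * η' b) (φ : N →ₗ[k] N')
    (hφ : ∀ b n, φ (l b n) = l' b (φ n)) : RelTensor η l →ₗ[k] RelTensor η' l' :=
  Submodule.mapQ _ _ (TensorProduct.map α φ) (by
    refine Submodule.span_le.2 ?_
    rintro _ ⟨a, b, n, rfl⟩
    refine Submodule.subset_span ⟨α a, b, φ n, ?_⟩
    rw [map_sub, TensorProduct.map_tmul, TensorProduct.map_tmul, hα, hφ])

theorem relTensorMap₂_relTmul (α : A →ₗ[k] A') (hα : ∀ a b, α (a * η b) = α a * η' b)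
    (φ : N →ₗ[k] N') (hφ : ∀ b n, φ (l b n) = l' b (φ n)) (a : A) (n : N) :
    relTensorMap₂ α hα φ hφ (relTmul η l a n) = relTmul η' l' (α a) (φ n) := rfl

variable {V : Type*} [AddCommGroup V] [Module k V]

/-- The map `A ⊗_B N → V ⊗ (A' ⊗_B N)` induced by a right linear map `A → V ⊗ A'`. -/
def relTensorInto (l : B →ₐ[k] Module.End k N) (κ : A →ₗ[k] V ⊗[k] A')
    (hκ : ∀ a b, κ (a * η b) = (LinearMap.mulRight k (η' b)).lTensor V (κ a)) :
    RelTensor η l →ₗ[k] V ⊗[k] RelTensor η' l :=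
  (balanced η l).liftQ ((balanced η' l).mkQ.lTensor V ∘ₗ
    (TensorProduct.assoc k V A' N).toLinearMap ∘ₗ κ.rTensor N) (by
    refine Submodule.span_le.2 ?_
    rintro _ ⟨a, b, n, rfl⟩
    refine LinearMap.mem_ker.2 ?_
    rw [map_sub, sub_eq_zero]
    simp only [LinearMap.comp_apply, LinearMap.rTensor_tmul, hκ]
    generalize κ a = t
    induction t using TensorProduct.induction_on with
    | zero => simp
    | add x y hx hy => simp only [map_add, TensorProduct.add_tmul, hx, hy]
    | tmul c d => exact congrArg (c ⊗ₜ[k] ·) (relTmul_balanced (η := η') (l := l) d b n))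

/-- The map `V ⊗ (A' ⊗_B N) → A ⊗_B N` induced by a right linear map `V ⊗ A' → A`. -/
def relTensorFrom (l : B →ₐ[k] Module.End k N) (ν : V ⊗[k] A' →ₗ[k] A)
    (hν : ∀ c d b, ν (c ⊗ₜ[k] (d * η' b)) = ν (c ⊗ₜ[k] d) * η b) :
    V ⊗[k] RelTensor η' l →ₗ[k] RelTensor η l :=
  TensorProduct.lift (LinearMap.mk₂ k
    (fun c => relTensorMap₂ (ν ∘ₗ TensorProduct.mk k V A' c) (hν c) LinearMap.id
      fun _ _ => rfl)
    (fun c c' t => by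
      refine LinearMap.congr_fun (f := relTensorMap₂ _ (hν (c + c')) _ _) (g := _ + _)
        (relTensor_hom_ext fun a n => ?_) t
      rw [LinearMap.add_apply]
      simp only [relTensorMap₂_relTmul, LinearMap.comp_apply, map_add, LinearMap.add_apply]
      simp only [relTmul, TensorProduct.add_tmul, map_add]
      rfl)
    (fun r c t => by
      refine LinearMap.congr_fun (f := relTensorMap₂ _ (hν (r • c)) _ _) (g := r • _)
        (relTensor_hom_ext fun a n => ?_) t
      rw [LinearMap.smul_apply]
      simp only [relTensorMap₂_relTmul, LinearMap.comp_apply, map_smul, LinearMap.smul_apply]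
      simp only [relTmul, ← TensorProduct.smul_tmul', map_smul]
      rfl)
    (fun c => map_add _) (fun r c => map_smul _ r))

theorem relTensorFrom_into (κ : A →ₗ[k] V ⊗[k] A')
    (hκ : ∀ a b, κ (a * η b) = (LinearMap.mulRight k (η' b)).lTensor V (κ a))
    (ν : V ⊗[k] A' →ₗ[k] A) (hν : ∀ c d b, ν (c ⊗ₜ[k] (d * η' b)) = ν (c ⊗ₜ[k] d) * η b)
    (hνκ : ∀ a, ν (κ a) = a) (t : RelTensor η l) :
    relTensorFrom l ν hν (relTensorInto l κ hκ t) = t := by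
  suffices h : relTensorFrom l ν hν ∘ₗ relTensorInto l κ hκ = LinearMap.id from
    LinearMap.congr_fun h t
  refine relTensor_hom_ext fun a n => ?_
  have h : ∀ s : V ⊗[k] A', relTensorFrom l ν hν ((balanced η' l).mkQ.lTensor V
      (TensorProduct.assoc k V A' N (s ⊗ₜ[k] n))) = relTmul η l (ν s) n := fun s => by
    induction s using TensorProduct.induction_on with
    | zero => simp [relTmul]
    | add x y hx hy =>
      simp only [map_add, TensorProduct.add_tmul, hx, hy, relTmul]
    | tmul c d => rfl
  exact (h (κ a)).trans (congrArg (fun a => relTmul η l a n) (hνκ a))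

end Maps

section Exact

/-- A diagram chase in the form used twice below: a retract of an exact sequence is exact. -/
theorem exact_of_retract {X Y Z X' Y' Z' : Type*} [AddCommGroup X] [AddCommGroup Y]
    [AddCommGroup Z] [AddCommGroup X'] [AddCommGroup Y'] [AddCommGroup Z'] [Module k X]
    [Module k Y] [Module k Z] [Module k X'] [Module k Y'] [Module k Z'] {f : X →ₗ[k] Y}
    {g : Y →ₗ[k] Z} {f' : X' →ₗ[k] Y'} {g' : Y' →ₗ[k] Z'} {sX : X' → X} {sY : Y' → Y}
    {sZ : Z' →ₗ[k] Z} {rX : X → X'} {rY : Y → Y'} {rZ : Z → Z'} (h : Function.Exact f g)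
    (hf : ∀ t, sY (f' t) = f (sX t)) (hg : ∀ t, sZ (g' t) = g (sY t))
    (hf' : ∀ t, rY (f t) = f' (rX t)) (hY : ∀ t, rY (sY t) = t)
    (hZ : ∀ t, rZ (sZ t) = t) : Function.Exact f' g' := by
  intro t
  constructor
  · intro ht
    obtain ⟨s, hs⟩ := (h (sY t)).1 (by rw [← hg, ht, map_zero])
    exact ⟨rX s, by rw [← hf', hs, hY]⟩
  · rintro ⟨s, rfl⟩
    refine Function.LeftInverse.injective hZ ?_
    rw [hg, hf, h.apply_apply_eq_zero, map_zero]

variable {A : SuperAlg.{u, x} k} {A' : SuperAlg.{u, y} k} {B : SuperAlg.{u, w} k}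
  {η : B →ₐ[k] A} {η' : B →ₐ[k] A'}

theorem relTensorMap₂_relTensorMap {M N : SuperMod.{u, v, w} B} (g : M.Hom N) (α : A →ₗ[k] A')
    (hα : ∀ a b, α (a * η b) = α a * η' b) (t : RelTensor η M.act) :
    relTensorMap₂ α hα LinearMap.id (fun _ _ => rfl) (relTensorMap η g t) =
      relTensorMap η' g (relTensorMap₂ α hα LinearMap.id (fun _ _ => rfl) t) := by
  suffices h : relTensorMap₂ α hα LinearMap.id (fun _ _ => rfl) ∘ₗ relTensorMap η g =
      relTensorMap η' g ∘ₗ relTensorMap₂ α hα LinearMap.id (fun _ _ => rfl) from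
    LinearMap.congr_fun h t
  exact relTensor_hom_ext fun _ _ => rfl

variable {V : Type*} [AddCommGroup V] [Module k V]

theorem relTensorInto_relTensorMap {M N : SuperMod.{u, v, w} B} (g : M.Hom N)
    (κ : A →ₗ[k] V ⊗[k] A')
    (hκ : ∀ a b, κ (a * η b) = (LinearMap.mulRight k (η' b)).lTensor V (κ a))
    (t : RelTensor η M.act) : relTensorInto N.act κ hκ (relTensorMap η g t) =
      (relTensorMap η' g).lTensor V (relTensorInto M.act κ hκ t) := by
  suffices h : relTensorInto N.act κ hκ ∘ₗ relTensorMap η g =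
      (relTensorMap η' g).lTensor V ∘ₗ relTensorInto M.act κ hκ from LinearMap.congr_fun h t
  refine relTensor_hom_ext fun a m => ?_
  have h : ∀ s : V ⊗[k] A', (balanced η' N.act).mkQ.lTensor V
      (TensorProduct.assoc k V A' N.carrier (s ⊗ₜ[k] g.toLin m)) =
        (relTensorMap η' g).lTensor V ((balanced η' M.act).mkQ.lTensor V
          (TensorProduct.assoc k V A' M.carrier (s ⊗ₜ[k] m))) := fun s => by
    induction s using TensorProduct.induction_on with
    | zero => simp
    | add x y hx hy => simp only [map_add, TensorProduct.add_tmul, hx, hy]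
    | tmul c d => rfl
  exact h (κ a)

theorem relTensorFrom_relTensorMap {M N : SuperMod.{u, v, w} B} (g : M.Hom N)
    (ν : V ⊗[k] A' →ₗ[k] A) (hν : ∀ c d b, ν (c ⊗ₜ[k] (d * η' b)) = ν (c ⊗ₜ[k] d) * η b)
    (t : V ⊗[k] RelTensor η' M.act) :
    relTensorFrom N.act ν hν ((relTensorMap η' g).lTensor V t) =
      relTensorMap η g (relTensorFrom M.act ν hν t) := by
  suffices h : relTensorFrom N.act ν hν ∘ₗ (relTensorMap η' g).lTensor V =
      relTensorMap η g ∘ₗ relTensorFrom M.act ν hν from LinearMap.congr_fun h t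
  refine TensorProduct.ext (LinearMap.ext fun c => relTensor_hom_ext fun _ _ => rfl)

/-- Faithful flatness passes from `A` to a right linear retract `A'` of `A` such that `A` is a right
linear retract of `V ⊗ A'`. -/
theorem FaithfullyFlat.of_retract (hη : FaithfullyFlat η) (q : A →ₗ[k] A')
    (hq : ∀ a b, q (a * η b) = q a * η' b) (s : A' →ₗ[k] A)
    (hs : ∀ a b, s (a * η' b) = s a * η b) (hqs : ∀ a, q (s a) = a) (κ : A →ₗ[k] V ⊗[k] A')
    (hκ : ∀ a b, κ (a * η b) = (LinearMap.mulRight k (η' b)).lTensor V (κ a))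
    (ν : V ⊗[k] A' →ₗ[k] A) (hν : ∀ c d b, ν (c ⊗ₜ[k] (d * η' b)) = ν (c ⊗ₜ[k] d) * η b)
    (hνκ : ∀ a, ν (κ a) = a) : FaithfullyFlat η' := by
  intro L M N f g
  rw [hη L M N f g]
  have hqs' : ∀ (P : SuperMod.{u, w, w} B) (t : RelTensor η' P.act),
      relTensorMap₂ q hq LinearMap.id (l' := P.act) (fun _ _ => rfl)
        (relTensorMap₂ s hs LinearMap.id (l' := P.act) (fun _ _ => rfl) t) = t := by
    intro P t
    suffices h : relTensorMap₂ q hq LinearMap.id (l' := P.act) (fun _ _ => rfl) ∘ₗ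
        relTensorMap₂ s hs LinearMap.id (l' := P.act) (fun _ _ => rfl) = LinearMap.id from
      LinearMap.congr_fun h t
    exact relTensor_hom_ext fun a n => congrArg (fun a => relTmul η' P.act a n) (hqs a)
  constructor
  · intro h
    -- The sequence for `A'` is a retract of the one for `A`, through `s` and `q`.
    exact exact_of_retract h (relTensorMap₂_relTensorMap f s hs)
      (relTensorMap₂_relTensorMap g s hs) (relTensorMap₂_relTensorMap f q hq) (hqs' M) (hqs' N)
  · intro h
    -- Tensoring with `V` over the field keeps the sequence for `A'` exact, and the sequence for `A`
    -- is a retract of the result.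
    exact exact_of_retract (Module.Flat.lTensor_exact V h) (relTensorInto_relTensorMap f κ hκ)
      (relTensorInto_relTensorMap g κ hκ) (relTensorFrom_relTensorMap f ν hν)
      (relTensorFrom_into κ hκ ν hν hνκ) (relTensorFrom_into κ hκ ν hν hνκ)

end Exact

end RelTensor

/-! ### D_f is an H̄-Galois extension of B. -/

section Galois

variable {k : Type u} [Field k] {H : HopfSuperAlg.{u, v} k} {A : SuperAlg.{u, w} k}
  {ρ : A →ₐ[k] (A.gr ᵍ⊗[k] H.gr)} {B : SuperAlg.{u, x} k} {η : B →ₐ[k] A}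

theorem comm_includeLeft (D : SuperAlg.{u, w} k) (E : SuperAlg.{u, v} k) (d : D) :
    GradedTensorProduct.comm (R := k) D.gr E.gr (GradedTensorProduct.includeLeft D.gr E.gr d) =
      GradedTensorProduct.includeRight E.gr D.gr d := by
  suffices h : (GradedTensorProduct.comm (R := k) D.gr E.gr).toLinearMap ∘ₗ
      (GradedTensorProduct.includeLeft D.gr E.gr).toLinearMap =
        (GradedTensorProduct.includeRight E.gr D.gr).toLinearMap from LinearMap.congr_fun h d
  refine DirectSum.decompose_lhom_ext D.gr fun i => LinearMap.ext fun a => ?_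
  have h := GradedTensorProduct.comm_coe_tmul_coe (R := k) D.gr E.gr a
    (⟨1, SetLike.GradedOne.one_mem⟩ : E.gr 0)
  rw [zero_mul, uzpow_zero, one_smul] at h
  exact h

/-- An element whose image in `D □ H` is of the form `d ⊗ 1` is coinvariant. -/
theorem IsInflationIso.coinv_of_eq {D : SuperAlg.{u, w} k} {ρD : D →ₐ[k] (D.gr ᵍ⊗[k] H.bar.gr)}
    {ηD : B →ₐ[k] D} {φ : A →ₐ[k] (D.gr ᵍ⊗[k] H.gr)} (hφ : IsInflationIso ρ η ρD ηD φ) {a : A}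
    {d : D} (ha : φ a = GradedTensorProduct.tmul k d (1 : H)) :
    ρ a = GradedTensorProduct.tmul k a (1 : H) := by
  have hinj : Function.Injective
      ((plain D H.toSuperAlg ∘ₗ φ.toLinearMap).rTensor H.carrier) :=
    Module.Flat.rTensor_preserves_injective_linearMap _ hφ.injective
  have ha' : plain D H.toSuperAlg (φ a) = d ⊗ₜ[k] (1 : H) := ha
  have h₁ : Coalgebra.comul (R := k) (1 : H) = 1 ⊗ₜ[k] 1 := H.comul_one
  refine hinj ((TensorProduct.assoc k D H H).injective ((hφ.colinear a).trans ?_))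
  rw [ha', LinearMap.lTensor_tmul, h₁]
  change _ = TensorProduct.assoc k D H H ((plain D H.toSuperAlg (φ a)) ⊗ₜ[k] (1 : H))
  rw [ha', TensorProduct.assoc_tmul]

variable {f : H.coinv →ₐ[k] A}

theorem secDf_toDf_base (hchar : (2 : k) ≠ 0)
    (hη : ∀ b : B, ρ (η b) = GradedTensorProduct.tmul k (η b) (1 : H))
    (hf : IsCoinvMorphism ρ f) (b : B) : secDf hchar hf (toDf hf (η b)) = η b := by
  have h : coactLin ρ (η b) = η b ⊗ₜ[k] (1 : H) := hη b
  change LinearMap.mul' k A (TensorProduct.map LinearMap.id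
    (compAntiMean hchar f).toLinearMap (coactLin ρ (η b))) = _
  rw [h]
  change η b * compAntiMean hchar f 1 = _
  rw [map_one, mul_one]

theorem rhoDf_toDf_base (hη : ∀ b : B, ρ (η b) = GradedTensorProduct.tmul k (η b) (1 : H))
    (hf : IsCoinvMorphism ρ f) (b : B) : rhoDf hf ((toDf hf).comp η b) =
      GradedTensorProduct.tmul k ((toDf hf).comp η b) (1 : H.bar) := by
  have h : coactLin ρ (η b) = η b ⊗ₜ[k] (1 : H) := hη b
  refine (coactLin_rhoDf_toDf hf (η b)).trans ?_
  rw [h]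
  exact congrArg (_ ⊗ₜ[k] ·) (map_one H.toHbar)

/-- If d is coinvariant, `iota_secDf` gives ι(s(d)) = d ⊗ γ(1) = d ⊗ 1. Hence s(d) is
`H`-coinvariant in `A`, so it comes from `B`, and its image in `D_f` is d. -/
theorem coinv_rhoDf (hchar : (2 : k) ≠ 0) (hA : IsGalois H A ρ B η) (hf : IsCoinvMorphism ρ f) (d : Df hf) :
    d ∈ ((toDf hf).comp η).range ↔ rhoDf hf d = GradedTensorProduct.tmul k d (1 : H.bar) := by
  have hη : ∀ b : B, ρ (η b) = GradedTensorProduct.tmul k (η b) (1 : H) :=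
    fun b => (hA.coinv _).1 ⟨b, rfl⟩
  constructor
  · rintro ⟨b, rfl⟩
    exact rhoDf_toDf_base hη hf b
  · intro hd
    have hd' : coactLin (rhoDf hf) d = d ⊗ₜ[k] (1 : H.bar) := hd
    have h := iota_secDf hchar hA.coaction hf d
    rw [hd', LinearMap.lTensor_tmul, AlgHom.toLinearMap_apply, map_one] at h
    obtain ⟨b, hb⟩ := (hA.coinv _).2
      ((isInflationIso_iota hchar hA.coaction hf hη).coinv_of_eq h)
    refine ⟨b, ?_⟩
    have h' := congrArg (toDf hf) hb
    rw [toDf_secDf hchar hA.coaction] at h'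
    exact h'

theorem faithfullyFlat_toDf (hchar : (2 : k) ≠ 0) (hA : IsGalois H A ρ B η) (hf : IsCoinvMorphism ρ f) :
    FaithfullyFlat ((toDf hf).comp η) := by
  have hη : ∀ b : B, ρ (η b) = GradedTensorProduct.tmul k (η b) (1 : H) :=
    fun b => (hA.coinv _).1 ⟨b, rfl⟩
  have hρ := hA.coaction
  -- The signed swap puts `D_f` on the right, next to the `B`-module, as the retract criterion
  -- requires.
  let κ : A →ₐ[k] (H.gr ᵍ⊗[k] (Df hf).gr) :=
    (GradedTensorProduct.comm (R := k) (Df hf).gr H.gr).toAlgHom.comp (iota hf)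
  let ν : (H.gr ᵍ⊗[k] (Df hf).gr) →ₐ[k] A := (iotaRetract hchar hρ hf).comp
    (GradedTensorProduct.comm (R := k) (Df hf).gr H.gr).symm.toAlgHom
  have hνκ : ∀ a, ν (κ a) = a := fun a => by
    change iotaRetract hchar hρ hf ((GradedTensorProduct.comm (R := k) (Df hf).gr H.gr).symm
      (GradedTensorProduct.comm (R := k) (Df hf).gr H.gr (iota hf a))) = a
    rw [AlgEquiv.symm_apply_apply, iotaRetract_iota]
  have hκη : ∀ b, κ (η b) =
      GradedTensorProduct.includeRight H.gr (Df hf).gr ((toDf hf).comp η b) := fun b =>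
    (congrArg _ ((isInflationIso_iota hchar hρ hf hη).map_base b)).trans
      (comm_includeLeft (Df hf) H.toSuperAlg _)
  have hκmul : ∀ (t : H ⊗[k] Df hf) (b : B),
      GradedTensorProduct.of k H.gr (Df hf).gr t * κ (η b) =
        GradedTensorProduct.of k H.gr (Df hf).gr
          ((LinearMap.mulRight k ((toDf hf).comp η b)).lTensor H t) := fun t b => by
    rw [hκη, of_mul_includeRight]
  refine hA.faithfullyFlat.of_retract (V := H) (toDf hf).toLinearMap (fun a b => map_mul (toDf hf) a (η b))
    (secDf hchar hf).toLinearMap ?_ (toDf_secDf hchar hρ hf)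
    (plain H.toSuperAlg (Df hf) ∘ₗ κ.toLinearMap) ?_
    (ν.toLinearMap ∘ₗ (GradedTensorProduct.of k H.gr (Df hf).gr).toLinearMap) ?_ hνκ
  · intro d b
    refine (map_mul (secDf hchar hf) d _).trans ?_
    exact congrArg _ (secDf_toDf_base hchar hη hf b)
  · intro a b
    exact (congrArg (plain H.toSuperAlg (Df hf)) (map_mul κ a (η b))).trans (hκmul _ b)
  · intro h d b
    have e := congrArg ν (hκmul (h ⊗ₜ[k] d) b)
    rw [map_mul, hνκ] at e
    exact e.symm

theorem gtMap_includeLeft {A' : SuperAlg.{u, y} k} {E : SuperAlg.{u, v} k} {E' : SuperAlg.{u, z} k}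
    (α : A →ₐ[k] A') (hα : IsEven A.gr A'.gr α) (φ : E →ₐ[k] E') (hφ : IsEven E.gr E'.gr φ)
    (a : A) : gtMap α hα φ hφ (GradedTensorProduct.includeLeft A.gr E.gr a) =
      GradedTensorProduct.includeLeft A'.gr E'.gr (α a) := by
  refine (GradedTensorProduct.of k A'.gr E'.gr).symm.injective
    ((plain_gtMap α hα φ hφ _).trans ?_)
  exact congrArg (α a ⊗ₜ[k] ·) (map_one φ)

/-- The map `A ⊗_B A → D_f ⊗_B D_f` induced by the quotient map. -/
def relTensorToDf (hf : IsCoinvMorphism ρ f) (η : B →ₐ[k] A) :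
    RelTensor η ((Algebra.lmul k A).comp η) →ₗ[k]
      RelTensor ((toDf hf).comp η) ((Algebra.lmul k (Df hf)).comp ((toDf hf).comp η)) :=
  relTensorMap₂ (toDf hf).toLinearMap (fun a b => map_mul (toDf hf) a (η b))
    (toDf hf).toLinearMap (fun b n => map_mul (toDf hf) (η b) n)

/-- β for `D_f` composed with the projection from `A ⊗_B A` equals β for `A` followed by the
surjection onto `D_f ⊗ H̄`. -/
theorem beta_rhoDf_surjective (hA : IsGalois H A ρ B η) (hf : IsCoinvMorphism ρ f)
    (hηD : ∀ b : B, rhoDf hf ((toDf hf).comp η b) =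
      GradedTensorProduct.tmul k ((toDf hf).comp η b) (1 : H.bar)) :
    Function.Surjective (beta (H := H.bar) (rhoDf hf) ((toDf hf).comp η) hηD) := by
  have hη : ∀ b : B, ρ (η b) = GradedTensorProduct.tmul k (η b) (1 : H) :=
    fun b => (hA.coinv _).1 ⟨b, rfl⟩
  let π := gtMap (toDf hf) (toDf_even hf) H.toHbar H.toHbar_even
  have hQ : beta (H := H.bar) (rhoDf hf) ((toDf hf).comp η) hηD ∘ₗ relTensorToDf hf η =
      π.toLinearMap ∘ₗ beta ρ η hη := by
    refine relTensor_hom_ext fun a a' => ?_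
    refine Eq.trans ?_ (map_mul π (GradedTensorProduct.includeLeft A.gr H.gr a) (ρ a')).symm
    rw [gtMap_includeLeft]
    rfl
  have hπ : Function.Surjective π := fun y => by
    obtain ⟨t, ht⟩ := TensorProduct.map_surjective (g := (toDf hf).toLinearMap)
      (g' := H.toHbar.toLinearMap) (toDf_surjective hf) H.toHbar_surjective
      (plain (Df hf) H.bar.toSuperAlg y)
    exact ⟨GradedTensorProduct.of k A.gr H.gr t,
      (GradedTensorProduct.of k (Df hf).gr H.bar.gr).symm.injective
        ((plain_gtMap _ (toDf_even hf) _ H.toHbar_even _).trans ht)⟩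
  have hsurj : Function.Surjective (π.toLinearMap ∘ₗ beta ρ η hη) :=
    hπ.comp hA.beta_bijective.2
  rw [← hQ] at hsurj
  exact Function.Surjective.of_comp hsurj

/-- The left action of `A` on `A ⊗_B N`. -/
def relMulLeft {N : Type*} [AddCommGroup N] [Module k N] {l : B →ₐ[k] Module.End k N} (a : A) :
    RelTensor η l →ₗ[k] RelTensor η l :=
  relTensorMap₂ (LinearMap.mulLeft k a) (fun x _ => (mul_assoc a x _).symm) LinearMap.id
    (fun _ _ => rfl)

theorem relTensorToDf_relMulLeft (hf : IsCoinvMorphism ρ f) (a : A)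
    (z : RelTensor η ((Algebra.lmul k A).comp η)) :
    relTensorToDf hf η (relMulLeft a z) =
      relMulLeft (η := (toDf hf).comp η) (toDf hf a) (relTensorToDf hf η z) := by
  suffices h : relTensorToDf hf η ∘ₗ relMulLeft a =
      relMulLeft (η := (toDf hf).comp η) (toDf hf a) ∘ₗ relTensorToDf hf η from
    LinearMap.congr_fun h z
  refine relTensor_hom_ext fun x x' => ?_
  change relTmul _ _ (toDf hf (a * x)) (toDf hf x') =
    relTmul _ _ (toDf hf a * toDf hf x) (toDf hf x')
  rw [map_mul]

theorem beta_relMulLeft (hη : ∀ b : B, ρ (η b) = GradedTensorProduct.tmul k (η b) (1 : H)) (a : A)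
    (z : RelTensor η ((Algebra.lmul k A).comp η)) : beta ρ η hη (relMulLeft a z) =
      GradedTensorProduct.includeLeft A.gr H.gr a * beta ρ η hη z := by
  suffices h : beta ρ η hη ∘ₗ relMulLeft a =
      LinearMap.mulLeft k (GradedTensorProduct.includeLeft A.gr H.gr a) ∘ₗ beta ρ η hη from
    LinearMap.congr_fun h z
  refine relTensor_hom_ext fun x x' => ?_
  change GradedTensorProduct.includeLeft A.gr H.gr (a * x) * ρ x' =
    GradedTensorProduct.includeLeft A.gr H.gr a *
      (GradedTensorProduct.includeLeft A.gr H.gr x * ρ x')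
  rw [map_mul, mul_assoc]

theorem HopfSuperAlg.barSection_even (hchar : (2 : k) ≠ 0) :
    IsEven H.bar.gr H.gr (H.barSection hchar) := by
  rintro i _ ⟨a, ha, rfl⟩
  exact H.mean_even hchar i a ha

/-- A left inverse is explicit: lift from `D_f ⊗ H̄` to `A ⊗ H` by the two sections, apply β⁻¹ for
`A`, and project to `D_f ⊗_B D_f`. -/
theorem beta_rhoDf_injective (hchar : (2 : k) ≠ 0) (hA : IsGalois H A ρ B η)
    (hf : IsCoinvMorphism ρ f)
    (hηD : ∀ b : B, rhoDf hf ((toDf hf).comp η b) =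
      GradedTensorProduct.tmul k ((toDf hf).comp η b) (1 : H.bar)) :
    Function.Injective (beta (H := H.bar) (rhoDf hf) ((toDf hf).comp η) hηD) := by
  have hη : ∀ b : B, ρ (η b) = GradedTensorProduct.tmul k (η b) (1 : H) :=
    fun b => (hA.coinv _).1 ⟨b, rfl⟩
  have hρ := hA.coaction
  let e := LinearEquiv.ofBijective (beta ρ η hη) hA.beta_bijective
  let E := relTensorToDf hf η ∘ₗ e.symm.toLinearMap
  have hE : ∀ z, E (beta ρ η hη z) = relTensorToDf hf η z := fun z =>
    congrArg (relTensorToDf hf η) (e.symm_apply_apply z)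
  have hEmul : ∀ a y, E (GradedTensorProduct.includeLeft A.gr H.gr a * y) =
      relMulLeft (η := (toDf hf).comp η) (toDf hf a) (E y) := fun a y => by
    obtain ⟨z, rfl⟩ := hA.beta_bijective.2 y
    rw [← beta_relMulLeft, hE, hE, relTensorToDf_relMulLeft]
  let γ := gtMap (secDf hchar hf) (secDf_even hchar hρ hf) (H.barSection hchar)
    (HopfSuperAlg.barSection_even hchar)
  -- `E` is left `A`-linear with values in `D_f ⊗_B D_f`, so it depends on the first tensor factor
  -- only through its class in `D_f`.
  have hEs : ∀ t : A ⊗[k] H, E (GradedTensorProduct.of k A.gr H.gr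
      ((secDf hchar hf).toLinearMap.rTensor H (TensorProduct.map (toDf hf).toLinearMap
        LinearMap.id t))) = E (GradedTensorProduct.of k A.gr H.gr t) := fun t => by
    induction t using TensorProduct.induction_on with
    | zero => simp
    | add x y hx hy => simp only [map_add, hx, hy]
    | tmul a h =>
      have h₁ : ∀ a : A, E (GradedTensorProduct.of k A.gr H.gr (a ⊗ₜ[k] h)) =
          relMulLeft (η := (toDf hf).comp η) (toDf hf a)
            (E (GradedTensorProduct.includeRight A.gr H.gr h)) := fun a => by
        rw [← hEmul]
        exact congrArg E (GradedTensorProduct.tmul_one_mul_one_tmul (R := k) A.gr H.gr a h).symm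
      refine (h₁ _).trans ((h₁ a).trans ?_).symm
      refine congrArg (fun d => relMulLeft (η := (toDf hf).comp η) d _) ?_
      exact (toDf_secDf hchar hρ hf (toDf hf a)).symm
  -- The two arguments of `E` may differ, but by `iota_secDf` they have the same image in `D_f ⊗ H`,
  -- which is all that `E` detects.
  have hγ : ∀ d, E (γ (rhoDf hf d)) = E (ρ (secDf hchar hf d)) := fun d => by
    have h₁ : TensorProduct.map (toDf hf).toLinearMap LinearMap.id
        (coactLin ρ (secDf hchar hf d)) =
          (H.barSection hchar).toLinearMap.lTensor (Df hf) (coactLin (rhoDf hf) d) :=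
      (plain_iota hf _).symm.trans (iota_secDf hchar hρ hf d)
    refine Eq.trans ?_ (hEs (coactLin ρ (secDf hchar hf d)))
    rw [h₁, ← LinearMap.comp_apply (LinearMap.rTensor _ _), LinearMap.rTensor_comp_lTensor]
    exact congrArg E (plain_gtMap _ (secDf_even hchar hρ hf) _
      (HopfSuperAlg.barSection_even hchar) (rhoDf hf d))
  have hleft : (E ∘ₗ γ.toLinearMap) ∘ₗ
      beta (H := H.bar) (rhoDf hf) ((toDf hf).comp η) hηD = LinearMap.id := by
    refine relTensor_hom_ext fun d d' => ?_
    change E (γ (GradedTensorProduct.includeLeft (Df hf).gr H.bar.gr d * rhoDf hf d')) = _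
    rw [map_mul, gtMap_includeLeft, hEmul, hγ, ← hEmul]
    refine (hE (relTmul η _ (secDf hchar hf d) (secDf hchar hf d'))).trans ?_
    exact congrArg₂ (relTmul _ _) (toDf_secDf hchar hρ hf d) (toDf_secDf hchar hρ hf d')
  exact Function.LeftInverse.injective (g := E ∘ₗ γ.toLinearMap)
    fun z => LinearMap.congr_fun hleft z

theorem isGalois_rhoDf (hchar : (2 : k) ≠ 0) (hA : IsGalois H A ρ B η)
    (hf : IsCoinvMorphism ρ f) : IsGalois H.bar (Df hf) (rhoDf hf) B ((toDf hf).comp η) where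
  coaction := isCoaction_rhoDf hA.coaction hf
  even i b hb := toDf_even hf i _ (hA.even i b hb)
  injective b b' h := hA.injective (by
    have hη : ∀ b : B, ρ (η b) = GradedTensorProduct.tmul k (η b) (1 : H) :=
      fun b => (hA.coinv _).1 ⟨b, rfl⟩
    rw [← secDf_toDf_base hchar hη hf b, ← secDf_toDf_base hchar hη hf b']
    exact congrArg (secDf hchar hf) h)
  coinv := coinv_rhoDf hchar hA hf
  faithfullyFlat := faithfullyFlat_toDf hchar hA hf
  beta_bijective := ⟨beta_rhoDf_injective hchar hA hf _, beta_rhoDf_surjective hA hf _⟩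

end Galois

/-! ### Coinvariants of H inside an inflation. -/

section Inflation

variable {k : Type u} [Field k]

/-- The projection of a super-algebra to its component of degree `i`. -/
def SuperAlg.component (D : SuperAlg.{u, v} k) (i : ZMod 2) : D →ₗ[k] D :=
  (D.gr i).subtype ∘ₗ DirectSum.component k (ZMod 2) (fun i => D.gr i) i ∘ₗ
    (DirectSum.decomposeLinearEquiv D.gr).toLinearMap

theorem SuperAlg.component_of_mem (D : SuperAlg.{u, v} k) {i : ZMod 2} {d : D}
    (hd : d ∈ D.gr i) : D.component i d = d :=
  DirectSum.decompose_of_mem_same D.gr hd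

theorem SuperAlg.component_of_mem_ne (D : SuperAlg.{u, v} k) {i j : ZMod 2} {d : D}
    (hd : d ∈ D.gr j) (hij : j ≠ i) : D.component i d = 0 :=
  DirectSum.decompose_of_mem_ne D.gr hd hij

theorem SuperAlg.component_mem (D : SuperAlg.{u, v} k) (i : ZMod 2) (d : D) :
    D.component i d ∈ D.gr i :=
  SetLike.coe_mem (DirectSum.decompose D.gr d i)

theorem SuperAlg.component_add_component (D : SuperAlg.{u, v} k) (i : ZMod 2) (d : D) :
    D.component i d + D.component (i + 1) d = d := by
  induction d using DirectSum.Decomposition.inductionOn D.gr with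
  | zero => simp
  | add a b ha hb =>
    rw [map_add, map_add, add_add_add_comm, ha, hb]
  | @homogeneous j a =>
    have hij : ∀ i j : ZMod 2, j = i ∨ j = i + 1 := by decide
    have hne : ∀ i : ZMod 2, i ≠ i + 1 := by decide
    rcases hij i j with rfl | rfl
    · rw [D.component_of_mem a.2, D.component_of_mem_ne a.2 (hne _), add_zero]
    · rw [D.component_of_mem a.2, D.component_of_mem_ne a.2 (hne _).symm, zero_add]

theorem eq_zero_of_mem_tensorGr (D : SuperAlg.{u, w} k) (E : SuperAlg.{u, v} k)
    {t : D ⊗[k] E} (h₀ : t ∈ tensorGr D.gr E.gr 0) (h₁ : t ∈ tensorGr D.gr E.gr 1) : t = 0 := by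
  -- `F` projects `D ⊗ E` onto total degree 0: it fixes that part and kills total degree 1.
  let F := TensorProduct.map (D.component 0) (E.component 0) +
    TensorProduct.map (D.component 1) (E.component 1)
  have e₀ : tensorGr D.gr E.gr 0 ≤ Submodule.comap (F - LinearMap.id) ⊥ := by
    refine tensorGr_le_iff.2 fun j l hjl a ha b hb => (Submodule.mem_bot k).2 ?_
    have hl : ∀ j l : ZMod 2, j + l = 0 → l = j := by decide
    obtain rfl := hl j l hjl
    rcases zmod_two l with rfl | rfl
    · simp [F, D.component_of_mem ha, E.component_of_mem hb,
        D.component_of_mem_ne ha (i := 1) (by decide)]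
    · simp [F, D.component_of_mem ha, E.component_of_mem hb,
        D.component_of_mem_ne ha (i := 0) (by decide)]
  have e₁ : tensorGr D.gr E.gr 1 ≤ Submodule.comap F ⊥ := by
    refine tensorGr_le_iff.2 fun j l hjl a ha b hb => (Submodule.mem_bot k).2 ?_
    have hl : ∀ j l : ZMod 2, j + l = 1 → l = j + 1 := by decide
    obtain rfl := hl j l hjl
    rcases zmod_two j with rfl | rfl
    · simp [F, E.component_of_mem_ne hb (i := 0) (by decide),
        D.component_of_mem_ne ha (i := 1) (by decide)]
    · simp [F, E.component_of_mem_ne hb (i := 1) (by decide),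
        D.component_of_mem_ne ha (i := 0) (by decide)]
  have h₀' : F t - t = 0 := e₀ h₀
  have h₁' : F t = 0 := e₁ h₁
  rw [h₁', zero_sub, neg_eq_zero] at h₀'
  exact h₀'

variable {H : HopfSuperAlg.{u, v} k} {A : SuperAlg.{u, w} k}
  {ρ : A →ₐ[k] (A.gr ᵍ⊗[k] H.gr)} {B : SuperAlg.{u, x} k} {η : B →ₐ[k] A} {D : SuperAlg.{u, w} k}
  {ρD : D →ₐ[k] (D.gr ᵍ⊗[k] H.bar.gr)} {ηD : B →ₐ[k] D} {φ : A →ₐ[k] (D.gr ᵍ⊗[k] H.gr)}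

/-- An injective even map reflects degrees: the component of `a` in the other degree has an image
lying in both degrees, hence vanishes. -/
theorem IsInflationIso.mem_of_mem_tensorGr (hφ : IsInflationIso ρ η ρD ηD φ) {i : ZMod 2} {a : A}
    (ha : plain D H.toSuperAlg (φ a) ∈ tensorGr D.gr H.gr i) : a ∈ A.gr i := by
  let F := plain D H.toSuperAlg ∘ₗ φ.toLinearMap
  have h : F (A.component (i + 1) a) ∈ tensorGr D.gr H.gr i := by
    have e : F (A.component (i + 1) a) = F a - F (A.component i a) := by
      rw [eq_sub_iff_add_eq', ← map_add, A.component_add_component]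
    rw [e]
    exact sub_mem ha (hφ.even i _ (A.component_mem i a))
  have h' := hφ.even (i + 1) _ (A.component_mem (i + 1) a)
  have h₀ : F (A.component (i + 1) a) = 0 := by
    rcases zmod_two i with rfl | rfl
    · exact eq_zero_of_mem_tensorGr D H.toSuperAlg h h'
    · exact eq_zero_of_mem_tensorGr D H.toSuperAlg h' h
  have h₁ : A.component (i + 1) a = 0 :=
    hφ.injective (h₀.trans (map_zero F).symm)
  have h₂ := A.component_add_component i a
  rw [h₁, add_zero] at h₂
  rw [← h₂]
  exact A.component_mem i a

theorem one_tmul_mem_cotensor (r : H.coinv) :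
    (1 : D) ⊗ₜ[k] (r : H) ∈ cotensor H ρD := by
  have h : coactLin ρD 1 = 1 ⊗ₜ[k] 1 := map_one ρD
  change TensorProduct.assoc k D H.bar H (coactLin ρD 1 ⊗ₜ[k] (r : H)) =
    (1 : D) ⊗ₜ[k] H.leftCoactLin r
  rw [h, (H.mem_coinv r).1 r.2]
  rfl

theorem IsInflationIso.exists_eq (hφ : IsInflationIso ρ η ρD ηD φ) (r : H.coinv) :
    GradedTensorProduct.includeRight D.gr H.gr (r : H) ∈ φ.range := by
  have h := one_tmul_mem_cotensor (ρD := ρD) r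
  rw [← hφ.range] at h
  exact h

/-- The algebra morphism `R → A` which corresponds to `r ↦ 1 ⊗ r` under `A ≅ D □ H`. -/
def IsInflationIso.coinvHom (hφ : IsInflationIso ρ η ρD ηD φ) : H.coinv →ₐ[k] A :=
  (AlgEquiv.ofInjective φ hφ.injective).symm.toAlgHom.comp
    (((GradedTensorProduct.includeRight D.gr H.gr).comp H.coinv.val).codRestrict φ.range
      hφ.exists_eq)

theorem IsInflationIso.apply_coinvHom (hφ : IsInflationIso ρ η ρD ηD φ) (r : H.coinv) :
    φ (hφ.coinvHom r) = GradedTensorProduct.includeRight D.gr H.gr (r : H) :=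
  congrArg Subtype.val ((AlgEquiv.ofInjective φ hφ.injective).apply_symm_apply
    ⟨_, hφ.exists_eq r⟩)

/-- Colinearity may be tested after the injection φ ⊗ id, where both sides become 1 ⊗ Δ(r). -/
theorem IsInflationIso.isCoinvMorphism (hφ : IsInflationIso ρ η ρD ηD φ) :
    IsCoinvMorphism ρ hφ.coinvHom where
  even i r hr := by
    refine hφ.mem_of_mem_tensorGr ?_
    rw [hφ.apply_coinvHom]
    have h := tmul_mem_tensorGr (𝒱 := D.gr) SetLike.GradedOne.one_mem hr
    rw [zero_add] at h
    exact h
  colinear r := by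
    let F := plain D H.toSuperAlg ∘ₗ φ.toLinearMap
    have hinj : Function.Injective (F.rTensor H.carrier) :=
      Module.Flat.rTensor_preserves_injective_linearMap _ hφ.injective
    refine hinj ((TensorProduct.assoc k D H H).injective ((hφ.colinear _).trans ?_))
    have h₁ : plain D H.toSuperAlg (φ (hφ.coinvHom r)) = 1 ⊗ₜ[k] (r : H) := hφ.apply_coinvHom r
    have h₂ : F ∘ₗ hφ.coinvHom.toLinearMap =
        TensorProduct.mk k D H 1 ∘ₗ H.coinv.val.toLinearMap :=
      LinearMap.ext hφ.apply_coinvHom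
    have h₃ : ∀ t : H ⊗[k] H, (1 : D) ⊗ₜ[k] t =
        TensorProduct.assoc k D H H ((TensorProduct.mk k D H 1).rTensor H t) := fun t => by
      induction t using TensorProduct.induction_on with
      | zero => simp
      | add x y hx hy => simp only [map_add, TensorProduct.tmul_add, hx, hy]
      | tmul x y => rfl
    rw [h₁, LinearMap.lTensor_tmul, ← LinearMap.rTensor_comp_apply, h₂,
      LinearMap.rTensor_comp_apply, H.rTensor_val_coinvCoact, ← h₃]

end Inflation

end SuperHopf

end

/-! ### The proposition. -/

open scoped TensorProduct
theorem proposition3p6 {k : Type*} [Field k] (hchar : ringChar k ≠ 2)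
    (H : SuperHopf.HopfSuperAlg k) (B : SuperHopf.SuperAlg k) (hB : Nontrivial B)
    (A : SuperHopf.SuperAlg k) (ρ : A →ₐ[k] (A.gr ᵍ⊗[k] H.gr)) (η : B →ₐ[k] A)
    (hA : SuperHopf.IsGalois H A ρ B η) :
    ((∃ (D : SuperHopf.SuperAlg k) (ρD : D →ₐ[k] (D.gr ᵍ⊗[k] H.bar.gr)) (ηD : B →ₐ[k] D),
        SuperHopf.IsGalois H.bar D ρD B ηD ∧ SuperHopf.ArisesFrom ρ η ρD ηD) ↔
      ∃ f : H.coinv →ₐ[k] A, SuperHopf.IsCoinvMorphism ρ f) ∧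
    ∀ (f : H.coinv →ₐ[k] A) (hf : SuperHopf.IsCoinvMorphism ρ f),
      ∃ ρD : SuperHopf.Df hf →ₐ[k] ((SuperHopf.Df hf).gr ᵍ⊗[k] H.bar.gr),
        (∀ a : A, ρD (SuperHopf.toDf hf a) =
          SuperHopf.gtMap (SuperHopf.toDf hf) (SuperHopf.toDf_even hf)
            H.toHbar H.toHbar_even (ρ a)) ∧
        SuperHopf.IsGalois H.bar (SuperHopf.Df hf) ρD B ((SuperHopf.toDf hf).comp η) ∧
        SuperHopf.IsInflationIso ρ η ρD ((SuperHopf.toDf hf).comp η) (SuperHopf.iota hf) := by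
  have h2 : (2 : k) ≠ 0 := Ring.two_ne_zero hchar
  have hη : ∀ b : B, ρ (η b) = GradedTensorProduct.tmul k (η b) (1 : H) :=
    fun b => (hA.coinv _).1 ⟨b, rfl⟩
  refine ⟨⟨?_, ?_⟩, fun f hf => ⟨SuperHopf.rhoDf hf, SuperHopf.rhoDf_toDf hf,
    SuperHopf.isGalois_rhoDf h2 hA hf, SuperHopf.isInflationIso_iota h2 hA.coaction hf hη⟩⟩
  · rintro ⟨D, ρD, ηD, -, φ, hφ⟩
    exact ⟨hφ.coinvHom, hφ.isCoinvMorphism⟩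
  · rintro ⟨f, hf⟩
    exact ⟨SuperHopf.Df hf, SuperHopf.rhoDf hf, (SuperHopf.toDf hf).comp η,
      SuperHopf.isGalois_rhoDf h2 hA hf, SuperHopf.iota hf,
      SuperHopf.isInflationIso_iota h2 hA.coaction hf hη⟩
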